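/- Let $q\ge 0$ and let $M$ be a connected smooth manifold (Hausdorff, second countable, without boundary) of dimension $q+1$, with a foliation $\mathcal F$ of dimension one. Here a foliation of codimension $q$ is given, up to equivalence, by a Haefliger cocycle: an open covering $\{U_i\}$ of $M$, smooth submersions $\pi_i\colon U_i\to\mathbb R^q$, and local diffeomorphisms $\gamma_{ij}\colon \pi_j(U_i\cap U_j)\to\pi_i(U_i\cap U_j)$ with $\pi_i=\gamma_{ij}\circ\pi_j$ on $U_i\cap U_j$; two cocycles are equivalent if their union is a cocycle after adding the necessary maps $\gamma_{ij}$. Assume that $\mathcal F$ is Riemannian, that is, there are Riemannian metrics $h_i$ on $\pi_i(U_i)$ with $\gamma_{ij}^*h_i=h_j$, and that $\mathcal F$ is transversally complete, that is, there is a Riemannian metric $g$ on $M$ such that - $g$ is bundle-like: for some cocycle representing $\mathcal F$ and some metrics $h_i$ as above, $g(v,w)=h_i\bigl((\pi_i)_*v,(\pi_i)_*w\bigr)$ for all $x\in U_i$ and all $v,w\in T_xM$ orthogonal to $T_x\mathcal F$; - every maximal geodesic of $(M,g)$ that is orthogonal to the leaves of $\mathcal F$ is defined on all of $\mathbb R$.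 Then at least one of the following holds: 1. $(M,\mathcal F)$ is an $\mathbb R$-bundle, that is, there are a smooth manifold $B$ of dimension $q$ and a smooth locally trivial fibre bundle $p\colon M\to B$ with fibre $\mathbb R$ whose fibres are the leaves of $\mathcal F$; 2. the closure in $M$ of every leaf of $\mathcal F$ is compact. -/

import Mathlib

open scoped Manifold ContDiff Topology
open Set

universe w u

noncomputable section

/-- A Riemannian metric of class `C^∞` on a manifold modelled on `ℝⁿ`. -/
abbrev SmoothMetric (n : ℕ) (M : Type u) [TopologicalSpace M]
    [ChartedSpace (EuclideanSpace ℝ (Fin n)) M] [IsManifold (𝓡 n) ∞ M] :=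
  Bundle.ContMDiffRiemannianMetric (𝓡 n) ∞ (EuclideanSpace ℝ (Fin n))
    (fun x : M => TangentSpace (𝓡 n) x)

/-! ### Geodesics -/

section Geodesics

variable {n : ℕ} {M : Type u} [TopologicalSpace M]
  [ChartedSpace (EuclideanSpace ℝ (Fin n)) M] [IsManifold (𝓡 n) ∞ M]

namespace SmoothMetric

/-- The coefficients of the metric in the preferred chart around `x₀`: the value at the point `y`
of the target of the chart, on the vectors `v`, `w` of `ℝⁿ`. -/
def inChart (g : SmoothMetric n M) (x₀ : M) (y v w : EuclideanSpace ℝ (Fin n)) : ℝ :=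
  g.inner ((extChartAt (𝓡 n) x₀).symm y)
    (mfderiv 𝓘(ℝ, EuclideanSpace ℝ (Fin n)) (𝓡 n) (extChartAt (𝓡 n) x₀).symm y v)
    (mfderiv 𝓘(ℝ, EuclideanSpace ℝ (Fin n)) (𝓡 n) (extChartAt (𝓡 n) x₀).symm y w)

/-- The Christoffel symbols of the first kind of the metric in the preferred chart around `x₀`:
`Γ(a, b; w) = (∂_a G(b, w) + ∂_b G(a, w) - ∂_w G(a, b)) / 2`. -/
def christoffel (g : SmoothMetric n M) (x₀ : M) (y a b w : EuclideanSpace ℝ (Fin n)) : ℝ :=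
  (fderiv ℝ (fun z => g.inChart x₀ z b w) y a + fderiv ℝ (fun z => g.inChart x₀ z a w) y b
    - fderiv ℝ (fun z => g.inChart x₀ z a b) y w) / 2

/-- `γ` restricted to the open interval `J` is an (affinely parametrized) geodesic: it is smooth
on `J`, and in each preferred chart the coordinate curve `u` satisfies `G(u'', w) + Γ(u', u'; w) = 0`
for all vectors `w`, that is, `∇_{γ'} γ' = 0` for the Levi-Civita connection.
The values of `γ` outside `J` play no role. -/
structure IsGeodesicOn (g : SmoothMetric n M) (γ : ℝ → M) (J : Set ℝ) : Prop where
  isOpen : IsOpen J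
  ordConnected : J.OrdConnected
  nonempty : J.Nonempty
  contMDiffOn : ContMDiffOn 𝓘(ℝ, ℝ) (𝓡 n) ∞ γ J
  geodesic_eq : ∀ x₀ : M, ∀ t ∈ J, γ t ∈ (extChartAt (𝓡 n) x₀).source →
    ∀ w : EuclideanSpace ℝ (Fin n),
      g.inChart x₀ (extChartAt (𝓡 n) x₀ (γ t))
          (deriv (deriv (fun s => extChartAt (𝓡 n) x₀ (γ s))) t) w
        + g.christoffel x₀ (extChartAt (𝓡 n) x₀ (γ t))
          (deriv (fun s => extChartAt (𝓡 n) x₀ (γ s)) t)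
          (deriv (fun s => extChartAt (𝓡 n) x₀ (γ s)) t) w = 0

/-- `γ` restricted to `J` is a geodesic that is not the restriction of a geodesic defined on a
larger open interval. -/
def IsMaximalGeodesicOn (g : SmoothMetric n M) (γ : ℝ → M) (J : Set ℝ) : Prop :=
  g.IsGeodesicOn γ J ∧
    ∀ (γ' : ℝ → M) (J' : Set ℝ), J ⊆ J' → g.IsGeodesicOn γ' J' → EqOn γ γ' J → J' = J

end SmoothMetric

end Geodesics

/-! ### Foliations -/

/-- A Haefliger cocycle of codimension `q` on a manifold `M` of dimension `n`: an open covering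
`U i`, submersions `π i : U i → ℝ^q`, and local diffeomorphisms
`γ i j : π j (U i ∩ U j) → π i (U i ∩ U j)` with `π i = γ i j ∘ π j` on `U i ∩ U j`.
The values of `π i` outside `U i`, and of `γ i j` outside `π j (U i ∩ U j)`, play no role. -/
structure HaefligerCocycle (n q : ℕ) (M : Type u) [TopologicalSpace M]
    [ChartedSpace (EuclideanSpace ℝ (Fin n)) M] [IsManifold (𝓡 n) ∞ M] where
  ι : Type w
  U : ι → Set M
  isOpen_U : ∀ i, IsOpen (U i)
  iUnion_U : ⋃ i, U i = univ
  π : ι → M → EuclideanSpace ℝ (Fin q)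
  contMDiffOn_π : ∀ i, ContMDiffOn (𝓡 n) (𝓡 q) ∞ (π i) (U i)
  surjective_mfderiv_π : ∀ i, ∀ x ∈ U i, Function.Surjective (mfderiv (𝓡 n) (𝓡 q) (π i) x)
  γ : ι → ι → EuclideanSpace ℝ (Fin q) → EuclideanSpace ℝ (Fin q)
  isLocalDiffeomorphOn_γ : ∀ i j,
    IsLocalDiffeomorphOn (𝓡 q) (𝓡 q) ∞ (γ i j) (π j '' (U i ∩ U j))
  π_eq : ∀ i j, ∀ x ∈ U i ∩ U j, π i x = γ i j (π j x)

namespace HaefligerCocycle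

variable {n q : ℕ} {M : Type u} [TopologicalSpace M]
  [ChartedSpace (EuclideanSpace ℝ (Fin n)) M] [IsManifold (𝓡 n) ∞ M]

/-- The additional maps `γ` from the submersions of `c'` to those of `c` exist. -/
def HasTransitionsFrom (c c' : HaefligerCocycle.{w} n q M) : Prop :=
  ∀ (i : c.ι) (j : c'.ι), ∃ γ : EuclideanSpace ℝ (Fin q) → EuclideanSpace ℝ (Fin q),
    IsLocalDiffeomorphOn (𝓡 q) (𝓡 q) ∞ γ (c'.π j '' (c.U i ∩ c'.U j)) ∧
      ∀ x ∈ c.U i ∩ c'.U j, c.π i x = γ (c'.π j x)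

/-- Two cocycles are equivalent if their union is a cocycle after adding the necessary maps `γ`. -/
def Equivalent (c c' : HaefligerCocycle.{w} n q M) : Prop :=
  c.HasTransitionsFrom c' ∧ c'.HasTransitionsFrom c

/-- `σ` is a path in a leaf from `x` to `y`: a continuous path along which each submersion `π i` is
locally constant (equivalently, a continuous path for the leaf topology). -/
def IsLeafPath (c : HaefligerCocycle.{w} n q M) {x y : M} (σ : Path x y) : Prop :=
  ∀ t : unitInterval, ∀ i, σ t ∈ c.U i → ∀ᶠ s in 𝓝 t, c.π i (σ s) = c.π i (σ t)

/-- The leaf through `x`. -/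
def leaf (c : HaefligerCocycle.{w} n q M) (x : M) : Set M :=
  {y | ∃ σ : Path x y, c.IsLeafPath σ}

theorem IsLeafPath.of_hasTransitionsFrom {c c' : HaefligerCocycle.{w} n q M}
    (h : c.HasTransitionsFrom c') {x y : M} {σ : Path x y} (hσ : c'.IsLeafPath σ) :
    c.IsLeafPath σ := by
  intro t i hi
  obtain ⟨j, hj⟩ : ∃ j, σ t ∈ c'.U j := by
    have : σ t ∈ ⋃ j, c'.U j := by rw [c'.iUnion_U]; trivial
    simpa using this
  obtain ⟨γ, -, hγ⟩ := h i j
  have hopen : IsOpen (c.U i ∩ c'.U j) := (c.isOpen_U i).inter (c'.isOpen_U j)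
  filter_upwards [hσ t j hj, σ.continuous.continuousAt.preimage_mem_nhds
    (hopen.mem_nhds ⟨hi, hj⟩)] with s hs hs'
  rw [hγ _ hs', hs, hγ _ ⟨hi, hj⟩]

theorem Equivalent.leaf_eq {c c' : HaefligerCocycle.{w} n q M} (h : c.Equivalent c') :
    c.leaf = c'.leaf := by
  funext x
  ext y
  exact ⟨fun ⟨σ, hσ⟩ => ⟨σ, hσ.of_hasTransitionsFrom h.2⟩,
    fun ⟨σ, hσ⟩ => ⟨σ, hσ.of_hasTransitionsFrom h.1⟩⟩

/-- The tangent vector `v` at `x` is tangent to the foliation: `v ∈ ker dπ_i`. -/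
def IsTangent (c : HaefligerCocycle.{w} n q M) (x : M) (v : TangentSpace (𝓡 n) x) : Prop :=
  ∀ i, x ∈ c.U i → mfderiv (𝓡 n) (𝓡 q) (c.π i) x v = 0

/-- The tangent vector `v` at `x` is orthogonal to the foliation. -/
def IsOrthogonal (c : HaefligerCocycle.{w} n q M) (g : SmoothMetric n M) (x : M)
    (v : TangentSpace (𝓡 n) x) : Prop :=
  ∀ w : TangentSpace (𝓡 n) x, c.IsTangent x w → g.inner x v w = 0

/-- `h` is a family of Riemannian metrics `h i` on the open sets `π i (U i)` of `ℝ^q` with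
`(γ i j)^* h i = h j`. -/
structure IsTransverseMetric (c : HaefligerCocycle.{w} n q M)
    (h : c.ι → EuclideanSpace ℝ (Fin q) →
      EuclideanSpace ℝ (Fin q) →L[ℝ] EuclideanSpace ℝ (Fin q) →L[ℝ] ℝ) : Prop where
  contDiffOn : ∀ i, ContDiffOn ℝ ∞ (h i) (c.π i '' c.U i)
  symm : ∀ i, ∀ y ∈ c.π i '' c.U i, ∀ v w, h i y v w = h i y w v
  pos : ∀ i, ∀ y ∈ c.π i '' c.U i, ∀ v, v ≠ 0 → 0 < h i y v v
  pullback_γ : ∀ i j, ∀ y ∈ c.π j '' (c.U i ∩ c.U j), ∀ v w,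
    h i (c.γ i j y) (fderiv ℝ (c.γ i j) y v) (fderiv ℝ (c.γ i j) y w) = h j y v w

/-- The metric `g` is bundle-like: the metric that it induces on the normal bundle, identified with
the orthogonal complement of the tangent spaces of the leaves, is the pullback by the submersions
`π i` of a family of metrics invariant under the maps `γ i j`. -/
def IsBundleLike (c : HaefligerCocycle.{w} n q M) (g : SmoothMetric n M) : Prop :=
  ∃ h, c.IsTransverseMetric h ∧
    ∀ i, ∀ x ∈ c.U i, ∀ v w : TangentSpace (𝓡 n) x,
      c.IsOrthogonal g x v → c.IsOrthogonal g x w →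
        g.inner x v w = h i (c.π i x) (mfderiv (𝓡 n) (𝓡 q) (c.π i) x v)
          (mfderiv (𝓡 n) (𝓡 q) (c.π i) x w)

/-- The metric `g` is transversally complete: each maximal geodesic that is orthogonal to the
leaves is defined on all of `ℝ`. -/
def IsTransversallyCompleteMetric (c : HaefligerCocycle.{w} n q M) (g : SmoothMetric n M) : Prop :=
  ∀ (σ : ℝ → M) (J : Set ℝ), g.IsMaximalGeodesicOn σ J →
    (∀ t ∈ J, c.IsOrthogonal g (σ t) (mfderiv 𝓘(ℝ, ℝ) (𝓡 n) σ t (1 : ℝ))) → J = univ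

end HaefligerCocycle

/-- A foliation of codimension `q`: a Haefliger cocycle up to (the equivalence relation generated
by) equivalence. -/
def Foliation (n q : ℕ) (M : Type u) [TopologicalSpace M]
    [ChartedSpace (EuclideanSpace ℝ (Fin n)) M] [IsManifold (𝓡 n) ∞ M] :=
  Quot (HaefligerCocycle.Equivalent.{w} (n := n) (q := q) (M := M))

namespace Foliation

variable {n q : ℕ} {M : Type u} [TopologicalSpace M]
  [ChartedSpace (EuclideanSpace ℝ (Fin n)) M] [IsManifold (𝓡 n) ∞ M]

/-- The leaf of the foliation through `x`. -/
def leaf (F : Foliation.{w} n q M) : M → Set M :=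
  Quot.lift HaefligerCocycle.leaf (fun _ _ h => h.leaf_eq) F

/-- The cocycle `c` represents the foliation `F`. -/
def IsRepresentedBy (F : Foliation.{w} n q M) (c : HaefligerCocycle.{w} n q M) : Prop :=
  F = Quot.mk _ c

/-- The foliation is Riemannian: the submersions of some cocycle that represents it carry an
invariant family of Riemannian metrics. -/
def IsRiemannian (F : Foliation.{w} n q M) : Prop :=
  ∃ c, F.IsRepresentedBy c ∧ ∃ h, c.IsTransverseMetric h

/-- The foliation is transversally complete: there is a Riemannian metric on `M` which is both
bundle-like and transversally complete. -/
def IsTransversallyComplete (F : Foliation.{w} n q M) : Prop :=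
  ∃ c, F.IsRepresentedBy c ∧ ∃ g : SmoothMetric n M,
    c.IsBundleLike g ∧ c.IsTransversallyCompleteMetric g

/-- `(M, F)` is an `ℝ`-bundle: there are a smooth manifold `B` of dimension `q` and a smooth locally
trivial fibre bundle `p : M → B` with fibre `ℝ` whose fibres are the leaves of `F`. -/
def IsRBundle (F : Foliation.{w} n q M) : Prop :=
  ∃ (B : Type u) (_ : TopologicalSpace B) (_ : ChartedSpace (EuclideanSpace ℝ (Fin q)) B)
    (p : M → B),
    T2Space B ∧ SecondCountableTopology B ∧ IsManifold (𝓡 q) ∞ B ∧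
    ContMDiff (𝓡 n) (𝓡 q) ∞ p ∧
    (∀ b : B, ∃ V : Set B, IsOpen V ∧ b ∈ V ∧
      ∃ Φ : PartialDiffeomorph (𝓡 n) ((𝓡 q).prod 𝓘(ℝ, ℝ)) M (B × ℝ) ∞,
        Φ.source = p ⁻¹' V ∧ Φ.target = V ×ˢ univ ∧ ∀ x ∈ p ⁻¹' V, (Φ x).1 = p x) ∧
    ∀ x, F.leaf x = p ⁻¹' {p x}

end Foliation

end

/-! For a bundle-like metric the maps `π i` are Riemannian submersions. A curve orthogonal to the
leaves that projects to geodesics of the transverse metrics is therefore a geodesic of `g`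
(`IsHG.isGeodesicOn`), and transversal completeness extends it to all of `ℝ`
(`IsHG.exists_extension`). The projected equation does not see the leaf direction. Hence a
horizontal geodesic can be slid: if its origin runs along a leaf while its projected initial jet is
kept, its endpoint also runs along a leaf and its speed is unchanged (`exists_isSlide`,
`IsSlide.isLeafCurveOn`). Consequently all points of a leaf are joined to a neighbouring leaf by
uniformly short horizontal geodesics (`exists_isHG_to_leaf`).

Horizontal geodesics of bounded speed that start in a compact set end in a relatively compact set
(`isCompact_closure_endpoints`). So having compact closure is an open and closed property of leaves,
and on a connected manifold it holds for every leaf or for none.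

Suppose that it holds for none. Let `ρ` be smooth with compact sublevel sets. Arc length for `g + dρ
⊗ dρ` parametrizes the leaves by complete curves along which `ρ` is 1-Lipschitz. These unit curves
are injective, since otherwise a leaf would be compact. The heart is
`IsUnitCurve.isCompact_closure_of_mapClusterPt`. Suppose that a unit curve accumulates at `z` as
time tends to infinity. Its limit set is closed and a union of leaves. Sliding shows that each of
these leaves is recurrent and meets a given compact neighbourhood `K` of `z`, so it meets `K` at
some positive time. Compactness bounds the return times to `K` by some `τ`, and the Lipschitz bound
on `ρ` then confines the leaf of `z` to a compact sublevel set, a contradiction. Hence the leaves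
are properly embedded lines.

Sliding again shows that distinct leaves have disjoint saturated neighbourhoods and that, near a
point, a leaf meets a flow box in one plaque only. So the space of leaves is a Hausdorff manifold
with charts given by flow boxes, and signed arc length from a local section trivializes the
projection onto it (`IsLeafChart.exists_partialDiffeomorph`). -/

noncomputable section

/-! ### Geodesic equations -/

section GeodesicForm

variable {E F : Type*} [NormedAddCommGroup E] [NormedSpace ℝ E]
  [NormedAddCommGroup F] [NormedSpace ℝ F]

/-- The left-hand side of the geodesic equation of the metric `h`, at a point `a` with velocity `ξ`
and acceleration `ζ`, tested against `w`. -/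
def geoForm (h : E → E →L[ℝ] E →L[ℝ] ℝ) (a ξ ζ w : E) : ℝ :=
  h a ζ w + fderiv ℝ h a ξ ξ w - fderiv ℝ h a w ξ ξ / 2

/-- The geodesic expression of a metric `G` along a curve on which it is, to the first order, the
pullback of a metric `h` by a map `f`. -/
theorem geoForm_eq_of_pullback {G : E → E →L[ℝ] E →L[ℝ] ℝ} {h : F → F →L[ℝ] F →L[ℝ] ℝ}
    {f : E → F} {u : ℝ → E} {t : ℝ} (hG : DifferentiableAt ℝ G (u t))
    (hh : DifferentiableAt ℝ h (f (u t))) (hf : ContDiffAt ℝ 2 f (u t))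
    (hsymm : ∀ v w, h (f (u t)) v w = h (f (u t)) w v)
    (hu : ∀ᶠ s in 𝓝 t, DifferentiableAt ℝ u s) (hu' : DifferentiableAt ℝ (deriv u) t)
    (hle : ∀ᶠ y in 𝓝 (u t), ∀ v, h (f y) (fderiv ℝ f y v) (fderiv ℝ f y v) ≤ G y v v)
    (hker : ∀ᶠ s in 𝓝 t, ∀ w, G (u s) (deriv u s) w =
      h (f (u s)) (fderiv ℝ f (u s) (deriv u s)) (fderiv ℝ f (u s) w)) (w : E) :
    geoForm G (u t) (deriv u t) (deriv (deriv u) t) w =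
      geoForm h (f (u t)) (deriv (fun s => f (u s)) t) (deriv (deriv fun s => f (u s)) t)
        (fderiv ℝ f (u t) w) := by
  have hut : HasDerivAt u (deriv u t) t := hu.self_of_nhds.hasDerivAt
  have hut' : HasDerivAt (deriv u) (deriv (deriv u) t) t := hu'.hasDerivAt
  have hfe : ∀ᶠ y in 𝓝 (u t), DifferentiableAt ℝ f y := by
    filter_upwards [hf.eventually (by simp)] with y hy
    exact hy.differentiableAt (by norm_num)
  have hf1 : HasFDerivAt (fderiv ℝ f) (fderiv ℝ (fderiv ℝ f) (u t)) (u t) :=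
    ((hf.fderiv_right (m := 1) (by norm_num)).differentiableAt (by norm_num)).hasFDerivAt
  have hf0 : HasFDerivAt f (fderiv ℝ f (u t)) (u t) := hfe.self_of_nhds.hasFDerivAt
  have hsnd : ∀ v w, fderiv ℝ (fderiv ℝ f) (u t) v w = fderiv ℝ (fderiv ℝ f) (u t) w v :=
    hf.isSymmSndFDerivAt (by simp)
  have hc' : deriv (fun s => f (u s)) =ᶠ[𝓝 t] fun s => fderiv ℝ f (u s) (deriv u s) := by
    filter_upwards [hu, hut.continuousAt.eventually hfe] with s hs1 hs2
    exact (hs2.hasFDerivAt.comp_hasDerivAt s hs1.hasDerivAt).deriv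
  have hfu : HasDerivAt (fun s => fderiv ℝ f (u s)) (fderiv ℝ (fderiv ℝ f) (u t) (deriv u t)) t :=
    hf1.comp_hasDerivAt t hut
  have hc'' : HasDerivAt (fun s => fderiv ℝ f (u s) (deriv u s))
      (fderiv ℝ (fderiv ℝ f) (u t) (deriv u t) (deriv u t) +
        fderiv ℝ f (u t) (deriv (deriv u) t)) t := hfu.clm_apply hut'
  have hfut : HasDerivAt (fun s => f (u s)) (fderiv ℝ f (u t) (deriv u t)) t :=
    hf0.comp_hasDerivAt t hut
  have hhu : HasDerivAt (fun s => h (f (u s)))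
      (fderiv ℝ h (f (u t)) (fderiv ℝ f (u t) (deriv u t))) t :=
    HasFDerivAt.comp_hasDerivAt (l := h) (f := fun s => f (u s)) t hh.hasFDerivAt hfut
  have hGu : HasDerivAt (fun s => G (u s)) (fderiv ℝ G (u t) (deriv u t)) t :=
    HasFDerivAt.comp_hasDerivAt (l := G) t hG.hasFDerivAt hut
  -- The two sides of `hker`, for a fixed `w`, are differentiated in time; comparing the results
  -- gives `e1`.
  have hA : HasDerivAt (fun s => G (u s) (deriv u s) w)
      (fderiv ℝ G (u t) (deriv u t) (deriv u t) w + G (u t) (deriv (deriv u) t) w) t := by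
    simpa using (hGu.clm_apply hut').clm_apply (hasDerivAt_const t w)
  have hA' := (hhu.clm_apply hc'').clm_apply (hfu.clm_apply (hasDerivAt_const t w))
  have hAA : (fun s => G (u s) (deriv u s) w) =ᶠ[𝓝 t]
      fun s => h (f (u s)) (fderiv ℝ f (u s) (deriv u s)) (fderiv ℝ f (u s) w) := by
    filter_upwards [hker] with s hs using hs w
  have e1 := hA.unique (hA'.congr_of_eventuallyEq hAA)
  set v := deriv u t with hv
  -- With the velocity `v` frozen, the excess of `G` over the pulled-back form is nonnegative near
  -- `u t` and zero there. Its derivative in the direction `w` vanishes, which controls the term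
  -- `fderiv ℝ G (u t) w v v`.
  have hN : IsLocalMin (fun y => G y v v - h (f y) (fderiv ℝ f y v) (fderiv ℝ f y v)) (u t) := by
    filter_upwards [hle] with y hy
    rw [hker.self_of_nhds v, sub_self]
    exact sub_nonneg.2 (hy v)
  have hfv : HasFDerivAt (fun y => fderiv ℝ f y v) _ (u t) :=
    hf1.clm_apply (hasFDerivAt_const v (u t))
  have hN' := ((hG.hasFDerivAt.clm_apply (hasFDerivAt_const v (u t))).clm_apply
    (hasFDerivAt_const v (u t))).sub ((((hh.hasFDerivAt.comp (u t) hf0).clm_apply hfv).clm_apply hfv))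
  have e2 := congrArg (fun L => L w) (hN.hasFDerivAt_eq_zero hN')
  simp at e1 e2
  unfold geoForm
  rw [hc'.eq_of_nhds, hc'.deriv_eq, hc''.deriv]
  simp only [map_add, add_apply]
  -- What remains are two terms with the second derivative of `f`; they cancel by the symmetry of
  -- that derivative and of `h`.
  have e3 := hsnd w v
  have e4 := hsymm (fderiv ℝ f (u t) v) (fderiv ℝ (fderiv ℝ f) (u t) w v)
  rw [← hv]
  rw [e3] at e2 e4
  linarith [e1, e2, e4]

end GeodesicForm

section GeodesicVector

variable {F : Type*} [NormedAddCommGroup F] [NormedSpace ℝ F]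

/-- The acceleration of the geodesic of the metric `h` with velocity `ξ` at `a`. -/
def geoVec (h : F → F →L[ℝ] F →L[ℝ] ℝ) (a ξ : F) : F :=
  (h a).inverse ((2⁻¹ : ℝ) • (((fderiv ℝ h a).flip ξ).flip ξ) - fderiv ℝ h a ξ ξ)

theorem exists_equiv_of_pos [FiniteDimensional ℝ F] {L : F →L[ℝ] F →L[ℝ] ℝ}
    (hL : ∀ v, v ≠ 0 → 0 < L v v) : ∃ e : F ≃L[ℝ] (F →L[ℝ] ℝ), (e : F →L[ℝ] F →L[ℝ] ℝ) = L := by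
  have hinj : Function.Injective L.toLinearMap := by
    rw [← LinearMap.ker_eq_bot, LinearMap.ker_eq_bot']
    intro v hv
    by_contra hne
    have h1 := hL v hne
    have h2 : L v = 0 := hv
    simp [h2] at h1
  have hfr : Module.finrank ℝ F = Module.finrank ℝ (F →L[ℝ] ℝ) := by
    rw [← (LinearMap.toContinuousLinearMap (𝕜 := ℝ) (E := F) (F' := ℝ)).finrank_eq]
    exact (Subspace.dual_finrank_eq (K := ℝ) (V := F)).symm
  refine ⟨(LinearEquiv.ofInjectiveOfFinrankEq L.toLinearMap hinj hfr).toContinuousLinearEquiv, ?_⟩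
  ext v w
  rfl

/-- Positive definiteness makes `h a` invertible, so the weak form of the geodesic equation can be
solved for the acceleration. The weak form transforms well under maps; the solved form is an
ordinary differential equation. -/
theorem geoForm_eq_zero_iff [FiniteDimensional ℝ F] {h : F → F →L[ℝ] F →L[ℝ] ℝ} {a ξ ζ : F}
    (hpos : ∀ v, v ≠ 0 → 0 < h a v v) :
    (∀ w, geoForm h a ξ ζ w = 0) ↔ ζ = geoVec h a ξ := by
  obtain ⟨e, he⟩ := exists_equiv_of_pos hpos
  have key : (∀ w, geoForm h a ξ ζ w = 0) ↔
      e ζ = (2⁻¹ : ℝ) • (((fderiv ℝ h a).flip ξ).flip ξ) - fderiv ℝ h a ξ ξ := by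
    rw [ContinuousLinearMap.ext_iff]
    refine forall_congr' fun w => ?_
    have : e ζ w = h a ζ w := by rw [← he]; rfl
    simp only [geoForm, this, sub_apply, smul_apply,
      ContinuousLinearMap.flip_apply, smul_eq_mul]
    constructor <;> intro H <;> linarith
  rw [key, geoVec, ← he, ContinuousLinearMap.inverse_equiv]
  exact (ContinuousLinearEquiv.eq_symm_apply e).symm

set_option maxSynthPendingDepth 5 in
theorem contDiffAt_geoVec [FiniteDimensional ℝ F] {h : F → F →L[ℝ] F →L[ℝ] ℝ} {a : F}
    (hpos : ∀ v, v ≠ 0 → 0 < h a v v) (hh : ContDiffAt ℝ ∞ h a) (ξ : F) :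
    ContDiffAt ℝ ∞ (fun p : F × F => geoVec h p.1 p.2) (a, ξ) := by
  obtain ⟨e, he⟩ := exists_equiv_of_pos hpos
  have h1 : ContDiffAt ℝ ∞ (fun p : F × F => h p.1) (a, ξ) :=
    ContDiffAt.comp (g := h) (f := Prod.fst) (a, ξ) hh contDiffAt_fst
  have h2 : ContDiffAt ℝ ∞ (fun p : F × F => (h p.1).inverse) (a, ξ) := by
    refine ContDiffAt.comp (g := ContinuousLinearMap.inverse) (f := fun p : F × F => h p.1) (a, ξ)
      ?_ h1
    simp only [← he]
    exact contDiffAt_map_inverse e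
  have h3 : ContDiffAt ℝ ∞ (fun p : F × F => fderiv ℝ h p.1) (a, ξ) :=
    ContDiffAt.comp (g := fderiv ℝ h) (f := Prod.fst) (a, ξ)
      (hh.fderiv_right (m := ∞) (by simp)) contDiffAt_fst
  have hξ : ContDiffAt ℝ ∞ (fun p : F × F => p.2) (a, ξ) := contDiffAt_snd
  have h4 : ContDiffAt ℝ ∞ (fun p : F × F => (fderiv ℝ h p.1).flip) (a, ξ) :=
    (ContinuousLinearMap.flipₗᵢ ℝ F F (F →L[ℝ] ℝ)).contDiff.contDiffAt.comp (a, ξ) h3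
  have h5 : ContDiffAt ℝ ∞ (fun p : F × F => ((fderiv ℝ h p.1).flip p.2).flip) (a, ξ) :=
    (ContinuousLinearMap.flipₗᵢ ℝ F F ℝ).contDiff.contDiffAt.comp (a, ξ) (h4.clm_apply hξ)
  exact h2.clm_apply (((h5.clm_apply hξ).const_smul _).sub ((h3.clm_apply hξ).clm_apply hξ))

theorem geoVec_smul (h : F → F →L[ℝ] F →L[ℝ] ℝ) (a ξ : F) (r : ℝ) :
    geoVec h a (r • ξ) = r ^ 2 • geoVec h a ξ := by
  have : ((2⁻¹ : ℝ) • (((fderiv ℝ h a).flip (r • ξ)).flip (r • ξ)) -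
      fderiv ℝ h a (r • ξ) (r • ξ)) =
      r ^ 2 • ((2⁻¹ : ℝ) • (((fderiv ℝ h a).flip ξ).flip ξ) - fderiv ℝ h a ξ ξ) := by
    ext w
    simp
    ring
  rw [geoVec, this, map_smul, geoVec]

/-- Being quadratic in the velocity, the acceleration is `r ^ 2` times a smooth function of `r`
along each line through `(a, 0)`. The vanishing strict derivative provides arbitrarily small
Lipschitz constants near `(a, 0)`, which the construction of short geodesics needs. -/
theorem hasStrictFDerivAt_geoVec [FiniteDimensional ℝ F] {h : F → F →L[ℝ] F →L[ℝ] ℝ} {a : F}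
    (hpos : ∀ v, v ≠ 0 → 0 < h a v v) (hh : ContDiffAt ℝ ∞ h a) :
    HasStrictFDerivAt (fun p : F × F => geoVec h p.1 p.2) (0 : F × F →L[ℝ] F) (a, 0) := by
  have h1 := (contDiffAt_geoVec hpos hh 0).hasStrictFDerivAt (by simp)
  suffices H : fderiv ℝ (fun p : F × F => geoVec h p.1 p.2) (a, 0) = 0 by rwa [H] at h1
  refine ContinuousLinearMap.ext fun p => ?_
  obtain ⟨b, η⟩ := p
  have hline : HasDerivAt (fun r : ℝ => ((a, 0) : F × F) + r • (b, η)) (b, η) 0 := by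
    simpa using ((hasDerivAt_id (0 : ℝ)).smul_const (b, η)).const_add ((a, 0) : F × F)
  have h2 : HasDerivAt (fun r : ℝ => geoVec h (((a, 0) : F × F) + r • (b, η)).1
      (((a, 0) : F × F) + r • (b, η)).2)
      (fderiv ℝ (fun p : F × F => geoVec h p.1 p.2) (a, 0) (b, η)) 0 :=
    HasFDerivAt.comp_hasDerivAt_of_eq (l := fun p : F × F => geoVec h p.1 p.2) 0
      h1.hasFDerivAt hline (by simp)
  have hd : ContDiffAt ℝ ∞ (fun r : ℝ => geoVec h (a + r • b) η) 0 := by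
    have h3 : ContDiffAt ℝ ∞ (fun p : F × F => geoVec h p.1 p.2) (a + (0 : ℝ) • b, η) := by
      simpa using contDiffAt_geoVec hpos hh η
    have h4 : ContDiffAt ℝ ∞ (fun r : ℝ => ((a + r • b, η) : F × F)) 0 := by fun_prop
    exact ContDiffAt.comp (g := fun p : F × F => geoVec h p.1 p.2) (0 : ℝ) h3 h4
  have h5 : HasDerivAt (fun r : ℝ => r ^ 2 • geoVec h (a + r • b) η) 0 0 := by
    have := (hasDerivAt_pow 2 (0 : ℝ)).smul (hd.differentiableAt (by simp)).hasDerivAt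
    simp only [ne_eq, OfNat.ofNat_ne_zero, not_false_eq_true, zero_pow, zero_smul,
      Nat.cast_ofNat, Nat.add_one_sub_one, pow_one, mul_zero, add_zero] at this
    exact this
  refine h2.unique (h5.congr_of_eventuallyEq (Filter.Eventually.of_forall fun r => ?_))
  simp [geoVec_smul]

end GeodesicVector

/-! ### Autonomous differential equations and continuity arguments -/

section ODE

/-- The open-and-closed argument in the form used throughout: both `P` and its negation are open
conditions on `J`. -/
theorem IsPreconnected.forall_of_eventually_iff {X : Type*} [TopologicalSpace X] {J : Set X}
    (hJ : IsPreconnected J) {P : X → Prop} (h : ∀ t ∈ J, ∀ᶠ s in 𝓝[J] t, (P t ↔ P s))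
    {t₀ : X} (ht₀ : t₀ ∈ J) (h₀ : P t₀) : ∀ t ∈ J, P t := by
  intro t ht
  refine hJ.induction₂ (fun x y => P x ↔ P y) h (fun x y z _ _ _ => Iff.trans)
    (fun x y _ _ => Iff.symm) ht₀ ht |>.1 h₀

variable {V : Type*} [NormedAddCommGroup V] [NormedSpace ℝ V] {f : V → V}

/-- Coincidence is open by local Lipschitz uniqueness and its failure is open by continuity. Only
`α` has to stay in `U`, because uniqueness is applied at common points. -/
theorem ode_eqOn {U : Set V} (hf : ∀ x ∈ U, ContDiffAt ℝ 1 f x)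
    {J : Set ℝ} (hJ : IsOpen J) (hJ' : IsPreconnected J) {α β : ℝ → V}
    (hα : ∀ t ∈ J, HasDerivAt α (f (α t)) t) (hαU : ∀ t ∈ J, α t ∈ U)
    (hβ : ∀ t ∈ J, HasDerivAt β (f (β t)) t) {t₀ : ℝ} (ht₀ : t₀ ∈ J) (h₀ : α t₀ = β t₀) :
    EqOn α β J := by
  refine hJ'.forall_of_eventually_iff (P := fun t => α t = β t) (fun t ht => ?_) ht₀ h₀
  rw [hJ.nhdsWithin_eq ht]
  by_cases h : α t = β t
  · obtain ⟨K, s, hs, hl⟩ := (hf _ (hαU t ht)).exists_lipschitzOnWith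
    have h1 : α =ᶠ[𝓝 t] β := by
      refine ODE_solution_unique_of_eventually (v := fun _ => f) (s := fun _ => s) (K := K)
        (Filter.Eventually.of_forall fun _ => hl) ?_ ?_ h
      · filter_upwards [hJ.mem_nhds ht, (hα t ht).continuousAt.preimage_mem_nhds hs] with r hr hr'
        exact ⟨hα r hr, hr'⟩
      · rw [h] at hs
        filter_upwards [hJ.mem_nhds ht, (hβ t ht).continuousAt.preimage_mem_nhds hs] with r hr hr'
        exact ⟨hβ r hr, hr'⟩
    filter_upwards [h1] with r hr
    simp [h, hr]
  · have : ∀ᶠ r in 𝓝 t, α r ≠ β r :=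
      (hα t ht).continuousAt.ne_iff_eventually_ne (hβ t ht).continuousAt |>.1 h
    filter_upwards [this] with r hr
    simp [h, hr]

/-- Picard–Lindelöf with continuous dependence; joint continuity at `(x₀, 0)` allows the box to be
shrunk until the flow stays in `U`. -/
theorem exists_local_flow [CompleteSpace V] {x₀ : V} (hf : ContDiffAt ℝ 1 f x₀) {U : Set V}
    (hU : U ∈ 𝓝 x₀) : ∃ r > (0 : ℝ), ∃ ε > (0 : ℝ), ∃ α : V × ℝ → V,
      (∀ x ∈ Metric.ball x₀ r, α (x, 0) = x ∧ ∀ t ∈ Ioo (-ε) ε,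
        HasDerivAt (fun s => α (x, s)) (f (α (x, t))) t ∧ α (x, t) ∈ U) ∧
      ContinuousOn α (Metric.ball x₀ r ×ˢ Ioo (-ε) ε) := by
  obtain ⟨ε, hε, a, r, L, K, hr, hpl⟩ := IsPicardLindelof.of_contDiffAt_one hf
  obtain ⟨α, hα, hc⟩ := (hpl 0).exists_forall_mem_closedBall_eq_hasDerivWithinAt_continuousOn
  have hmem : ((x₀, 0) : V × ℝ) ∈ Metric.closedBall x₀ (r : ℝ) ×ˢ Icc (0 - ε) (0 + ε) :=
    ⟨Metric.mem_closedBall_self r.2, by constructor <;> linarith⟩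
  have hnhds : Metric.closedBall x₀ (r : ℝ) ×ˢ Icc (0 - ε) (0 + ε) ∈ 𝓝 ((x₀, 0) : V × ℝ) :=
    prod_mem_nhds (Metric.closedBall_mem_nhds _ hr) (Icc_mem_nhds (by linarith) (by linarith))
  have hc0 : ContinuousAt α (x₀, 0) := hc.continuousAt hnhds
  have h0 : α (x₀, 0) = x₀ := (hα x₀ hmem.1).1
  have hU' : α ⁻¹' U ∈ 𝓝 ((x₀, 0) : V × ℝ) := hc0.preimage_mem_nhds (by rwa [h0])
  obtain ⟨δ, hδ, hδU⟩ := Metric.mem_nhds_iff.1 (Filter.inter_mem hU' hnhds)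
  rw [← ball_prod_same] at hδU
  have hsub : ∀ x ∈ Metric.ball x₀ δ, ∀ t ∈ Ioo (-δ) δ, (x, t) ∈ Metric.ball x₀ δ ×ˢ
      Metric.ball (0 : ℝ) δ := fun x hx t ht => ⟨hx, by simpa [abs_lt] using ht⟩
  refine ⟨δ, hδ, min δ ε, lt_min hδ hε, α, fun x hx => ⟨?_, fun t ht => ⟨?_, ?_⟩⟩, ?_⟩
  · exact (hα x (hδU (hsub x hx 0 ⟨by linarith, hδ⟩)).2.1).1
  · have ht' : t ∈ Ioo (-δ) δ := ⟨by linarith [ht.1, min_le_left δ ε], ht.2.trans_le (min_le_left _ _)⟩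
    have h2 := (hδU (hsub x hx t ht')).2
    have ht2 : t ∈ Ioo (0 - ε) (0 + ε) :=
      ⟨by linarith [ht.1, min_le_right δ ε], by linarith [ht.2, min_le_right δ ε]⟩
    exact ((hα x h2.1).2 t h2.2).hasDerivAt (Icc_mem_nhds ht2.1 ht2.2)
  · have ht' : t ∈ Ioo (-δ) δ := ⟨by linarith [ht.1, min_le_left δ ε], ht.2.trans_le (min_le_left _ _)⟩
    exact (hδU (hsub x hx t ht')).1
  · refine hc.mono fun p hp => ?_
    have ht' : p.2 ∈ Ioo (-δ) δ :=
      ⟨by linarith [hp.2.1, min_le_left δ ε], hp.2.2.trans_le (min_le_left _ _)⟩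
    exact (hδU (hsub p.1 hp.1 p.2 ht')).2

/-- A solution of a smooth autonomous differential equation is smooth. -/
theorem contDiffOn_of_ode {U : Set V} (hf : ContDiffOn ℝ ∞ f U)
    {J : Set ℝ} (hJ : IsOpen J) {α : ℝ → V}
    (hα : ∀ t ∈ J, HasDerivAt α (f (α t)) t) (hαU : ∀ t ∈ J, α t ∈ U) :
    ContDiffOn ℝ ∞ α J := by
  rw [contDiffOn_infty]
  intro n
  induction n with
  | zero => exact contDiffOn_zero.2 fun t ht => (hα t ht).continuousAt.continuousWithinAt
  | succ n ih =>
    push_cast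
    rw [contDiffOn_succ_iff_deriv_of_isOpen hJ]
    refine ⟨fun t ht => (hα t ht).differentiableAt.differentiableWithinAt, by simp, ?_⟩
    exact ((hf.of_le (by exact_mod_cast le_top)).comp ih hαU).congr fun t ht => (hα t ht).deriv

end ODE

/-- The Euclidean space `ℝⁿ`. -/
abbrev Euc (n : ℕ) := EuclideanSpace ℝ (Fin n)

/-! ### Pullbacks of the metric to vector spaces -/

section PullMetric

variable {n : ℕ} {M : Type u} [TopologicalSpace M]
  [ChartedSpace (Euc n) M] [IsManifold (𝓡 n) ∞ M]
  {E' : Type*} [NormedAddCommGroup E'] [NormedSpace ℝ E']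

/-- The pullback of a metric by a map from a vector space. -/
def pullMetric (g : SmoothMetric n M) (ψ : E' → M) (y : E') : E' →L[ℝ] E' →L[ℝ] ℝ :=
  let A : E' →L[ℝ] Euc n := mfderiv 𝓘(ℝ, E') (𝓡 n) ψ y
  let G : Euc n →L[ℝ] Euc n →L[ℝ] ℝ := g.inner (ψ y)
  G.bilinearComp A A

theorem pullMetric_apply (g : SmoothMetric n M) (ψ : E' → M) (y v w : E') :
    pullMetric g ψ y v w = g.inner (ψ y) (mfderiv 𝓘(ℝ, E') (𝓡 n) ψ y v)
      (mfderiv 𝓘(ℝ, E') (𝓡 n) ψ y w) := rfl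

/-- In finite dimension it is enough to fix two vectors. Their images under the derivative of `ψ`
are smooth sections along `ψ`, to which the smooth section `g.inner` is applied. -/
theorem contDiffOn_pullMetric [FiniteDimensional ℝ E'] (g : SmoothMetric n M) {ψ : E' → M}
    {Ω : Set E'} (hΩ : IsOpen Ω) (hψ : ContMDiffOn 𝓘(ℝ, E') (𝓡 n) ∞ ψ Ω) :
    ContDiffOn ℝ ∞ (pullMetric g ψ) Ω := by
  have hsec : ∀ v : E', ContMDiffOn 𝓘(ℝ, E') (𝓡 n).tangent ∞
      (fun y => (⟨ψ y, mfderiv 𝓘(ℝ, E') (𝓡 n) ψ y v⟩ : TangentBundle (𝓡 n) M)) Ω := by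
    intro v
    have h1 := hψ.contMDiffOn_tangentMapWithin (m := ∞) (by simp) hΩ.uniqueMDiffOn
    have h2 : ContMDiff 𝓘(ℝ, E') 𝓘(ℝ, E').tangent ∞
        (fun y => (⟨y, v⟩ : TangentBundle 𝓘(ℝ, E') E')) := by
      intro y
      rw [Bundle.contMDiffAt_totalSpace]
      refine ⟨contMDiffAt_id, ?_⟩
      simpa using contMDiffAt_const
    refine (h1.comp h2.contMDiffOn (fun y hy => hy)).congr fun y hy => ?_
    simp [tangentMapWithin, mfderivWithin_of_isOpen hΩ hy]
  rw [contDiffOn_clm_apply]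
  intro v
  rw [contDiffOn_clm_apply]
  intro w y hy
  have h4 : ContMDiffWithinAt 𝓘(ℝ, E') ((𝓡 n).prod 𝓘(ℝ, ℝ)) ∞
      (fun m ↦ Bundle.TotalSpace.mk' ℝ (E := Bundle.Trivial M ℝ) (ψ m)
        (g.inner (ψ m) (mfderiv 𝓘(ℝ, E') (𝓡 n) ψ m v) (mfderiv 𝓘(ℝ, E') (𝓡 n) ψ m w))) Ω y := by
    apply ContMDiffWithinAt.clm_bundle_apply₂ (F₁ := Euc n) (F₂ := Euc n)
    · exact ContMDiffAt.comp_contMDiffWithinAt y g.contMDiff.contMDiffAt (hψ y hy)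
    · exact hsec v y hy
    · exact hsec w y hy
  rw [Bundle.contMDiffWithinAt_totalSpace] at h4
  exact contMDiffWithinAt_iff_contDiffWithinAt.1 h4.2

/-- For equal arguments the first two terms of the Christoffel symbol coincide. This identifies the
equation in the definition of a geodesic with the vanishing of `geoForm`. -/
theorem geoForm_inChart (g : SmoothMetric n M) (x₀ : M) {y : Euc n}
    (hy : y ∈ (extChartAt (𝓡 n) x₀).target) (v a w : Euc n) :
    g.inChart x₀ y a w + g.christoffel x₀ y v v w =
      geoForm (pullMetric g (extChartAt (𝓡 n) x₀).symm) y v a w := by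
  have hd : DifferentiableAt ℝ (pullMetric g (extChartAt (𝓡 n) x₀).symm) y :=
    ((contDiffOn_pullMetric g (isOpen_extChartAt_target x₀)
      (contMDiffOn_extChartAt_symm x₀)).contDiffAt
      ((isOpen_extChartAt_target x₀).mem_nhds hy)).differentiableAt (by simp)
  have key : ∀ b c d, fderiv ℝ (fun z => g.inChart x₀ z b c) y d =
      fderiv ℝ (pullMetric g (extChartAt (𝓡 n) x₀).symm) y d b c := by
    intro b c d
    have h1 := (hd.hasFDerivAt.clm_apply (hasFDerivAt_const b y)).clm_apply (hasFDerivAt_const c y)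
    have h2 : HasFDerivAt (fun z => g.inChart x₀ z b c) _ y := h1
    rw [h2.fderiv]
    simp
  have h0 : g.inChart x₀ y a w = pullMetric g (extChartAt (𝓡 n) x₀).symm y a w := rfl
  simp only [SmoothMetric.christoffel, key, geoForm, h0]
  ring

end PullMetric

/-! ### Tangent and orthogonal vectors; the submersions as Riemannian submersions -/

namespace HaefligerCocycle

section Pointwise

variable {q : ℕ} {M : Type u} [TopologicalSpace M]
  [ChartedSpace (Euc (q + 1)) M] [IsManifold (𝓡 (q + 1)) ∞ M]
  {c : HaefligerCocycle.{w} (q + 1) q M} {g : SmoothMetric (q + 1) M}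
  {h : c.ι → Euc q → Euc q →L[ℝ] Euc q →L[ℝ] ℝ}

theorem exists_mem_U (c : HaefligerCocycle.{w} (q + 1) q M) (x : M) : ∃ i, x ∈ c.U i := by
  have : x ∈ ⋃ i, c.U i := by rw [c.iUnion_U]; trivial
  simpa using this

theorem contMDiffAt_π {i : c.ι} {x : M} (hx : x ∈ c.U i) :
    ContMDiffAt (𝓡 (q + 1)) (𝓡 q) ∞ (c.π i) x :=
  (c.contMDiffOn_π i).contMDiffAt ((c.isOpen_U i).mem_nhds hx)

theorem mdifferentiableAt_π {i : c.ι} {x : M} (hx : x ∈ c.U i) :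
    MDifferentiableAt (𝓡 (q + 1)) (𝓡 q) (c.π i) x :=
  (contMDiffAt_π hx).mdifferentiableAt (by simp)

theorem contDiffAt_γ {i j : c.ι} {x : M} (hx : x ∈ c.U i) (hx' : x ∈ c.U j) :
    ContDiffAt ℝ ∞ (c.γ i j) (c.π j x) := by
  have := (c.isLocalDiffeomorphOn_γ i j ⟨c.π j x, mem_image_of_mem _ ⟨hx, hx'⟩⟩).contMDiffAt
  exact contMDiffAt_iff_contDiffAt.1 this

theorem mfderiv_π_eq {i j : c.ι} {x : M} (hx : x ∈ c.U i) (hx' : x ∈ c.U j)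
    (v : TangentSpace (𝓡 (q + 1)) x) :
    mfderiv (𝓡 (q + 1)) (𝓡 q) (c.π i) x v =
      fderiv ℝ (c.γ i j) (c.π j x) (mfderiv (𝓡 (q + 1)) (𝓡 q) (c.π j) x v) := by
  have h1 : c.π i =ᶠ[𝓝 x] c.γ i j ∘ c.π j := by
    filter_upwards [((c.isOpen_U i).inter (c.isOpen_U j)).mem_nhds ⟨hx, hx'⟩] with y hy
    exact c.π_eq i j y hy
  rw [h1.mfderiv_eq]
  have h2 : MDifferentiableAt (𝓡 q) (𝓡 q) (c.γ i j) (c.π j x) :=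
    ((contDiffAt_γ hx hx').differentiableAt (by simp)).mdifferentiableAt
  have h3 := mfderiv_comp x h2 (mdifferentiableAt_π hx')
  rw [h3, mfderiv_eq_fderiv]
  rfl

theorem isTangent_iff {i : c.ι} {x : M} (hx : x ∈ c.U i) {v : TangentSpace (𝓡 (q + 1)) x} :
    c.IsTangent x v ↔ mfderiv (𝓡 (q + 1)) (𝓡 q) (c.π i) x v = 0 := by
  refine ⟨fun H => H i hx, fun H j hj => ?_⟩
  rw [mfderiv_π_eq hj hx, H]
  exact map_zero _

/-- The tangent space of the foliation at a point is a line. -/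
theorem exists_tangent (c : HaefligerCocycle.{w} (q + 1) q M) (x : M) :
    ∃ e : TangentSpace (𝓡 (q + 1)) x, e ≠ 0 ∧ ∀ v, c.IsTangent x v ↔ ∃ r : ℝ, v = r • e := by
  obtain ⟨i, hi⟩ := c.exists_mem_U x
  let L : Euc (q + 1) →L[ℝ] Euc q := mfderiv (𝓡 (q + 1)) (𝓡 q) (c.π i) x
  have hL : Function.Surjective L.toLinearMap := c.surjective_mfderiv_π i x hi
  have h1 := L.toLinearMap.finrank_range_add_finrank_ker
  rw [LinearMap.range_eq_top.2 hL, finrank_top] at h1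
  simp only [finrank_euclideanSpace, Fintype.card_fin] at h1
  have h2 : Module.finrank ℝ (LinearMap.ker L.toLinearMap) = 1 := by omega
  obtain ⟨⟨e, he⟩, hne, hspan⟩ := finrank_eq_one_iff'.1 h2
  refine ⟨e, fun H => hne (Subtype.ext H), fun v => ?_⟩
  rw [isTangent_iff hi]
  constructor
  · intro hv
    obtain ⟨r, hr⟩ := hspan ⟨v, hv⟩
    exact ⟨r, (congrArg Subtype.val hr).symm⟩
  · rintro ⟨r, rfl⟩
    have he' : L e = 0 := he
    have : L (r • e) = 0 := by rw [map_smul, he', smul_zero]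
    exact this

/-- Every tangent vector is the sum of a tangent and an orthogonal one. -/
theorem exists_orthogonal_add (c : HaefligerCocycle.{w} (q + 1) q M)
    (g : SmoothMetric (q + 1) M) (x : M) (v : TangentSpace (𝓡 (q + 1)) x) :
    ∃ v₀ v₁, v = v₀ + v₁ ∧ c.IsOrthogonal g x v₀ ∧ c.IsTangent x v₁ := by
  obtain ⟨e, he, hspan⟩ := c.exists_tangent x
  have hpos := g.pos x e he
  refine ⟨v - (g.inner x v e / g.inner x e e) • e, (g.inner x v e / g.inner x e e) • e,
    by simp, fun w hw => ?_, (hspan _).2 ⟨_, rfl⟩⟩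
  obtain ⟨r, rfl⟩ := (hspan _).1 hw
  simp only [map_sub, map_smul, sub_apply, smul_apply, smul_eq_mul]
  field_simp
  ring

/-- The metric `g` induces the transverse metric `h`. -/
structure Induces (c : HaefligerCocycle.{w} (q + 1) q M) (g : SmoothMetric (q + 1) M)
    (h : c.ι → Euc q → Euc q →L[ℝ] Euc q →L[ℝ] ℝ) : Prop where
  isTransverseMetric : c.IsTransverseMetric h
  inner_eq : ∀ i, ∀ x ∈ c.U i, ∀ v w : TangentSpace (𝓡 (q + 1)) x,
      c.IsOrthogonal g x v → c.IsOrthogonal g x w →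
        g.inner x v w = h i (c.π i x) (mfderiv (𝓡 (q + 1)) (𝓡 q) (c.π i) x v)
          (mfderiv (𝓡 (q + 1)) (𝓡 q) (c.π i) x w)

/-- The tangential part of `w` contributes to neither side. With `Induces.le_inner` this supplies
the two first-order hypotheses of `geoForm_eq_of_pullback`. -/
theorem Induces.inner_eq_of_isOrthogonal (H : c.Induces g h) {i : c.ι} {x : M} (hx : x ∈ c.U i)
    {v : TangentSpace (𝓡 (q + 1)) x} (hv : c.IsOrthogonal g x v)
    (w : TangentSpace (𝓡 (q + 1)) x) :
    g.inner x v w = h i (c.π i x) (mfderiv (𝓡 (q + 1)) (𝓡 q) (c.π i) x v)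
          (mfderiv (𝓡 (q + 1)) (𝓡 q) (c.π i) x w) := by
  obtain ⟨w₀, w₁, rfl, h0, h1⟩ := c.exists_orthogonal_add g x w
  have e1 : mfderiv (𝓡 (q + 1)) (𝓡 q) (c.π i) x (w₀ + w₁) =
      mfderiv (𝓡 (q + 1)) (𝓡 q) (c.π i) x w₀ := by
    rw [map_add, (isTangent_iff hx).1 h1]
    exact add_zero _
  rw [e1, map_add, H.inner_eq i x hx v w₀ hv h0, hv w₁ h1, add_zero]

/-- The difference of the two sides is the squared length of the tangential part of `v`. -/
theorem Induces.le_inner (H : c.Induces g h) {i : c.ι} {x : M} (hx : x ∈ c.U i)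
    (v : TangentSpace (𝓡 (q + 1)) x) :
    h i (c.π i x) (mfderiv (𝓡 (q + 1)) (𝓡 q) (c.π i) x v)
      (mfderiv (𝓡 (q + 1)) (𝓡 q) (c.π i) x v) ≤ g.inner x v v := by
  obtain ⟨v₀, v₁, rfl, h0, h1⟩ := c.exists_orthogonal_add g x v
  have e1 : mfderiv (𝓡 (q + 1)) (𝓡 q) (c.π i) x (v₀ + v₁) =
      mfderiv (𝓡 (q + 1)) (𝓡 q) (c.π i) x v₀ := by
    rw [map_add, (isTangent_iff hx).1 h1]
    exact add_zero _
  rw [e1, ← H.inner_eq i x hx v₀ v₀ h0 h0]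
  have e2 : g.inner x v₁ v₀ = 0 := by rw [g.symm]; exact h0 v₁ h1
  have e3 : 0 ≤ g.inner x v₁ v₁ := by
    rcases eq_or_ne v₁ 0 with rfl | hne
    · simp
    · exact (g.pos x v₁ hne).le
  simp only [map_add, add_apply, h0 v₁ h1, e2]
  linarith

end Pointwise

end HaefligerCocycle

/-- The inverse function theorem, with the source shrunk to the open set where the derivative is
invertible, so that the inverse is smooth on the whole target and not only at one point. -/
theorem ContDiffOn.exists_openPartialHomeomorph {V W : Type*} [NormedAddCommGroup V]
    [NormedSpace ℝ V] [CompleteSpace V] [NormedAddCommGroup W] [NormedSpace ℝ W]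
    {Θ : V → W} {Ω : Set V} (hΘ : ContDiffOn ℝ ∞ Θ Ω) (hΩ : IsOpen Ω) {a : V} (ha : a ∈ Ω)
    {e : V ≃L[ℝ] W} (he : HasFDerivAt Θ (e : V →L[ℝ] W) a) :
    ∃ T : OpenPartialHomeomorph V W, a ∈ T.source ∧ T.source ⊆ Ω ∧ (∀ y, T y = Θ y) ∧
      ContDiffOn ℝ ∞ T.symm T.target := by
  have hat : ∀ y ∈ Ω, ContDiffAt ℝ ∞ Θ y := fun y hy => hΘ.contDiffAt (hΩ.mem_nhds hy)
  let T₀ := (hat a ha).toOpenPartialHomeomorph Θ he (by simp)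
  let Ω' : Set V := Ω ∩ fderiv ℝ Θ ⁻¹' range ((↑) : (V ≃L[ℝ] W) → V →L[ℝ] W)
  have hΩ' : IsOpen Ω' :=
    (hΘ.continuousOn_fderiv_of_isOpen hΩ (by simp)).isOpen_inter_preimage hΩ
      ContinuousLinearEquiv.isOpen
  have haΩ' : a ∈ Ω' := ⟨ha, e, he.fderiv.symm⟩
  refine ⟨T₀.restrOpen Ω' hΩ', ?_, ?_, fun y => rfl, fun z hz => ?_⟩
  · rw [OpenPartialHomeomorph.restrOpen_source]
    exact ⟨(hat a ha).mem_toOpenPartialHomeomorph_source he (by simp), haΩ'⟩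
  · rw [OpenPartialHomeomorph.restrOpen_source]
    exact fun y hy => hy.2.1
  · have hz' := (T₀.restrOpen Ω' hΩ').map_target hz
    rw [OpenPartialHomeomorph.restrOpen_source] at hz'
    obtain ⟨e', he'⟩ := hz'.2.2
    have hd : HasFDerivAt (T₀.restrOpen Ω' hΩ') (e' : V →L[ℝ] W)
        ((T₀.restrOpen Ω' hΩ').symm z) := by
      rw [he']
      exact ((hat _ hz'.2.1).differentiableAt (by simp)).hasFDerivAt
    exact ((T₀.restrOpen Ω' hΩ').contDiffAt_symm hz hd (hat _ hz'.2.1)).contDiffWithinAt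

/-! ### Flow boxes -/

namespace HaefligerCocycle

variable {q : ℕ} {M : Type u} [TopologicalSpace M]
  [ChartedSpace (Euc (q + 1)) M] [IsManifold (𝓡 (q + 1)) ∞ M]

/-- A flow box: a chart with values in `ℝ^q × ℝ` whose first component is `π i`. -/
structure IsBox (c : HaefligerCocycle.{w} (q + 1) q M) (i : c.ι)
    (B : OpenPartialHomeomorph M (Euc q × ℝ)) : Prop where
  contMDiffOn : ContMDiffOn (𝓡 (q + 1)) 𝓘(ℝ, Euc q × ℝ) ∞ B B.source
  contMDiffOn_symm : ContMDiffOn 𝓘(ℝ, Euc q × ℝ) (𝓡 (q + 1)) ∞ B.symm B.target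
  subset : B.source ⊆ c.U i
  fst_eq : ∀ x ∈ B.source, (B x).1 = c.π i x

variable {c : HaefligerCocycle.{w} (q + 1) q M} {g : SmoothMetric (q + 1) M}
  {h : c.ι → Euc q → Euc q →L[ℝ] Euc q →L[ℝ] ℝ}

/-- In a chart, `π i` is completed by the linear function `⟨e, ·⟩`, where `e` spans the kernel of
its derivative at the point. The resulting map has an injective, hence invertible, derivative there.
-/
theorem exists_isBox {i : c.ι} {x : M} (hx : x ∈ c.U i) :
    ∃ B, c.IsBox i B ∧ x ∈ B.source := by
  let φ := chartAt (Euc (q + 1)) x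
  have hxφ : x ∈ φ.source := mem_chart_source _ x
  have hφ : ContMDiffOn (𝓡 (q + 1)) 𝓘(ℝ, Euc (q + 1)) ∞ φ φ.source := contMDiffOn_chart
  have hφs : ContMDiffOn 𝓘(ℝ, Euc (q + 1)) (𝓡 (q + 1)) ∞ φ.symm φ.target :=
    contMDiffOn_chart_symm
  let Ω := φ.target ∩ φ.symm ⁻¹' c.U i
  have hΩ : IsOpen Ω := φ.isOpen_inter_preimage_symm (c.isOpen_U i)
  have ha : φ x ∈ Ω := ⟨φ.map_source hxφ, by simpa [φ.left_inv hxφ] using hx⟩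
  have hf : ContDiffOn ℝ ∞ (fun y => c.π i (φ.symm y)) Ω := by
    rw [← contMDiffOn_iff_contDiffOn]
    exact (c.contMDiffOn_π i).comp (hφs.mono inter_subset_left) (fun y hy => hy.2)
  have hfd : HasFDerivAt (fun y => c.π i (φ.symm y)) (fderiv ℝ (fun y => c.π i (φ.symm y)) (φ x))
      (φ x) := ((hf.contDiffAt (hΩ.mem_nhds ha)).differentiableAt (by simp)).hasFDerivAt
  set D := fderiv ℝ (fun y => c.π i (φ.symm y)) (φ x) with hD
  have hDsurj : Function.Surjective D := by
    have h1 : HasMFDerivAt (𝓡 (q + 1)) 𝓘(ℝ, Euc (q + 1)) φ x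
        (mfderiv (𝓡 (q + 1)) 𝓘(ℝ, Euc (q + 1)) φ x) :=
      ((hφ.contMDiffAt (φ.open_source.mem_nhds hxφ)).mdifferentiableAt (by simp)).hasMFDerivAt
    have h2 : HasMFDerivAt (𝓡 (q + 1)) (𝓡 q) ((fun y => c.π i (φ.symm y)) ∘ φ) x
        (D.comp (mfderiv (𝓡 (q + 1)) 𝓘(ℝ, Euc (q + 1)) φ x : Euc (q + 1) →L[ℝ] Euc (q + 1))) :=
      HasMFDerivAt.comp x hfd.hasMFDerivAt h1
    have h3 : ((fun y => c.π i (φ.symm y)) ∘ φ) =ᶠ[𝓝 x] c.π i := by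
      filter_upwards [φ.open_source.mem_nhds hxφ] with y hy
      simp [φ.left_inv hy]
    have h4 := (h2.congr_of_eventuallyEq h3.symm).mfderiv
    have h5 := c.surjective_mfderiv_π i x hx
    intro v
    obtain ⟨w, hw⟩ := h5 v
    rw [h4] at hw
    exact ⟨_, hw⟩
  have hfr : Module.finrank ℝ (LinearMap.ker D.toLinearMap) = 1 := by
    have h1 := D.toLinearMap.finrank_range_add_finrank_ker
    rw [LinearMap.range_eq_top.2 hDsurj, finrank_top] at h1
    simp only [finrank_euclideanSpace, Fintype.card_fin] at h1
    omega
  obtain ⟨⟨e, he⟩, hne, hspan⟩ := finrank_eq_one_iff'.1 hfr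
  let L : Euc (q + 1) →L[ℝ] Euc q × ℝ := D.prod (innerSL ℝ e)
  have hLinj : Function.Injective L.toLinearMap := by
    rw [← LinearMap.ker_eq_bot, LinearMap.ker_eq_bot']
    intro v hv
    have hv' : (D v, inner ℝ e v) = ((0, 0) : Euc q × ℝ) := hv
    rw [Prod.mk.injEq] at hv'
    obtain ⟨r, hr⟩ := hspan ⟨v, hv'.1⟩
    have hr' : r • e = v := congrArg Subtype.val hr
    have hne' : e ≠ 0 := fun H => hne (Subtype.ext H)
    rw [← hr', inner_smul_right, mul_eq_zero, inner_self_eq_zero] at hv'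
    rcases hv'.2 with h | h
    · simp [← hr', h]
    · exact absurd h hne'
  let eL : Euc (q + 1) ≃L[ℝ] Euc q × ℝ :=
    (LinearEquiv.ofInjectiveOfFinrankEq L.toLinearMap hLinj (by simp)).toContinuousLinearEquiv
  have hΘ : ContDiffOn ℝ ∞ (fun y => (c.π i (φ.symm y), innerSL ℝ e y)) Ω :=
    hf.prodMk (innerSL ℝ e).contDiff.contDiffOn
  have hΘd : HasFDerivAt (fun y => (c.π i (φ.symm y), innerSL ℝ e y))
      (eL : Euc (q + 1) →L[ℝ] Euc q × ℝ) (φ x) := by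
    have : (eL : Euc (q + 1) →L[ℝ] Euc q × ℝ) = L := by ext1 v; rfl
    rw [this]
    exact hfd.prodMk (innerSL ℝ e).hasFDerivAt
  obtain ⟨T, haT, hTΩ, hTeq, hTs⟩ := hΘ.exists_openPartialHomeomorph hΩ ha hΘd
  have hTc : ContDiffOn ℝ ∞ T T.source := (hΘ.mono hTΩ).congr fun y _ => hTeq y
  refine ⟨φ.trans T, ⟨?_, ?_, fun y hy => ?_, fun y hy => ?_⟩, ?_⟩
  · exact (contMDiffOn_iff_contDiffOn.2 hTc).comp (hφ.mono fun y hy => hy.1) fun y hy => hy.2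
  · exact hφs.comp ((contMDiffOn_iff_contDiffOn.2 hTs).mono fun y hy => hy.1) fun y hy => hy.2
  · have := (hTΩ hy.2).2
    simpa [φ.left_inv hy.1] using this
  · simp [hTeq, φ.left_inv hy.1]
  · exact ⟨hxφ, haT⟩

section Box

variable {i : c.ι} {B : OpenPartialHomeomorph M (Euc q × ℝ)}

theorem IsBox.contMDiffAt (hB : c.IsBox i B) {x : M} (hx : x ∈ B.source) :
    ContMDiffAt (𝓡 (q + 1)) 𝓘(ℝ, Euc q × ℝ) ∞ B x :=
  hB.contMDiffOn.contMDiffAt (B.open_source.mem_nhds hx)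

theorem IsBox.contMDiffAt_symm (hB : c.IsBox i B) {y : Euc q × ℝ} (hy : y ∈ B.target) :
    ContMDiffAt 𝓘(ℝ, Euc q × ℝ) (𝓡 (q + 1)) ∞ B.symm y :=
  hB.contMDiffOn_symm.contMDiffAt (B.open_target.mem_nhds hy)

theorem IsBox.mfderiv_symm_mfderiv (hB : c.IsBox i B) {x : M} (hx : x ∈ B.source)
    (v : TangentSpace (𝓡 (q + 1)) x) :
    (mfderiv 𝓘(ℝ, Euc q × ℝ) (𝓡 (q + 1)) B.symm (B x)
      (mfderiv (𝓡 (q + 1)) 𝓘(ℝ, Euc q × ℝ) B x v) : Euc (q + 1)) = v := by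
  have h1 : HasMFDerivAt (𝓡 (q + 1)) 𝓘(ℝ, Euc q × ℝ) B x _ :=
    ((hB.contMDiffAt hx).mdifferentiableAt (by simp)).hasMFDerivAt
  have h2 : HasMFDerivAt 𝓘(ℝ, Euc q × ℝ) (𝓡 (q + 1)) B.symm (B x) _ :=
    ((hB.contMDiffAt_symm (B.map_source hx)).mdifferentiableAt (by simp)).hasMFDerivAt
  have h3 := h2.comp x h1
  have h4 : B.symm ∘ B =ᶠ[𝓝 x] id := by
    filter_upwards [B.open_source.mem_nhds hx] with y hy using B.left_inv hy
  have h5 := (h3.congr_of_eventuallyEq h4.symm).mfderiv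
  rw [mfderiv_id] at h5
  exact (congrArg (fun L : Euc (q + 1) →L[ℝ] Euc (q + 1) => L v) h5).symm

theorem IsBox.mfderiv_mfderiv_symm (hB : c.IsBox i B) {y : Euc q × ℝ} (hy : y ∈ B.target)
    (v : Euc q × ℝ) :
    (mfderiv (𝓡 (q + 1)) 𝓘(ℝ, Euc q × ℝ) B (B.symm y)
      (mfderiv 𝓘(ℝ, Euc q × ℝ) (𝓡 (q + 1)) B.symm y v) : Euc q × ℝ) = v := by
  have h1 : HasMFDerivAt (𝓡 (q + 1)) 𝓘(ℝ, Euc q × ℝ) B (B.symm y) _ :=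
    ((hB.contMDiffAt (B.map_target hy)).mdifferentiableAt (by simp)).hasMFDerivAt
  have h2 : HasMFDerivAt 𝓘(ℝ, Euc q × ℝ) (𝓡 (q + 1)) B.symm y _ :=
    ((hB.contMDiffAt_symm hy).mdifferentiableAt (by simp)).hasMFDerivAt
  have h3 := h1.comp y h2
  have h4 : B ∘ B.symm =ᶠ[𝓝 y] id := by
    filter_upwards [B.open_target.mem_nhds hy] with z hz using B.right_inv hz
  have h5 := (h3.congr_of_eventuallyEq h4.symm).mfderiv
  rw [mfderiv_id] at h5
  exact (congrArg (fun L : Euc q × ℝ →L[ℝ] Euc q × ℝ => L v) h5).symm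

theorem IsBox.mfderiv_fst (hB : c.IsBox i B) {x : M} (hx : x ∈ B.source)
    (v : TangentSpace (𝓡 (q + 1)) x) :
    (mfderiv (𝓡 (q + 1)) 𝓘(ℝ, Euc q × ℝ) B x v : Euc q × ℝ).1 =
      mfderiv (𝓡 (q + 1)) (𝓡 q) (c.π i) x v := by
  have h1 : HasMFDerivAt (𝓡 (q + 1)) 𝓘(ℝ, Euc q × ℝ) B x _ :=
    ((hB.contMDiffAt hx).mdifferentiableAt (by simp)).hasMFDerivAt
  have h2 : HasMFDerivAt 𝓘(ℝ, Euc q × ℝ) (𝓡 q) (Prod.fst : Euc q × ℝ → Euc q) (B x)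
    (ContinuousLinearMap.fst ℝ (Euc q) ℝ) := (hasFDerivAt_fst (p := B x)).hasMFDerivAt
  have h3 := h2.comp x h1
  have h4 : Prod.fst ∘ B =ᶠ[𝓝 x] c.π i := by
    filter_upwards [B.open_source.mem_nhds hx] with y hy using hB.fst_eq y hy
  have h5 := (h3.congr_of_eventuallyEq h4.symm).mfderiv
  exact (congrArg (fun L : Euc (q + 1) →L[ℝ] Euc q => L v) h5).symm

theorem IsBox.isTangent_iff (hB : c.IsBox i B) {x : M} (hx : x ∈ B.source)
    (v : TangentSpace (𝓡 (q + 1)) x) :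
    c.IsTangent x v ↔ (mfderiv (𝓡 (q + 1)) 𝓘(ℝ, Euc q × ℝ) B x v : Euc q × ℝ).1 = 0 := by
  rw [hB.mfderiv_fst hx, HaefligerCocycle.isTangent_iff (hB.subset hx)]
  rfl

/-- Submersions are open: in a flow box they are the first projection. Thus `h i`, controlled only
on `π i (U i)`, is smooth in a full neighbourhood of each point there. -/
theorem image_π_mem_nhds {x : M} {s : Set M} (hs : s ∈ 𝓝 x) (i : c.ι) (hx : x ∈ c.U i) :
    c.π i '' s ∈ 𝓝 (c.π i x) := by
  obtain ⟨B, hB, hxB⟩ := exists_isBox hx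
  have h1 : (fun y => (B.symm y)) ⁻¹' s ∩ B.target ∈ 𝓝 (B x) :=
    Filter.inter_mem ((B.continuousAt_symm (B.map_source hxB)).preimage_mem_nhds
      (by rwa [B.left_inv hxB])) (B.open_target.mem_nhds (B.map_source hxB))
  have h2 := isOpenMap_fst.image_mem_nhds h1
  rw [hB.fst_eq x hxB] at h2
  refine Filter.mem_of_superset h2 ?_
  rintro _ ⟨y, hy, rfl⟩
  refine ⟨B.symm y, hy.1, ?_⟩
  rw [← hB.fst_eq _ (B.map_target hy.2), B.right_inv hy.2]

theorem Induces.contDiffAt (H : c.Induces g h) {x : M} (hx : x ∈ c.U i) :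
    ContDiffAt ℝ ∞ (h i) (c.π i x) :=
  (H.isTransverseMetric.contDiffOn i).contDiffAt
    (image_π_mem_nhds ((c.isOpen_U i).mem_nhds hx) i hx)

theorem Induces.pos (H : c.Induces g h) {x : M} (hx : x ∈ c.U i) (v : Euc q) (hv : v ≠ 0) :
    0 < h i (c.π i x) v v :=
  H.isTransverseMetric.pos i _ (mem_image_of_mem _ hx) v hv

/-- The orthogonal complement of the foliation in a flow box is the graph of this linear map. -/
def boxConn (g : SmoothMetric (q + 1) M) (B : OpenPartialHomeomorph M (Euc q × ℝ))
    (y : Euc q × ℝ) : Euc q →L[ℝ] ℝ :=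
  -(pullMetric g B.symm y (0, 1) (0, 1))⁻¹ •
    (pullMetric g B.symm y (0, 1)).comp (ContinuousLinearMap.inl ℝ (Euc q) ℝ)

theorem IsBox.pullMetric_pos (hB : c.IsBox i B) (g : SmoothMetric (q + 1) M)
    {y : Euc q × ℝ} (hy : y ∈ B.target) : 0 < pullMetric g B.symm y (0, 1) (0, 1) := by
  rw [pullMetric_apply]
  refine g.pos _ _ fun H => ?_
  have h1 := hB.mfderiv_mfderiv_symm hy (0, 1)
  rw [H] at h1
  have h2 : ((0 : Euc q), (1 : ℝ)) = 0 := by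
    rw [← h1]
    exact map_zero (mfderiv (𝓡 (q + 1)) 𝓘(ℝ, Euc q × ℝ) B (B.symm y))
  simp at h2

theorem IsBox.contDiffOn_boxConn (hB : c.IsBox i B) (g : SmoothMetric (q + 1) M) :
    ContDiffOn ℝ ∞ (boxConn g B) B.target := by
  have h1 := contDiffOn_pullMetric g B.open_target hB.contMDiffOn_symm
  have h2 : ContDiffOn ℝ ∞ (fun y => pullMetric g B.symm y (0, 1)) B.target :=
    h1.clm_apply contDiffOn_const
  have h3 : ContDiffOn ℝ ∞ (fun y => pullMetric g B.symm y (0, 1) (0, 1)) B.target :=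
    h2.clm_apply contDiffOn_const
  exact ((h3.inv fun y hy => (hB.pullMetric_pos g hy).ne').neg).smul (h2.clm_comp contDiffOn_const)

/-- The tangent line of the leaf is spanned by the last coordinate vector, so orthogonality is a
single linear equation, and it can be solved for the last component. -/
theorem IsBox.isOrthogonal_iff (hB : c.IsBox i B) (g : SmoothMetric (q + 1) M) {x : M}
    (hx : x ∈ B.source) (v : TangentSpace (𝓡 (q + 1)) x) :
    c.IsOrthogonal g x v ↔ (mfderiv (𝓡 (q + 1)) 𝓘(ℝ, Euc q × ℝ) B x v : Euc q × ℝ).2 =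
      boxConn g B (B x) (mfderiv (𝓡 (q + 1)) 𝓘(ℝ, Euc q × ℝ) B x v : Euc q × ℝ).1 := by
  set v' : Euc q × ℝ := mfderiv (𝓡 (q + 1)) 𝓘(ℝ, Euc q × ℝ) B x v with hv'
  have hpos := hB.pullMetric_pos g (B.map_source hx)
  obtain ⟨e, he⟩ : ∃ e : TangentSpace (𝓡 (q + 1)) x, e = (mfderiv 𝓘(ℝ, Euc q × ℝ) (𝓡 (q + 1))
    B.symm (B x) (0, 1) : Euc (q + 1)) := ⟨_, rfl⟩
  have hpull : ∀ a b : Euc q × ℝ, pullMetric g B.symm (B x) a b =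
      g.inner x (mfderiv 𝓘(ℝ, Euc q × ℝ) (𝓡 (q + 1)) B.symm (B x) a : Euc (q + 1))
        (mfderiv 𝓘(ℝ, Euc q × ℝ) (𝓡 (q + 1)) B.symm (B x) b : Euc (q + 1)) := by
    intro a b
    rw [pullMetric_apply, B.left_inv hx]
  have h1 : c.IsOrthogonal g x v ↔ g.inner x e v = 0 := by
    constructor
    · intro H
      rw [g.symm]
      refine H e ?_
      rw [hB.isTangent_iff hx, he]
      have := hB.mfderiv_mfderiv_symm (B.map_source hx) (0, 1)
      rw [B.left_inv hx] at this
      exact congrArg Prod.fst this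
    · intro H w hw
      rw [hB.isTangent_iff hx] at hw
      set w' : Euc q × ℝ := mfderiv (𝓡 (q + 1)) 𝓘(ℝ, Euc q × ℝ) B x w with hw'
      have h2 : w' = w'.2 • ((0, 1) : Euc q × ℝ) := by ext1 <;> simp [hw]
      have h3 : w = w'.2 • e := by
        have h4 := hB.mfderiv_symm_mfderiv hx w
        rw [← hw', h2] at h4
        rw [← h4, he]
        exact map_smul (mfderiv 𝓘(ℝ, Euc q × ℝ) (𝓡 (q + 1)) B.symm (B x)) _ _
      rw [h3, map_smul, g.symm, H, smul_zero]
  have h5 : g.inner x e v = pullMetric g B.symm (B x) (0, 1) v' := by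
    rw [hpull, ← he, hv', hB.mfderiv_symm_mfderiv hx v]
  have h6 : v' = (v'.1, 0) + v'.2 • ((0, 1) : Euc q × ℝ) := by ext1 <;> simp
  have h7 : pullMetric g B.symm (B x) (0, 1) v' =
      pullMetric g B.symm (B x) (0, 1) (v'.1, 0) +
        v'.2 * pullMetric g B.symm (B x) (0, 1) (0, 1) := by
    conv_lhs => rw [h6]
    rw [map_add, map_smul, smul_eq_mul]
  have h8 : boxConn g B (B x) v'.1 = -(pullMetric g B.symm (B x) (0, 1) (0, 1))⁻¹ *
      pullMetric g B.symm (B x) (0, 1) (v'.1, 0) := rfl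
  rw [h1, h5, h7, h8]
  constructor
  · intro H
    field_simp
    linarith
  · intro H
    rw [H]
    field_simp
    ring

end Box

end HaefligerCocycle

theorem ContDiffAt.deriv_infty {V : Type*} [NormedAddCommGroup V] [NormedSpace ℝ V] {f : ℝ → V}
    {t : ℝ} (hf : ContDiffAt ℝ ∞ f t) : ContDiffAt ℝ ∞ (deriv f) t :=
  (hf.fderiv_right (m := ∞) (by simp)).clm_apply contDiffAt_const

theorem HasDerivAt.fst_comp {V W : Type*} [NormedAddCommGroup V] [NormedSpace ℝ V]
    [NormedAddCommGroup W] [NormedSpace ℝ W] {α : ℝ → V × W} {p : V × W} {t : ℝ}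
    (hα : HasDerivAt α p t) : HasDerivAt (fun s => (α s).1) p.1 t :=
  (ContinuousLinearMap.fst ℝ V W).hasFDerivAt.comp_hasDerivAt t hα

theorem HasDerivAt.snd_comp {V W : Type*} [NormedAddCommGroup V] [NormedSpace ℝ V]
    [NormedAddCommGroup W] [NormedSpace ℝ W] {α : ℝ → V × W} {p : V × W} {t : ℝ}
    (hα : HasDerivAt α p t) : HasDerivAt (fun s => (α s).2) p.2 t :=
  (ContinuousLinearMap.snd ℝ V W).hasFDerivAt.comp_hasDerivAt t hα

section Curves

variable {n : ℕ} {M : Type u} [TopologicalSpace M] [ChartedSpace (Euc n) M]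

theorem hasDerivAt_comp_curve {V : Type*} [NormedAddCommGroup V] [NormedSpace ℝ V]
    {φ : M → V} {γ : ℝ → M} {t : ℝ}
    (hφ : ContMDiffAt (𝓡 n) 𝓘(ℝ, V) ∞ φ (γ t)) (hγ : ContMDiffAt 𝓘(ℝ, ℝ) (𝓡 n) ∞ γ t) :
    HasDerivAt (fun s => φ (γ s)) (mfderiv (𝓡 n) 𝓘(ℝ, V) φ (γ t)
      (mfderiv 𝓘(ℝ, ℝ) (𝓡 n) γ t (1 : ℝ)) : V) t := by
  have h1 := (hφ.mdifferentiableAt (by simp)).hasMFDerivAt.comp t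
    (hγ.mdifferentiableAt (by simp)).hasMFDerivAt
  let L : ℝ →L[ℝ] V := (mfderiv (𝓡 n) 𝓘(ℝ, V) φ (γ t)).comp (mfderiv 𝓘(ℝ, ℝ) (𝓡 n) γ t)
  have h2 : HasFDerivAt (fun s => φ (γ s)) L t := hasMFDerivAt_iff_hasFDerivAt.1 h1
  exact h2.hasDerivAt

theorem contDiffAt_comp_curve {V : Type*} [NormedAddCommGroup V] [NormedSpace ℝ V]
    {φ : M → V} {γ : ℝ → M} {t : ℝ}
    (hφ : ContMDiffAt (𝓡 n) 𝓘(ℝ, V) ∞ φ (γ t)) (hγ : ContMDiffAt 𝓘(ℝ, ℝ) (𝓡 n) ∞ γ t) :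
    ContDiffAt ℝ ∞ (fun s => φ (γ s)) t :=
  contMDiffAt_iff_contDiffAt.1 (hφ.comp t hγ)

end Curves

/-! ### Horizontal geodesics and their differential equation -/

namespace HaefligerCocycle

variable {q : ℕ} {M : Type u} [TopologicalSpace M]
  [ChartedSpace (Euc (q + 1)) M] [IsManifold (𝓡 (q + 1)) ∞ M]

/-- A horizontal geodesic on an open interval `J`: a curve orthogonal to the leaves which is mapped
by the submersions `π i` to geodesics of the transverse metric. -/
structure IsHG (c : HaefligerCocycle.{w} (q + 1) q M) (g : SmoothMetric (q + 1) M)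
    (h : c.ι → Euc q → Euc q →L[ℝ] Euc q →L[ℝ] ℝ) (γ : ℝ → M) (J : Set ℝ) : Prop where
  isOpen : IsOpen J
  ordConnected : J.OrdConnected
  contMDiffOn : ContMDiffOn 𝓘(ℝ, ℝ) (𝓡 (q + 1)) ∞ γ J
  orth : ∀ t ∈ J, c.IsOrthogonal g (γ t) (mfderiv 𝓘(ℝ, ℝ) (𝓡 (q + 1)) γ t (1 : ℝ))
  geo : ∀ t ∈ J, ∀ i, γ t ∈ c.U i → deriv (deriv fun s => c.π i (γ s)) t =
    geoVec (h i) (c.π i (γ t)) (deriv (fun s => c.π i (γ s)) t)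

/-- Two curves have the same 1-jet at `t` after projection by some `π i`. -/
def ShareJet (c : HaefligerCocycle.{w} (q + 1) q M) (γ γ' : ℝ → M) (t : ℝ) : Prop :=
  ∃ i, γ t ∈ c.U i ∧ γ' t ∈ c.U i ∧ c.π i (γ t) = c.π i (γ' t) ∧
    deriv (fun s => c.π i (γ s)) t = deriv (fun s => c.π i (γ' s)) t

/-- The state of a curve in a flow box: its position and the velocity of its projection. -/
def boxState (c : HaefligerCocycle.{w} (q + 1) q M) (i : c.ι)
    (B : OpenPartialHomeomorph M (Euc q × ℝ)) (γ : ℝ → M) (t : ℝ) : (Euc q × ℝ) × Euc q :=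
  (B (γ t), deriv (fun s => c.π i (γ s)) t)

/-- The vector field of horizontal geodesics in a flow box. -/
def boxField (g : SmoothMetric (q + 1) M) (k : Euc q → Euc q →L[ℝ] Euc q →L[ℝ] ℝ)
    (B : OpenPartialHomeomorph M (Euc q × ℝ)) (p : (Euc q × ℝ) × Euc q) : (Euc q × ℝ) × Euc q :=
  ((p.2, boxConn g B p.1 p.2), geoVec k p.1.1 p.2)

variable {c : HaefligerCocycle.{w} (q + 1) q M} {g : SmoothMetric (q + 1) M}
  {h : c.ι → Euc q → Euc q →L[ℝ] Euc q →L[ℝ] ℝ} {γ γ' : ℝ → M} {J : Set ℝ} {i j : c.ι}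
  {B : OpenPartialHomeomorph M (Euc q × ℝ)} {t : ℝ}

theorem IsHG.contMDiffAt (hγ : c.IsHG g h γ J) (ht : t ∈ J) :
    ContMDiffAt 𝓘(ℝ, ℝ) (𝓡 (q + 1)) ∞ γ t :=
  hγ.contMDiffOn.contMDiffAt (hγ.isOpen.mem_nhds ht)

theorem IsHG.continuousAt (hγ : c.IsHG g h γ J) (ht : t ∈ J) : ContinuousAt γ t :=
  (hγ.contMDiffAt ht).continuousAt

theorem deriv_π_comp (hγ : ContMDiffAt 𝓘(ℝ, ℝ) (𝓡 (q + 1)) ∞ γ t) (hi : γ t ∈ c.U i) :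
    deriv (fun s => c.π i (γ s)) t = (mfderiv (𝓡 (q + 1)) (𝓡 q) (c.π i) (γ t)
      (mfderiv 𝓘(ℝ, ℝ) (𝓡 (q + 1)) γ t (1 : ℝ)) : Euc q) :=
  (hasDerivAt_comp_curve (contMDiffAt_π hi) hγ).deriv

theorem deriv_π_eq (hγ : ContMDiffAt 𝓘(ℝ, ℝ) (𝓡 (q + 1)) ∞ γ t) (hi : γ t ∈ c.U i)
    (hj : γ t ∈ c.U j) : deriv (fun s => c.π i (γ s)) t =
      fderiv ℝ (c.γ i j) (c.π j (γ t)) (deriv (fun s => c.π j (γ s)) t) := by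
  rw [deriv_π_comp hγ hi, deriv_π_comp hγ hj, mfderiv_π_eq hi hj]

theorem ShareJet.eq (H : c.ShareJet γ γ' t)
    (hγ : ContMDiffAt 𝓘(ℝ, ℝ) (𝓡 (q + 1)) ∞ γ t) (hγ' : ContMDiffAt 𝓘(ℝ, ℝ) (𝓡 (q + 1)) ∞ γ' t)
    (hi : γ t ∈ c.U i) (hi' : γ' t ∈ c.U i) : c.π i (γ t) = c.π i (γ' t) ∧
      deriv (fun s => c.π i (γ s)) t = deriv (fun s => c.π i (γ' s)) t := by
  obtain ⟨j, hj, hj', e1, e2⟩ := H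
  rw [c.π_eq i j _ ⟨hi, hj⟩, c.π_eq i j _ ⟨hi', hj'⟩, deriv_π_eq hγ hi hj, deriv_π_eq hγ' hi' hj',
    e1, e2]
  exact ⟨rfl, rfl⟩

/-- The transition map is a local isometry, so `geoForm_eq_of_pullback` applies with equality in
`hle`. Its derivative is surjective, so every test vector is reached. -/
theorem geo_of_geo (H : c.Induces g h) (hγ : ContMDiffAt 𝓘(ℝ, ℝ) (𝓡 (q + 1)) ∞ γ t)
    (hi : γ t ∈ c.U i) (hj : γ t ∈ c.U j)
    (hgeo : deriv (deriv fun s => c.π j (γ s)) t =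
      geoVec (h j) (c.π j (γ t)) (deriv (fun s => c.π j (γ s)) t)) :
    deriv (deriv fun s => c.π i (γ s)) t =
      geoVec (h i) (c.π i (γ t)) (deriv (fun s => c.π i (γ s)) t) := by
  rw [← geoForm_eq_zero_iff (H.pos hj)] at hgeo
  rw [← geoForm_eq_zero_iff (H.pos hi)]
  have hij : c.U i ∩ c.U j ∈ 𝓝 (γ t) := ((c.isOpen_U i).inter (c.isOpen_U j)).mem_nhds ⟨hi, hj⟩
  have hev : (fun s => c.π i (γ s)) =ᶠ[𝓝 t] fun s => c.γ i j (c.π j (γ s)) := by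
    filter_upwards [hγ.continuousAt.preimage_mem_nhds hij] with s hs using c.π_eq i j _ hs
  have hu : ContDiffAt ℝ ∞ (fun s => c.π j (γ s)) t :=
    contDiffAt_comp_curve (contMDiffAt_π hj) hγ
  have hpull : ∀ᶠ y in 𝓝 (c.π j (γ t)), ∀ v w, h i (c.γ i j y) (fderiv ℝ (c.γ i j) y v)
      (fderiv ℝ (c.γ i j) y w) = h j y v w := by
    filter_upwards [image_π_mem_nhds hij j hj] with y hy
      using H.isTransverseMetric.pullback_γ i j y hy
  have key := geoForm_eq_of_pullback (u := fun s => c.π j (γ s)) (G := h j) (h := h i)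
    (f := c.γ i j) ((H.contDiffAt hj).differentiableAt (by simp))
    (by rw [← c.π_eq i j _ ⟨hi, hj⟩]; exact (H.contDiffAt hi).differentiableAt (by simp))
    (contDiffAt_infty.1 (contDiffAt_γ hi hj) 2)
    (by rw [← c.π_eq i j _ ⟨hi, hj⟩]
        exact H.isTransverseMetric.symm i _ (mem_image_of_mem _ hi))
    (((contDiffAt_infty.1 hu 1).eventually (by simp)).mono
      fun s hs => hs.differentiableAt (by simp))
    (hu.deriv_infty.differentiableAt (by simp))
    (hpull.mono fun y hy v => (hy v v).le)
    ((hu.continuousAt.eventually hpull).mono fun s hs w => (hs _ w).symm)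
  intro w
  have hsurj : ∃ v, fderiv ℝ (c.γ i j) (c.π j (γ t)) v = w := by
    obtain ⟨v, hv⟩ := c.surjective_mfderiv_π i _ hi w
    exact ⟨_, (mfderiv_π_eq hi hj v).symm.trans hv⟩
  obtain ⟨v, rfl⟩ := hsurj
  have := key v
  rw [hgeo v] at this
  rw [hev.deriv_eq, hev.deriv.deriv_eq, c.π_eq i j _ ⟨hi, hj⟩]
  exact this.symm

theorem IsHG.contDiffAt_π (hγ : c.IsHG g h γ J) (ht : t ∈ J) (hi : γ t ∈ c.U i) :
    ContDiffAt ℝ ∞ (fun s => c.π i (γ s)) t :=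
  contDiffAt_comp_curve (contMDiffAt_π hi) (hγ.contMDiffAt ht)

theorem IsHG.continuousAt_boxState (hγ : c.IsHG g h γ J) (ht : t ∈ J) (hB : c.IsBox i B)
    (hγB : γ t ∈ B.source) : ContinuousAt (c.boxState i B γ) t :=
  ((B.continuousAt hγB).comp (hγ.continuousAt ht)).prodMk
    (hγ.contDiffAt_π ht (hB.subset hγB)).deriv_infty.continuousAt

/-- Orthogonality determines the velocity in the leaf coordinate and the geodesic equation
determines the projected acceleration; together they form a first-order equation for position and
projected velocity. -/
theorem IsHG.hasDerivAt_boxState (hγ : c.IsHG g h γ J) (ht : t ∈ J) (hB : c.IsBox i B)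
    (hγB : γ t ∈ B.source) :
    HasDerivAt (c.boxState i B γ) (boxField g (h i) B (c.boxState i B γ t)) t := by
  have h1 := hasDerivAt_comp_curve (hB.contMDiffAt hγB) (hγ.contMDiffAt ht)
  set v : Euc q × ℝ := mfderiv (𝓡 (q + 1)) 𝓘(ℝ, Euc q × ℝ) B (γ t)
      (mfderiv 𝓘(ℝ, ℝ) (𝓡 (q + 1)) γ t (1 : ℝ)) with hv
  have h2 : v.1 = deriv (fun s => c.π i (γ s)) t := by
    rw [deriv_π_comp (hγ.contMDiffAt ht) (hB.subset hγB), hv, hB.mfderiv_fst hγB]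
  have h3 : v.2 = boxConn g B (B (γ t)) v.1 :=
    (hB.isOrthogonal_iff g hγB _).1 (hγ.orth t ht)
  have h4 : HasDerivAt (deriv fun s => c.π i (γ s)) _ t :=
    ((hγ.contDiffAt_π ht (hB.subset hγB)).deriv_infty.differentiableAt (by simp)).hasDerivAt
  rw [hγ.geo t ht i (hB.subset hγB), ← hB.fst_eq _ hγB] at h4
  have h5 : v = (deriv (fun s => c.π i (γ s)) t,
      boxConn g B (B (γ t)) (deriv (fun s => c.π i (γ s)) t)) := by
    rw [← h2, ← h3, Prod.mk.eta]
  rw [h5] at h1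
  exact h1.prodMk h4

theorem IsBox.contDiffOn_boxField (hB : c.IsBox i B) (H : c.Induces g h) :
    ContDiffOn ℝ ∞ (boxField g (h i) B) (B.target ×ˢ univ) := by
  have hc : ContDiffOn ℝ ∞ (fun p : (Euc q × ℝ) × Euc q => boxConn g B p.1) (B.target ×ˢ univ) :=
    (hB.contDiffOn_boxConn g).comp contDiff_fst.contDiffOn fun p hp => hp.1
  have hg : ContDiffOn ℝ ∞ (fun p : (Euc q × ℝ) × Euc q => geoVec (h i) p.1.1 p.2)
      (B.target ×ˢ univ) := by
    rintro ⟨y, ξ⟩ ⟨hy, -⟩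
    have hm := B.map_target hy
    have e : y.1 = c.π i (B.symm y) := by rw [← hB.fst_eq _ hm, B.right_inv hy]
    have h1 : ContDiffAt ℝ ∞ (fun p : Euc q × Euc q => geoVec (h i) p.1 p.2) (y.1, ξ) := by
      rw [e]
      exact contDiffAt_geoVec (H.pos (hB.subset hm)) (H.contDiffAt (hB.subset hm)) ξ
    have h2 : ContDiffAt ℝ ∞ (fun p : (Euc q × ℝ) × Euc q => (p.1.1, p.2)) (y, ξ) := by fun_prop
    exact (ContDiffAt.comp (g := fun p : Euc q × Euc q => geoVec (h i) p.1 p.2) (y, ξ)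
      h1 h2).contDiffWithinAt
  exact (contDiffOn_snd.prodMk (hc.clm_apply contDiffOn_snd)).prodMk hg

theorem IsBox.contDiffAt_boxField (hB : c.IsBox i B) (H : c.Induces g h)
    {p : (Euc q × ℝ) × Euc q} (hp : p.1 ∈ B.target) : ContDiffAt ℝ ∞ (boxField g (h i) B) p :=
  (hB.contDiffOn_boxField H).contDiffAt ((B.open_target.prod isOpen_univ).mem_nhds ⟨hp, trivial⟩)

/-- A solution of the differential equation of horizontal geodesics in a flow box. -/
theorem IsBox.boxState_of_ode (hB : c.IsBox i B)
    (hJ : IsOpen J) {α : ℝ → (Euc q × ℝ) × Euc q} (hαB : ∀ t ∈ J, (α t).1 ∈ B.target)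
    (hα : ∀ t ∈ J, HasDerivAt α (boxField g (h i) B (α t)) t) :
    ∀ t ∈ J, c.boxState i B (fun s => B.symm (α s).1) t = α t := by
  intro t ht
  have h0 : (fun s => c.π i (B.symm (α s).1)) =ᶠ[𝓝 t] fun s => (α s).1.1 := by
    filter_upwards [hJ.mem_nhds ht] with s hs
    rw [← hB.fst_eq _ (B.map_target (hαB s hs)), B.right_inv (hαB s hs)]
  have h1 : deriv (fun s => (α s).1.1) t = (α t).2 :=
    (((hα t ht).fst_comp).fst_comp).deriv
  simp only [boxState, B.right_inv (hαB t ht), h0.deriv_eq, h1]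

/-- The converse of `IsHG.hasDerivAt_boxState`. The equation holds for the submersion of the box by
construction and passes to the other submersions by `geo_of_geo`. -/
theorem IsBox.isHG_of_ode (hB : c.IsBox i B) (H : c.Induces g h)
    (hJ : IsOpen J) (hJ' : J.OrdConnected) {α : ℝ → (Euc q × ℝ) × Euc q}
    (hαB : ∀ t ∈ J, (α t).1 ∈ B.target)
    (hα : ∀ t ∈ J, HasDerivAt α (boxField g (h i) B (α t)) t) :
    c.IsHG g h (fun t => B.symm (α t).1) J := by
  have hsm : ContDiffOn ℝ ∞ α J :=
    contDiffOn_of_ode (hB.contDiffOn_boxField H) hJ hα fun t ht => ⟨hαB t ht, trivial⟩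
  have hγ : ContMDiffOn 𝓘(ℝ, ℝ) (𝓡 (q + 1)) ∞ (fun t => B.symm (α t).1) J :=
    hB.contMDiffOn_symm.comp (contMDiffOn_iff_contDiffOn.2 (contDiff_fst.comp_contDiffOn hsm)) hαB
  have hγt : ∀ t ∈ J, ContMDiffAt 𝓘(ℝ, ℝ) (𝓡 (q + 1)) ∞ (fun t => B.symm (α t).1) t :=
    fun t ht => hγ.contMDiffAt (hJ.mem_nhds ht)
  have hst := hB.boxState_of_ode hJ hαB hα
  refine ⟨hJ, hJ', hγ, fun t ht => ?_, fun t ht j hj => ?_⟩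
  · have hs := B.map_target (hαB t ht)
    rw [hB.isOrthogonal_iff g hs]
    have h1 := hasDerivAt_comp_curve (hB.contMDiffAt hs) (hγt t ht)
    have h2 : HasDerivAt (fun s => B (B.symm (α s).1)) (boxField g (h i) B (α t)).1 t := by
      refine ((hα t ht).fst_comp).congr_of_eventuallyEq ?_
      filter_upwards [hJ.mem_nhds ht] with s hs using B.right_inv (hαB s hs)
    rw [h1.unique h2, B.right_inv (hαB t ht)]
    rfl
  · have hs := hB.subset (B.map_target (hαB t ht))
    refine geo_of_geo H (hγt t ht) hj hs ?_
    have h1 : deriv (fun s => c.π i (B.symm (α s).1)) =ᶠ[𝓝 t] fun s => (α s).2 := by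
      filter_upwards [hJ.mem_nhds ht] with s hs using congrArg Prod.snd (hst s hs)
    rw [h1.deriv_eq, h1.eq_of_nhds, ((hα t ht).snd_comp).deriv, ← hB.fst_eq _ (B.map_target (hαB t ht)),
      B.right_inv (hαB t ht)]
    rfl

/-- A horizontal geodesic is determined by its position and projected velocity at one point. -/
theorem IsHG.eqOn [T2Space M] (H : c.Induces g h) (hγ : c.IsHG g h γ J) (hγ' : c.IsHG g h γ' J)
    (ht : t ∈ J) (h0 : γ t = γ' t) (h1 : c.ShareJet γ γ' t) : EqOn γ γ' J := by
  have key : ∀ s ∈ J, γ s = γ' s ∧ c.ShareJet γ γ' s := by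
    refine hγ.ordConnected.isPreconnected.forall_of_eventually_iff (fun s hs => ?_) ht ⟨h0, h1⟩
    rw [hγ.isOpen.nhdsWithin_eq hs]
    by_cases e : γ s = γ' s
    · obtain ⟨i, hi⟩ := c.exists_mem_U (γ s)
      obtain ⟨B, hB, hsB⟩ := exists_isBox hi
      have hsB' : γ' s ∈ B.source := e ▸ hsB
      have hev : ∀ᶠ r in 𝓝 s, r ∈ J ∧ γ r ∈ B.source ∧ γ' r ∈ B.source := by
        filter_upwards [hγ.isOpen.mem_nhds hs,
          (hγ.continuousAt hs).preimage_mem_nhds (B.open_source.mem_nhds hsB),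
          (hγ'.continuousAt hs).preimage_mem_nhds (B.open_source.mem_nhds hsB')]
          with r h1 h2 h3 using ⟨h1, h2, h3⟩
      -- Inside the box the propagated condition is equality of states, to which uniqueness for the
      -- differential equation applies.
      have hiff : ∀ r, r ∈ J ∧ γ r ∈ B.source ∧ γ' r ∈ B.source →
          ((γ r = γ' r ∧ c.ShareJet γ γ' r) ↔ c.boxState i B γ r = c.boxState i B γ' r) := by
        rintro r ⟨hr, hr1, hr2⟩
        constructor
        · rintro ⟨e1, e2⟩
          simp only [boxState, Prod.mk.injEq]
          exact ⟨by rw [e1], (e2.eq (hγ.contMDiffAt hr) (hγ'.contMDiffAt hr) (hB.subset hr1)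
            (hB.subset hr2)).2⟩
        · intro e1
          simp only [boxState, Prod.mk.injEq] at e1
          have e2 := B.injOn hr1 hr2 e1.1
          exact ⟨e2, i, hB.subset hr1, hB.subset hr2, by rw [e2], e1.2⟩
      have hself := hiff s ⟨hs, hsB, hsB'⟩
      obtain ⟨δ, hδ, hball⟩ := Metric.eventually_nhds_iff_ball.1 hev
      by_cases hst : c.boxState i B γ s = c.boxState i B γ' s
      · have := ode_eqOn (f := boxField g (h i) B) (U := B.target ×ˢ univ)
          (fun x hx => (hB.contDiffAt_boxField H hx.1).of_le (by simp)) Metric.isOpen_ball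
          (convex_ball s δ).isPreconnected
          (fun r hr => hγ.hasDerivAt_boxState (hball r hr).1 hB (hball r hr).2.1)
          (fun r hr => ⟨B.map_source (hball r hr).2.1, trivial⟩)
          (fun r hr => hγ'.hasDerivAt_boxState (hball r hr).1 hB (hball r hr).2.2)
          (Metric.mem_ball_self hδ) hst
        filter_upwards [Metric.ball_mem_nhds s hδ] with r hr
        rw [hself, hiff r (hball r hr)]
        simp [hst, this hr]
      · have hne := ((hγ.continuousAt_boxState hs hB hsB).ne_iff_eventually_ne
          (hγ'.continuousAt_boxState hs hB hsB')).1 hst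
        filter_upwards [hne, hev] with r hr hr'
        rw [hself, hiff r hr']
        simp [hst, hr]
    · have hne := ((hγ.continuousAt hs).ne_iff_eventually_ne (hγ'.continuousAt hs)).1 e
      filter_upwards [hne] with r hr
      simp [e, hr]
  exact fun s hs => (key s hs).1

end HaefligerCocycle

/-! ### Horizontal geodesics as geodesics of the ambient metric -/

namespace HaefligerCocycle

variable {q : ℕ} {M : Type u} [TopologicalSpace M]
  [ChartedSpace (Euc (q + 1)) M] [IsManifold (𝓡 (q + 1)) ∞ M]
  {c : HaefligerCocycle.{w} (q + 1) q M} {g : SmoothMetric (q + 1) M}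
  {h : c.ι → Euc q → Euc q →L[ℝ] Euc q →L[ℝ] ℝ} {γ γ' : ℝ → M} {J : Set ℝ} {i j : c.ι}
  {B : OpenPartialHomeomorph M (Euc q × ℝ)} {t : ℝ}

theorem fderiv_π_comp {ψ : Euc (q + 1) → M} {y : Euc (q + 1)}
    (hψ : ContMDiffAt (𝓡 (q + 1)) (𝓡 (q + 1)) ∞ ψ y) (hi : ψ y ∈ c.U i) (v : Euc (q + 1)) :
    fderiv ℝ (fun z => c.π i (ψ z)) y v = (mfderiv (𝓡 (q + 1)) (𝓡 q) (c.π i) (ψ y)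
      (mfderiv (𝓡 (q + 1)) (𝓡 (q + 1)) ψ y v) : Euc q) := by
  have h1 := (mdifferentiableAt_π hi).hasMFDerivAt.comp y
    (hψ.mdifferentiableAt (by simp)).hasMFDerivAt
  let L : Euc (q + 1) →L[ℝ] Euc q := (mfderiv (𝓡 (q + 1)) (𝓡 q) (c.π i) (ψ y)).comp
    (mfderiv (𝓡 (q + 1)) (𝓡 (q + 1)) ψ y)
  have h2 : HasFDerivAt (fun z => c.π i (ψ z)) L y := hasMFDerivAt_iff_hasFDerivAt.1 h1
  rw [h2.fderiv]
  rfl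

/-- Horizontal geodesics are geodesics. -/
theorem IsHG.isGeodesicOn (H : c.Induces g h) (hγ : c.IsHG g h γ J) (hne : J.Nonempty) :
    g.IsGeodesicOn γ J := by
  refine ⟨hγ.isOpen, hγ.ordConnected, hne, hγ.contMDiffOn, fun x₀ t ht hx₀ w => ?_⟩
  obtain ⟨i, hi⟩ := c.exists_mem_U (γ t)
  let φ := extChartAt (𝓡 (q + 1)) x₀
  have hφo : IsOpen φ.source := isOpen_extChartAt_source x₀
  have hφt : IsOpen φ.target := isOpen_extChartAt_target x₀
  have hφc : ∀ x ∈ φ.source, ContMDiffAt (𝓡 (q + 1)) 𝓘(ℝ, Euc (q + 1)) ∞ φ x := fun x hx =>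
    contMDiffAt_extChartAt' (by rwa [← extChartAt_source (𝓡 (q + 1))])
  have hψ : ∀ y ∈ φ.target, ContMDiffAt (𝓡 (q + 1)) (𝓡 (q + 1)) ∞ φ.symm y := fun y hy =>
    (contMDiffOn_extChartAt_symm x₀).contMDiffAt (hφt.mem_nhds hy)
  set y₀ := φ (γ t) with hy₀
  have hy₀t : y₀ ∈ φ.target := φ.map_source hx₀
  have hleft : φ.symm y₀ = γ t := φ.left_inv hx₀
  have hev : ∀ᶠ s in 𝓝 t, s ∈ J ∧ γ s ∈ φ.source ∧ γ s ∈ c.U i := by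
    filter_upwards [hγ.isOpen.mem_nhds ht,
      (hγ.continuousAt ht).preimage_mem_nhds (hφo.mem_nhds hx₀),
      (hγ.continuousAt ht).preimage_mem_nhds ((c.isOpen_U i).mem_nhds hi)]
      with s h1 h2 h3 using ⟨h1, h2, h3⟩
  have hevy : ∀ᶠ y in 𝓝 y₀, y ∈ φ.target ∧ φ.symm y ∈ c.U i := by
    filter_upwards [hφt.mem_nhds hy₀t, (hψ y₀ hy₀t).continuousAt.preimage_mem_nhds
      ((c.isOpen_U i).mem_nhds (by rwa [hleft]))] with y h1 h2 using ⟨h1, h2⟩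
  have hus : ∀ s, s ∈ J ∧ γ s ∈ φ.source ∧ γ s ∈ c.U i → ContDiffAt ℝ ∞ (fun s => φ (γ s)) s :=
    fun s hs => contDiffAt_comp_curve (hφc _ hs.2.1) (hγ.contMDiffAt hs.1)
  have hu := hus t ⟨ht, hx₀, hi⟩
  have hfu : (fun s => c.π i (φ.symm (φ (γ s)))) =ᶠ[𝓝 t] fun s => c.π i (γ s) := by
    filter_upwards [hev] with s hs
    rw [φ.left_inv hs.2.1]
  rw [geoForm_inChart g x₀ hy₀t]
  -- The comparison map is the submersion read in the chart. The inequality holds because a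
  -- Riemannian submersion shortens vectors, and the identity along the curve holds because the
  -- velocity is orthogonal to the leaves.
  have key := geoForm_eq_of_pullback (G := pullMetric g φ.symm) (h := h i)
    (f := fun y => c.π i (φ.symm y)) (u := fun s => φ (γ s)) (t := t)
    (((contDiffOn_pullMetric g hφt (contMDiffOn_extChartAt_symm x₀)).contDiffAt
      (hφt.mem_nhds hy₀t)).differentiableAt (by simp))
    (by rw [← hy₀, hleft]; exact (H.contDiffAt hi).differentiableAt (by simp))
    (contDiffAt_infty.1 (contMDiffAt_iff_contDiffAt.1
      ((contMDiffAt_π (by rw [hleft]; exact hi)).comp _ (hψ y₀ hy₀t))) 2)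
    (by rw [← hy₀, hleft]
        exact H.isTransverseMetric.symm i _ (mem_image_of_mem _ hi))
    (hev.mono fun s hs => (hus s hs).differentiableAt (by simp))
    (hu.deriv_infty.differentiableAt (by simp))
    (hevy.mono fun y hy v => by
      rw [fderiv_π_comp (hψ y hy.1) hy.2]
      exact H.le_inner hy.2 _)
    (hev.mono fun s hs w => by
      have hys : φ (γ s) ∈ φ.target := φ.map_source hs.2.1
      have hls : φ.symm (φ (γ s)) = γ s := φ.left_inv hs.2.1
      have hUs : φ.symm (φ (γ s)) ∈ c.U i := by rw [hls]; exact hs.2.2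
      have hvel : (mfderiv (𝓡 (q + 1)) (𝓡 (q + 1)) φ.symm (φ (γ s))
          (deriv (fun s => φ (γ s)) s) : Euc (q + 1)) =
          (mfderiv 𝓘(ℝ, ℝ) (𝓡 (q + 1)) γ s (1 : ℝ) : Euc (q + 1)) := by
        have h1 : HasMFDerivAt 𝓘(ℝ, ℝ) 𝓘(ℝ, Euc (q + 1)) (fun s => φ (γ s)) s
            (ContinuousLinearMap.toSpanSingleton ℝ (deriv (fun s => φ (γ s)) s)) :=
          ((hus s hs).differentiableAt (by simp)).hasDerivAt.hasFDerivAt.hasMFDerivAt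
        have h2 := ((hψ _ hys).mdifferentiableAt (by simp)).hasMFDerivAt.comp s h1
        have h3 : (φ.symm ∘ fun s => φ (γ s)) =ᶠ[𝓝 s] γ := by
          filter_upwards [(hγ.continuousAt hs.1).preimage_mem_nhds (hφo.mem_nhds hs.2.1)]
            with r hr using φ.left_inv hr
        have h4 := (h2.congr_of_eventuallyEq h3.symm).mfderiv
        have h5 := congrArg (fun L : ℝ →L[ℝ] Euc (q + 1) => L 1) h4
        refine Eq.trans ?_ h5.symm
        change _ = (mfderiv (𝓡 (q + 1)) (𝓡 (q + 1)) φ.symm (φ (γ s)) : Euc (q + 1) →L[ℝ] Euc (q + 1))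
          ((1 : ℝ) • deriv (fun s => φ (γ s)) s)
        rw [one_smul]
        rfl
      have horth : c.IsOrthogonal g (φ.symm (φ (γ s)))
          (mfderiv (𝓡 (q + 1)) (𝓡 (q + 1)) φ.symm (φ (γ s)) (deriv (fun s => φ (γ s)) s)) := by
        have : ∀ p (X : Euc (q + 1)), p = γ s → X = (mfderiv 𝓘(ℝ, ℝ) (𝓡 (q + 1)) γ s (1 : ℝ)) →
            c.IsOrthogonal g p X := by
          rintro _ _ rfl rfl
          exact hγ.orth s hs.1
        exact this _ _ hls hvel
      rw [fderiv_π_comp (hψ _ hys) hUs, fderiv_π_comp (hψ _ hys) hUs]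
      exact H.inner_eq_of_isOrthogonal hUs horth _) w
  rw [key, hfu.deriv_eq, hfu.deriv.deriv_eq, ← hy₀, hleft]
  exact (geoForm_eq_zero_iff (H.pos hi)).2 (hγ.geo t ht i hi) _

end HaefligerCocycle

/-! ### Extension and existence of horizontal geodesics -/

namespace HaefligerCocycle

variable {q : ℕ} {M : Type u} [TopologicalSpace M]
  [ChartedSpace (Euc (q + 1)) M] [IsManifold (𝓡 (q + 1)) ∞ M]
  {c : HaefligerCocycle.{w} (q + 1) q M} {g : SmoothMetric (q + 1) M}
  {h : c.ι → Euc q → Euc q →L[ℝ] Euc q →L[ℝ] ℝ} {γ γ' : ℝ → M} {J J' : Set ℝ} {i j : c.ι}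
  {B : OpenPartialHomeomorph M (Euc q × ℝ)} {t : ℝ}

theorem IsHG.of_eventuallyEq (hJ : IsOpen J) (hJ' : J.OrdConnected)
    (H : ∀ t ∈ J, ∃ γ' J', c.IsHG g h γ' J' ∧ t ∈ J' ∧ γ =ᶠ[𝓝 t] γ') : c.IsHG g h γ J := by
  refine ⟨hJ, hJ', fun t ht => ?_, fun t ht => ?_, fun t ht i hi => ?_⟩
  · obtain ⟨γ', J', h1, h2, h3⟩ := H t ht
    exact ((h1.contMDiffAt h2).congr_of_eventuallyEq h3).contMDiffWithinAt
  · obtain ⟨γ', J', h1, h2, h3⟩ := H t ht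
    rw [h3.mfderiv_eq]
    have := h1.orth t h2
    have h4 : ∀ p (X : Euc (q + 1)), p = γ' t → c.IsOrthogonal g (γ' t) X →
        c.IsOrthogonal g p X := by
      rintro _ X rfl hX
      exact hX
    exact h4 _ _ h3.eq_of_nhds this
  · obtain ⟨γ', J', h1, h2, h3⟩ := H t ht
    have h4 : (fun s => c.π i (γ s)) =ᶠ[𝓝 t] fun s => c.π i (γ' s) := by
      filter_upwards [h3] with s hs
      rw [hs]
    rw [h4.deriv.deriv_eq, h4.deriv_eq, h3.eq_of_nhds]
    exact h1.geo t h2 i (by rwa [← h3.eq_of_nhds])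

theorem IsHG.mono (hγ : c.IsHG g h γ J) (hJ : IsOpen J') (hJ' : J'.OrdConnected) (hs : J' ⊆ J) :
    c.IsHG g h γ J' :=
  IsHG.of_eventuallyEq hJ hJ' fun _ ht => ⟨γ, J, hγ, hs ht, Filter.EventuallyEq.rfl⟩

theorem ShareJet.of_eventuallyEq (h : γ =ᶠ[𝓝 t] γ') : c.ShareJet γ γ' t := by
  obtain ⟨i, hi⟩ := c.exists_mem_U (γ t)
  have h4 : (fun s => c.π i (γ s)) =ᶠ[𝓝 t] fun s => c.π i (γ' s) := by
    filter_upwards [h] with s hs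
    rw [hs]
  exact ⟨i, hi, by rwa [← h.eq_of_nhds], h4.eq_of_nhds, h4.deriv_eq⟩

theorem boxState_eq_of_eventuallyEq (h : γ =ᶠ[𝓝 t] γ') :
    c.boxState i B γ t = c.boxState i B γ' t := by
  have h4 : (fun s => c.π i (γ s)) =ᶠ[𝓝 t] fun s => c.π i (γ' s) := by
    filter_upwards [h] with s hs
    rw [hs]
  simp only [boxState, h.eq_of_nhds, h4.deriv_eq]

theorem IsHG.eqOn_of_boxState [T2Space M] (H : c.Induces g h) (hB : c.IsBox i B)
    (hγ : c.IsHG g h γ J) (hγ' : c.IsHG g h γ' J)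
    (ht : t ∈ J) (h1 : γ t ∈ B.source) (h2 : γ' t ∈ B.source)
    (h3 : c.boxState i B γ t = c.boxState i B γ' t) : EqOn γ γ' J := by
  simp only [boxState, Prod.mk.injEq] at h3
  have h4 := B.injOn h1 h2 h3.1
  exact hγ.eqOn H hγ' ht h4 ⟨i, hB.subset h1, hB.subset h2, by rw [h4], h3.2⟩

/-- The local flow of horizontal geodesics. -/
theorem IsBox.exists_flow [T2Space M] (hB : c.IsBox i B) (H : c.Induces g h)
    {p₀ : (Euc q × ℝ) × Euc q} (hp₀ : p₀.1 ∈ B.target) {U : Set ((Euc q × ℝ) × Euc q)}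
    (hU : U ∈ 𝓝 p₀) : ∃ r > (0 : ℝ), ∃ ε > (0 : ℝ), ∃ α : ((Euc q × ℝ) × Euc q) × ℝ →
      (Euc q × ℝ) × Euc q, ContinuousOn α (Metric.ball p₀ r ×ˢ Ioo (-ε) ε) ∧
      (∀ p ∈ Metric.ball p₀ r, α (p, 0) = p ∧ ∀ t ∈ Ioo (-ε) ε, α (p, t) ∈ U ∧
        (α (p, t)).1 ∈ B.target ∧
        HasDerivAt (fun s => α (p, s)) (boxField g (h i) B (α (p, t))) t) ∧
      (∀ p ∈ Metric.ball p₀ r, ∀ t₀,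
        c.IsHG g h (fun t => B.symm (α (p, t - t₀)).1) (Ioo (t₀ - ε) (t₀ + ε)) ∧
        ∀ t ∈ Ioo (t₀ - ε) (t₀ + ε),
          c.boxState i B (fun t => B.symm (α (p, t - t₀)).1) t = α (p, t - t₀)) ∧
      ∀ γ J t₀, c.IsHG g h γ J → t₀ ∈ J → γ t₀ ∈ B.source →
        c.boxState i B γ t₀ ∈ Metric.ball p₀ r → ∀ t ∈ J ∩ Ioo (t₀ - ε) (t₀ + ε),
          γ t ∈ B.source ∧ c.boxState i B γ t = α (c.boxState i B γ t₀, t - t₀) := by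
  have hU' : U ∩ B.target ×ˢ univ ∈ 𝓝 p₀ :=
    Filter.inter_mem hU ((B.open_target.prod isOpen_univ).mem_nhds ⟨hp₀, trivial⟩)
  obtain ⟨r, hr, ε, hε, α, hα, hc⟩ := exists_local_flow
    ((hB.contDiffAt_boxField H hp₀).of_le (by simp)) hU'
  have hshift : ∀ {t₀ t : ℝ}, t ∈ Ioo (t₀ - ε) (t₀ + ε) → t - t₀ ∈ Ioo (-ε) ε := by
    intro t₀ t ht
    constructor <;> linarith [ht.1, ht.2]
  have hode : ∀ p ∈ Metric.ball p₀ r, ∀ t₀, ∀ t ∈ Ioo (t₀ - ε) (t₀ + ε),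
      HasDerivAt (fun t => α (p, t - t₀)) (boxField g (h i) B (α (p, t - t₀))) t :=
    fun p hp t₀ t ht => HasDerivAt.comp_sub_const t t₀ ((hα p hp).2 _ (hshift ht)).1
  have hHG : ∀ p ∈ Metric.ball p₀ r, ∀ t₀,
        c.IsHG g h (fun t => B.symm (α (p, t - t₀)).1) (Ioo (t₀ - ε) (t₀ + ε)) ∧
        ∀ t ∈ Ioo (t₀ - ε) (t₀ + ε),
          c.boxState i B (fun t => B.symm (α (p, t - t₀)).1) t = α (p, t - t₀) := fun p hp t₀ =>
    ⟨hB.isHG_of_ode (α := fun t => α (p, t - t₀)) H isOpen_Ioo ordConnected_Ioo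
      (fun t ht => ((hα p hp).2 _ (hshift ht)).2.2.1) (hode p hp t₀),
      hB.boxState_of_ode (α := fun t => α (p, t - t₀)) isOpen_Ioo
      (fun t ht => ((hα p hp).2 _ (hshift ht)).2.2.1) (hode p hp t₀)⟩
  refine ⟨r, hr, ε, hε, α, hc, fun p hp => ⟨(hα p hp).1, fun t ht => ?_⟩, hHG, ?_⟩
  · have := (hα p hp).2 t ht
    exact ⟨this.2.1, this.2.2.1, this.1⟩
  · intro γ J t₀ hγ ht₀ h1 h2 t ht
    obtain ⟨h3, h4⟩ := hHG _ h2 t₀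
    have ht₀' : t₀ ∈ Ioo (t₀ - ε) (t₀ + ε) := ⟨by linarith, by linarith⟩
    have hJo : IsOpen (J ∩ Ioo (t₀ - ε) (t₀ + ε)) := hγ.isOpen.inter isOpen_Ioo
    have hJc := hγ.ordConnected.inter (ordConnected_Ioo (a := t₀ - ε) (b := t₀ + ε))
    have h5 : c.boxState i B (fun t => B.symm (α (c.boxState i B γ t₀, t - t₀)).1) t₀ =
        c.boxState i B γ t₀ := by
      rw [h4 t₀ ht₀', sub_self, (hα _ h2).1]
    have h6 : ∀ t ∈ Ioo (t₀ - ε) (t₀ + ε),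
        B.symm (α (c.boxState i B γ t₀, t - t₀)).1 ∈ B.source := fun t ht =>
      B.map_target ((hα _ h2).2 _ (hshift ht)).2.2.1
    have h7 := (hγ.mono hJo hJc inter_subset_left).eqOn_of_boxState H hB
      (h3.mono hJo hJc inter_subset_right) ⟨ht₀, ht₀'⟩ h1 (h6 t₀ ht₀') h5.symm
    refine ⟨by rw [h7 ht]; exact h6 t ht.2, ?_⟩
    rw [boxState_eq_of_eventuallyEq (h7.eventuallyEq_of_mem (hJo.mem_nhds ht)), h4 t ht.2]

/-- All horizontal geodesics with the given germ at `t` are glued; they agree on overlaps by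
uniqueness. Maximality is obtained among horizontal geodesics only. -/
theorem exists_isHG_maximal [T2Space M] (H : c.Induces g h) (hγ : c.IsHG g h γ J) (ht : t ∈ J) :
    ∃ γ' J', c.IsHG g h γ' J' ∧ J ⊆ J' ∧ EqOn γ γ' J ∧
      ∀ γ'' J'', c.IsHG g h γ'' J'' → t ∈ J'' → γ'' =ᶠ[𝓝 t] γ → J'' ⊆ J' := by
  classical
  let S : Set ((ℝ → M) × Set ℝ) := {p | c.IsHG g h p.1 p.2 ∧ t ∈ p.2 ∧ p.1 =ᶠ[𝓝 t] γ}
  have hagree : ∀ p ∈ S, ∀ p' ∈ S, EqOn p.1 p'.1 (p.2 ∩ p'.2) := by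
    rintro p ⟨h1, h2, h3⟩ p' ⟨h1', h2', h3'⟩
    have ho := h1.isOpen.inter h1'.isOpen
    have hoc := h1.ordConnected.inter h1'.ordConnected
    have he := h3.trans h3'.symm
    exact (h1.mono ho hoc inter_subset_left).eqOn H (h1'.mono ho hoc inter_subset_right)
      ⟨h2, h2'⟩ he.eq_of_nhds (ShareJet.of_eventuallyEq he)
  let J' : Set ℝ := ⋃ p ∈ S, p.2
  have hch : ∀ s : ℝ, ∃ p ∈ S, s ∈ J' → s ∈ p.2 := by
    intro s
    by_cases hs : s ∈ J'
    · obtain ⟨p, hp, hsp⟩ := mem_iUnion₂.1 hs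
      exact ⟨p, hp, fun _ => hsp⟩
    · exact ⟨(γ, J), ⟨hγ, ht, Filter.EventuallyEq.rfl⟩, fun h => absurd h hs⟩
  choose P hP hPJ using hch
  let γ' : ℝ → M := fun s => (P s).1 s
  have heq : ∀ p ∈ S, EqOn γ' p.1 p.2 := fun p hp s hs =>
    hagree _ (hP s) _ hp ⟨hPJ s (mem_biUnion hp hs), hs⟩
  have hJ'o : IsOpen J' := isOpen_biUnion fun p hp => hp.1.isOpen
  have hJ'c : J'.OrdConnected := by
    rw [← isPreconnected_iff_ordConnected]
    have : J' = ⋃₀ (Prod.snd '' S) := by rw [sUnion_image]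
    rw [this]
    refine isPreconnected_sUnion t _ ?_ ?_
    · rintro _ ⟨p, hp, rfl⟩
      exact hp.2.1
    · rintro _ ⟨p, hp, rfl⟩
      exact hp.1.ordConnected.isPreconnected
  have hmem : (γ, J) ∈ S := ⟨hγ, ht, Filter.EventuallyEq.rfl⟩
  refine ⟨γ', J', IsHG.of_eventuallyEq hJ'o hJ'c fun s hs => ?_, fun s hs => mem_biUnion hmem hs,
    (heq _ hmem).symm, fun γ'' J'' h1 h2 h3 s hs => ?_⟩
  · obtain ⟨p, hp, hsp⟩ := mem_iUnion₂.1 hs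
    exact ⟨p.1, p.2, hp.1, hsp, (heq p hp).eventuallyEq_of_mem (hp.1.isOpen.mem_nhds hsp)⟩
  · have : (γ'', J'') ∈ S := ⟨h1, h2, h3⟩
    exact mem_biUnion this hs

theorem IsHG.union (hγ : c.IsHG g h γ J) (hγ' : c.IsHG g h γ' J')
    (he : EqOn γ γ' (J ∩ J')) (hne : (J ∩ J').Nonempty) :
    ∃ γ'', c.IsHG g h γ'' (J ∪ J') ∧ EqOn γ'' γ J ∧ EqOn γ'' γ' J' := by
  classical
  have h1 : EqOn (J.piecewise γ γ') γ J := piecewise_eqOn J γ γ'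
  have h2 : EqOn (J.piecewise γ γ') γ' J' := by
    intro s hs
    by_cases hsJ : s ∈ J
    · rw [h1 hsJ, he ⟨hsJ, hs⟩]
    · exact piecewise_eqOn_compl J γ γ' hsJ
  refine ⟨J.piecewise γ γ', IsHG.of_eventuallyEq (hγ.isOpen.union hγ'.isOpen) ?_ ?_, h1, h2⟩
  · obtain ⟨s, hs, hs'⟩ := hne
    exact (hγ.ordConnected.isPreconnected.union s hs hs'
      hγ'.ordConnected.isPreconnected).ordConnected
  · rintro s (hs | hs)
    · exact ⟨γ, J, hγ, hs, h1.eventuallyEq_of_mem (hγ.isOpen.mem_nhds hs)⟩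
    · exact ⟨γ', J', hγ', hs, h2.eventuallyEq_of_mem (hγ'.isOpen.mem_nhds hs)⟩

/-- Horizontal geodesics extend to all of `ℝ`. -/
theorem IsHG.exists_extension [T2Space M] (H : c.Induces g h)
    (hcomp : c.IsTransversallyCompleteMetric g) (hγ : c.IsHG g h γ J) (hne : J.Nonempty) :
    ∃ γ', c.IsHG g h γ' univ ∧ EqOn γ γ' J := by
  obtain ⟨t₀, ht₀⟩ := hne
  obtain ⟨γ₁, J₁, h1, hJ₁, he₁, hmax⟩ := exists_isHG_maximal H hγ ht₀
  have ht₁ := hJ₁ ht₀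
  have he₁' : γ₁ =ᶠ[𝓝 t₀] γ := (he₁.symm).eventuallyEq_of_mem (hγ.isOpen.mem_nhds ht₀)
  suffices hJ : J₁ = univ by
    subst hJ
    exact ⟨γ₁, h1, he₁⟩
  -- Completeness speaks of maximal geodesics, so the maximal horizontal geodesic must be shown to
  -- have no extension `γ₂` even among all geodesics.
  refine hcomp γ₁ J₁ ⟨h1.isGeodesicOn H ⟨t₀, ht₁⟩, fun γ₂ J₂ hsub h2 he₂ => ?_⟩ h1.orth
  refine Subset.antisymm (fun s hs => ?_) hsub
  refine h2.ordConnected.isPreconnected.forall_of_eventually_iff (P := fun s => s ∈ J₁)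
    (fun s hs => ?_) (hsub ht₁) ht₁ s hs
  rw [h2.isOpen.nhdsWithin_eq hs]
  by_cases hsJ : s ∈ J₁
  · filter_upwards [h1.isOpen.mem_nhds hsJ] with r hr using ⟨fun _ => hr, fun _ => hsJ⟩
  · by_contra hcon
    -- Here `s` is a boundary point of `J₁` inside `J₂`. As `γ₂` is smooth at `s`, the states of
    -- `γ₁` near `s` lie in the domain of a local flow with uniform lifetime `ε`, which carries `γ₁`
    -- past `s`.
    have hfreq : ∃ᶠ r in 𝓝 s, r ∈ J₁ := by
      intro hf
      refine hcon ?_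
      filter_upwards [hf] with r hr using ⟨fun h => absurd h hsJ, fun h => absurd h hr⟩
    obtain ⟨i, hi⟩ := c.exists_mem_U (γ₂ s)
    obtain ⟨B, hB, hsB⟩ := exists_isBox hi
    have hsm : ContMDiffAt 𝓘(ℝ, ℝ) (𝓡 (q + 1)) ∞ γ₂ s :=
      h2.contMDiffOn.contMDiffAt (h2.isOpen.mem_nhds hs)
    obtain ⟨r, hr, ε, hε, α, -, hα, hαHG, -⟩ := hB.exists_flow (g := g) (h := h) H
      (p₀ := c.boxState i B γ₂ s) (B.map_source hsB) Filter.univ_mem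
    have hcont : ContinuousAt (c.boxState i B γ₂) s :=
      ((B.continuousAt hsB).comp hsm.continuousAt).prodMk
        (contDiffAt_comp_curve (contMDiffAt_π (hB.subset hsB)) hsm).deriv_infty.continuousAt
    have hev₁ : ∀ᶠ r₁ in 𝓝 s, c.boxState i B γ₂ r₁ ∈ Metric.ball (c.boxState i B γ₂ s) r :=
      hcont.preimage_mem_nhds (Metric.ball_mem_nhds _ hr)
    have hev₂ : ∀ᶠ r₁ in 𝓝 s, γ₂ r₁ ∈ B.source :=
      hsm.continuousAt.preimage_mem_nhds (B.open_source.mem_nhds hsB)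
    have hev₃ : ∀ᶠ r₁ in 𝓝 s, r₁ ∈ Metric.ball s ε := Metric.ball_mem_nhds s hε
    obtain ⟨r₁, hr₁, hr₂, hr₃, hr₄⟩ := (hfreq.and_eventually (hev₁.and (hev₂.and hev₃))).exists
    have hev : γ₁ =ᶠ[𝓝 r₁] γ₂ := he₂.eventuallyEq_of_mem (h1.isOpen.mem_nhds hr₁)
    obtain ⟨h3, h4⟩ := hαHG _ hr₂ r₁
    have hmem : r₁ ∈ Ioo (r₁ - ε) (r₁ + ε) := ⟨by linarith, by linarith⟩
    have ho := h1.isOpen.inter (isOpen_Ioo (a := r₁ - ε) (b := r₁ + ε))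
    have hoc := h1.ordConnected.inter (ordConnected_Ioo (a := r₁ - ε) (b := r₁ + ε))
    have h5 := (h1.mono ho hoc inter_subset_left).eqOn_of_boxState H hB
      (h3.mono ho hoc inter_subset_right) ⟨hr₁, hmem⟩ (by rw [hev.eq_of_nhds]; exact hr₃)
      (B.map_target (by rw [sub_self, (hα _ hr₂).1]; exact B.map_source hr₃))
      (by rw [h4 r₁ hmem, sub_self, (hα _ hr₂).1, boxState_eq_of_eventuallyEq hev])
    obtain ⟨γ₃, h6, h7, -⟩ := h1.union h3 h5 ⟨r₁, hr₁, hmem⟩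
    have h8 := hmax γ₃ _ h6 (Or.inl ht₁)
      ((h7.eventuallyEq_of_mem (h1.isOpen.mem_nhds ht₁)).trans he₁')
    refine hsJ (h8 (Or.inr ?_))
    rw [Real.ball_eq_Ioo] at hr₄
    constructor <;> linarith [hr₄.1, hr₄.2]

/-- There is a horizontal geodesic with any given position and projected velocity. -/
theorem exists_isHG [T2Space M] (H : c.Induces g h) (hcomp : c.IsTransversallyCompleteMetric g)
    {x : M} (hx : x ∈ c.U i) (ξ : Euc q) : ∃ γ, c.IsHG g h γ univ ∧ γ 0 = x ∧
      deriv (fun s => c.π i (γ s)) 0 = ξ := by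
  obtain ⟨B, hB, hxB⟩ := exists_isBox hx
  obtain ⟨r, hr, ε, hε, α, -, hα, hαHG, -⟩ := hB.exists_flow (g := g) (h := h) H
      (p₀ := (B x, ξ)) (B.map_source hxB) Filter.univ_mem
  obtain ⟨h1, h2⟩ := hαHG _ (Metric.mem_ball_self hr) 0
  have h0 : (0 : ℝ) ∈ Ioo (0 - ε) (0 + ε) := ⟨by linarith, by linarith⟩
  obtain ⟨γ, h3, h4⟩ := h1.exists_extension H hcomp ⟨0, h0⟩
  have h5 : γ 0 = x := by
    rw [← h4 h0]
    simp [(hα _ (Metric.mem_ball_self hr)).1, B.left_inv hxB]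
  refine ⟨γ, h3, h5, ?_⟩
  have h6 := h2 0 h0
  rw [boxState_eq_of_eventuallyEq (h4.eventuallyEq_of_mem (isOpen_Ioo.mem_nhds h0)), sub_self,
    (hα _ (Metric.mem_ball_self hr)).1] at h6
  exact congrArg Prod.snd h6

theorem IsOrthogonal.smul {x : M} {v : TangentSpace (𝓡 (q + 1)) x} (hv : c.IsOrthogonal g x v)
    (a : ℝ) : c.IsOrthogonal g x (a • v) := by
  intro w hw
  rw [map_smul, smul_apply, hv w hw, smul_zero]

/-- Both sides of the geodesic equation scale with `a ^ 2`. The case `a = -1` reverses geodesics,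
and small `a` makes them slow. -/
theorem IsHG.comp_affine (hγ : c.IsHG g h γ univ) (a b : ℝ) :
    c.IsHG g h (fun t => γ (a * t + b)) univ := by
  have haff : ContDiff ℝ ∞ (fun t : ℝ => a * t + b) := by fun_prop
  have hd : ∀ t, HasDerivAt (fun t : ℝ => a * t + b) a t := fun t => by
    simpa using ((hasDerivAt_id t).const_mul a).add_const b
  have hπ : ∀ i t, γ (a * t + b) ∈ c.U i → HasDerivAt (fun s => c.π i (γ (a * s + b)))
      (a • deriv (fun s => c.π i (γ s)) (a * t + b)) t := fun i t hi =>
    HasDerivAt.scomp (g₁ := fun s => c.π i (γ s)) (h := fun s => a * s + b) t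
      ((hγ.contDiffAt_π (mem_univ _) hi).differentiableAt (by simp)).hasDerivAt
      (hd t)
  refine ⟨isOpen_univ, ordConnected_univ, hγ.contMDiffOn.comp haff.contMDiff.contMDiffOn
    fun _ _ => trivial, fun t _ => ?_, fun t _ i hi => ?_⟩
  · have h1 := ((hγ.contMDiffAt (mem_univ (a * t + b))).mdifferentiableAt
      (by simp)).hasMFDerivAt.comp t (hd t).hasFDerivAt.hasMFDerivAt
    have h2 : (mfderiv 𝓘(ℝ, ℝ) (𝓡 (q + 1)) (fun t => γ (a * t + b)) t (1 : ℝ) : Euc (q + 1)) =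
        a • (mfderiv 𝓘(ℝ, ℝ) (𝓡 (q + 1)) γ (a * t + b) (1 : ℝ) : Euc (q + 1)) := by
      have h3 := congrArg (fun L : ℝ →L[ℝ] Euc (q + 1) => L 1) h1.mfderiv
      refine Eq.trans h3 ?_
      let L : ℝ →L[ℝ] Euc (q + 1) := mfderiv 𝓘(ℝ, ℝ) (𝓡 (q + 1)) γ (a * t + b)
      have h4 : L ((1 : ℝ) • a) = a • L 1 := by
        rw [← map_smul, smul_eq_mul, smul_eq_mul, mul_one, one_mul]
      exact h4
    have h4 := (hγ.orth (a * t + b) trivial).smul a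
    exact h2 ▸ h4
  · have h1 : deriv (fun s => c.π i (γ (a * s + b))) =ᶠ[𝓝 t]
        fun s => a • deriv (fun s => c.π i (γ s)) (a * s + b) := by
      have hc : ContinuousAt (fun s => γ (a * s + b)) t :=
        ContinuousAt.comp (f := fun s => a * s + b) (hγ.continuousAt (mem_univ (a * t + b)))
          haff.continuous.continuousAt
      filter_upwards [hc.preimage_mem_nhds ((c.isOpen_U i).mem_nhds hi)] with s hs
      exact (hπ i s hs).deriv
    have h2 : HasDerivAt (fun s => deriv (fun s => c.π i (γ s)) (a * s + b))
        (a • deriv (deriv fun s => c.π i (γ s)) (a * t + b)) t :=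
      HasDerivAt.scomp (g₁ := deriv fun s => c.π i (γ s)) (h := fun s => a * s + b) t
        ((hγ.contDiffAt_π (mem_univ _) hi).deriv_infty.differentiableAt
        (by simp)).hasDerivAt (hd t)
    have h3 : deriv (fun s => a • deriv (fun s => c.π i (γ s)) (a * s + b)) t =
      a • a • deriv (deriv fun s => c.π i (γ s)) (a * t + b) := (h2.const_smul a).deriv
    rw [h1.deriv_eq, h3, (hπ i t hi).deriv, geoVec_smul,
      hγ.geo _ trivial i hi, smul_smul, sq]

end HaefligerCocycle

/-! ### Dependence on the initial state -/

namespace HaefligerCocycle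

variable {q : ℕ} {M : Type u} [TopologicalSpace M]
  [ChartedSpace (Euc (q + 1)) M] [IsManifold (𝓡 (q + 1)) ∞ M]
  {c : HaefligerCocycle.{w} (q + 1) q M} {g : SmoothMetric (q + 1) M}
  {h : c.ι → Euc q → Euc q →L[ℝ] Euc q →L[ℝ] ℝ} {γ γ' : ℝ → M} {J J' : Set ℝ} {i j : c.ι}
  {B : OpenPartialHomeomorph M (Euc q × ℝ)} {t : ℝ}

/-- Convergence of the positions and of the projected velocities at `t`. -/
def StateTendsto (c : HaefligerCocycle.{w} (q + 1) q M) {S : Type*} (l : Filter S)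
    (Γ : S → ℝ → M) (γ : ℝ → M) (t : ℝ) : Prop :=
  Filter.Tendsto (fun s => Γ s t) l (𝓝 (γ t)) ∧ ∀ i, γ t ∈ c.U i →
    Filter.Tendsto (fun s => deriv (fun r => c.π i (Γ s r)) t) l
      (𝓝 (deriv (fun r => c.π i (γ r)) t))

variable {S : Type*} {l : Filter S} {Γ : S → ℝ → M}

/-- One submersion suffices, because projected velocities change by the derivative of the transition
map, which is continuous. -/
theorem StateTendsto.of_exists (hΓ : ∀ s, c.IsHG g h (Γ s) univ)
    (hγ : c.IsHG g h γ univ) (h1 : Filter.Tendsto (fun s => Γ s t) l (𝓝 (γ t)))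
    (hi : γ t ∈ c.U i) (h2 : Filter.Tendsto (fun s => deriv (fun r => c.π i (Γ s r)) t) l
      (𝓝 (deriv (fun r => c.π i (γ r)) t))) : c.StateTendsto l Γ γ t := by
  refine ⟨h1, fun j hj => ?_⟩
  have h3 : ∀ᶠ s in l, Γ s t ∈ c.U i ∩ c.U j :=
    h1.eventually (((c.isOpen_U i).inter (c.isOpen_U j)).mem_nhds ⟨hi, hj⟩)
  have h4 : Filter.Tendsto (fun s => fderiv ℝ (c.γ j i) (c.π i (Γ s t))) l
      (𝓝 (fderiv ℝ (c.γ j i) (c.π i (γ t)))) :=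
    (((contDiffAt_γ hj hi).fderiv_right (m := ∞) (by simp)).continuousAt.tendsto).comp
      ((contMDiffAt_π hi).continuousAt.tendsto.comp h1)
  rw [deriv_π_eq (hγ.contMDiffAt (mem_univ t)) hj hi]
  refine ((isBoundedBilinearMap_apply.continuous.tendsto _).comp (h4.prodMk_nhds h2)).congr' ?_
  filter_upwards [h3] with s hs
  exact (deriv_π_eq ((hΓ s).contMDiffAt (mem_univ t)) hs.2 hs.1).symm

theorem StateTendsto.boxState (H : c.StateTendsto l Γ γ t) (hB : c.IsBox i B)
    (hγB : γ t ∈ B.source) :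
    Filter.Tendsto (fun s => c.boxState i B (Γ s) t) l (𝓝 (c.boxState i B γ t)) :=
  (((B.continuousAt hγB).tendsto).comp H.1).prodMk_nhds (H.2 i (hB.subset hγB))

/-- Near a time `t`, the states of nearby horizontal geodesics at two times are related by a
continuous map which preserves the relation of sharing the projected 1-jet. -/
theorem IsHG.exists_local_transfer [T2Space M] (H : c.Induces g h) (hγ : c.IsHG g h γ univ)
    (t : ℝ) : ∃ i B, c.IsBox i B ∧ ∃ δ > (0 : ℝ), ∀ s₁ ∈ Metric.ball t δ, ∀ s₂ ∈ Metric.ball t δ,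
      γ s₁ ∈ B.source ∧ γ s₂ ∈ B.source ∧ ∃ (O : Set ((Euc q × ℝ) × Euc q))
        (f : (Euc q × ℝ) × Euc q → (Euc q × ℝ) × Euc q), IsOpen O ∧
        c.boxState i B γ s₁ ∈ O ∧ ContinuousOn f O ∧
        (∀ γ', c.IsHG g h γ' univ → γ' s₁ ∈ B.source → c.boxState i B γ' s₁ ∈ O →
          γ' s₂ ∈ B.source ∧ c.boxState i B γ' s₂ = f (c.boxState i B γ' s₁)) ∧
        ∀ p ∈ O, ∀ p' ∈ O, p.1.1 = p'.1.1 → p.2 = p'.2 →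
          (f p).1.1 = (f p').1.1 ∧ (f p).2 = (f p').2 := by
  obtain ⟨i, hi⟩ := c.exists_mem_U (γ t)
  obtain ⟨B, hB, htB⟩ := exists_isBox hi
  obtain ⟨r, hr, ε, hε, α, hαc, hα, -, hαu⟩ := hB.exists_flow (g := g) (h := h) H
      (p₀ := c.boxState i B γ t) (B.map_source htB) Filter.univ_mem
  have h1 : ∀ᶠ s in 𝓝 t, γ s ∈ B.source :=
    (hγ.continuousAt (mem_univ t)).preimage_mem_nhds (B.open_source.mem_nhds htB)
  have h2 : ∀ᶠ s in 𝓝 t, c.boxState i B γ s ∈ Metric.ball (c.boxState i B γ t) r :=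
    (hγ.continuousAt_boxState (mem_univ t) hB htB).preimage_mem_nhds (Metric.ball_mem_nhds _ hr)
  obtain ⟨δ₀, hδ₀, hball⟩ := Metric.eventually_nhds_iff_ball.1 (h1.and h2)
  refine ⟨i, B, hB, min δ₀ (ε / 2), by positivity, fun s₁ hs₁ s₂ hs₂ => ?_⟩
  have hs₁' := hball s₁ (Metric.ball_subset_ball (min_le_left _ _) hs₁)
  have hs₂' := hball s₂ (Metric.ball_subset_ball (min_le_left _ _) hs₂)
  have hd : |s₂ - s₁| < ε := by
    have h3 := (Metric.mem_ball.1 hs₁).trans_le (min_le_right _ _)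
    have h4 := (Metric.mem_ball.1 hs₂).trans_le (min_le_right _ _)
    have h5 := dist_triangle_right s₂ s₁ t
    rw [Real.dist_eq] at h5
    linarith
  have hd' : s₂ - s₁ ∈ Ioo (-ε) ε := abs_lt.1 hd
  refine ⟨hs₁'.1, hs₂'.1, Metric.ball (c.boxState i B γ t) r, fun p => α (p, s₂ - s₁),
    Metric.isOpen_ball, hs₁'.2, ?_, ?_, ?_⟩
  · exact hαc.comp (by fun_prop) fun p hp => ⟨hp, hd'⟩
  · intro γ' hγ' h3 h4
    exact hαu γ' univ s₁ hγ' trivial h3 h4 s₂ ⟨trivial, by constructor <;> linarith [hd'.1, hd'.2]⟩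
  · intro p hp p' hp' e1 e2
    -- The projected position and velocity satisfy a differential equation of their own, in which
    -- the leaf coordinate does not occur; hence equal projected initial states remain equal.
    let V : Set (Euc q × Euc q) := {a | ∃ y ∈ B.target, y.1 = a.1}
    let f : Euc q × Euc q → Euc q × Euc q := fun a => (a.2, geoVec (h i) a.1 a.2)
    have hf : ∀ a ∈ V, ContDiffAt ℝ 1 f a := by
      rintro ⟨a, ξ⟩ ⟨y, hy, rfl⟩
      have hm := B.map_target hy
      have e : y.1 = c.π i (B.symm y) := by rw [← hB.fst_eq _ hm, B.right_inv hy]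
      have h1 : ContDiffAt ℝ ∞ (fun p : Euc q × Euc q => geoVec (h i) p.1 p.2) (y.1, ξ) := by
        rw [e]
        exact contDiffAt_geoVec (H.pos (hB.subset hm)) (H.contDiffAt (hB.subset hm)) ξ
      exact (contDiffAt_snd.prodMk h1).of_le (by simp)
    have hsol : ∀ p ∈ Metric.ball (c.boxState i B γ t) r, ∀ s ∈ Ioo (-ε) ε,
        HasDerivAt (fun s => ((α (p, s)).1.1, (α (p, s)).2))
          (f ((α (p, s)).1.1, (α (p, s)).2)) s := fun p hp s hs =>
      let h0 := ((hα p hp).2 s hs).2.2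
      (h0.fst_comp.fst_comp).prodMk h0.snd_comp
    have := ode_eqOn hf isOpen_Ioo isPreconnected_Ioo (hsol p hp)
      (fun s hs => ⟨_, ((hα p hp).2 s hs).2.1, rfl⟩) (hsol p' hp')
      (t₀ := 0) ⟨by linarith, hε⟩ (by simp [(hα p hp).1, (hα p' hp').1, e1, e2]) hd'
    exact Prod.mk.inj this

/-- Horizontal geodesics depend continuously on the initial state. -/
theorem StateTendsto.of_zero [T2Space M] (H : c.Induces g h) (hΓ : ∀ s, c.IsHG g h (Γ s) univ)
    (hγ : c.IsHG g h γ univ) {t₀ : ℝ} (h0 : c.StateTendsto l Γ γ t₀) (t : ℝ) :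
    c.StateTendsto l Γ γ t := by
  refine isPreconnected_univ.forall_of_eventually_iff (P := fun t => c.StateTendsto l Γ γ t)
    (fun t _ => ?_) (mem_univ t₀) h0 t trivial
  rw [nhdsWithin_univ]
  obtain ⟨i, B, hB, δ, hδ, htr⟩ := hγ.exists_local_transfer H t
  have key : ∀ s₁ ∈ Metric.ball t δ, ∀ s₂ ∈ Metric.ball t δ, c.StateTendsto l Γ γ s₁ →
      c.StateTendsto l Γ γ s₂ := by
    intro s₁ hs₁ s₂ hs₂ h1
    obtain ⟨hm₁, hm₂, O, f, hO, hγO, hf, hfl, -⟩ := htr s₁ hs₁ s₂ hs₂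
    have h2 := h1.boxState hB hm₁
    have h3 : ∀ᶠ s in l, Γ s s₁ ∈ B.source := h1.1.eventually (B.open_source.mem_nhds hm₁)
    have h4 : ∀ᶠ s in l, c.boxState i B (Γ s) s₁ ∈ O := h2.eventually (hO.mem_nhds hγO)
    have h5 : Filter.Tendsto (fun s => c.boxState i B (Γ s) s₂) l
        (𝓝 (c.boxState i B γ s₂)) := by
      rw [(hfl γ hγ hm₁ hγO).2]
      refine ((hf.continuousAt (hO.mem_nhds hγO)).tendsto.comp h2).congr' ?_
      filter_upwards [h3, h4] with s hs hs' using ((hfl _ (hΓ s) hs hs').2).symm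
    have h6 : Filter.Tendsto (fun s => B (Γ s s₂)) l (𝓝 (B (γ s₂))) :=
      (continuous_fst.tendsto _).comp h5
    refine StateTendsto.of_exists hΓ hγ ?_ (hB.subset hm₂) ((continuous_snd.tendsto _).comp h5)
    have h7 := ((B.continuousAt_symm (B.map_source hm₂)).tendsto).comp h6
    rw [B.left_inv hm₂] at h7
    refine h7.congr' ?_
    filter_upwards [h3, h4] with s hs hs' using B.left_inv (hfl _ (hΓ s) hs hs').1
  filter_upwards [Metric.ball_mem_nhds t hδ] with s hs
  exact ⟨key t (Metric.mem_ball_self hδ) s hs, key s hs t (Metric.mem_ball_self hδ)⟩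

/-- A shared projected jet is carried along by the local transfer maps as long as both curves lie in
their domain. Convergence of the states guarantees this along `l`, whence the formulation with a
filter. -/
theorem StateTendsto.eventually_shareJet [T2Space M] (H : c.Induces g h)
    (hΓ : ∀ s, c.IsHG g h (Γ s) univ) (hγ : c.IsHG g h γ univ) {t₀ : ℝ}
    (h0 : c.StateTendsto l Γ γ t₀) (hs : ∀ᶠ s in l, c.ShareJet (Γ s) γ t₀) (t : ℝ) :
    ∀ᶠ s in l, c.ShareJet (Γ s) γ t := by
  refine isPreconnected_univ.forall_of_eventually_iff
    (P := fun t => ∀ᶠ s in l, c.ShareJet (Γ s) γ t) (fun t _ => ?_) (mem_univ t₀) hs t trivial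
  rw [nhdsWithin_univ]
  obtain ⟨i, B, hB, δ, hδ, htr⟩ := hγ.exists_local_transfer H t
  have key : ∀ s₁ ∈ Metric.ball t δ, ∀ s₂ ∈ Metric.ball t δ, (∀ᶠ s in l, c.ShareJet (Γ s) γ s₁) →
      ∀ᶠ s in l, c.ShareJet (Γ s) γ s₂ := by
    intro s₁ hs₁ s₂ hs₂ h1
    obtain ⟨hm₁, hm₂, O, f, hO, hγO, hf, hfl, hfe⟩ := htr s₁ hs₁ s₂ hs₂
    have h2 := StateTendsto.of_zero H hΓ hγ h0 s₁
    have h3 : ∀ᶠ s in l, Γ s s₁ ∈ B.source := h2.1.eventually (B.open_source.mem_nhds hm₁)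
    have h4 : ∀ᶠ s in l, c.boxState i B (Γ s) s₁ ∈ O :=
      (h2.boxState hB hm₁).eventually (hO.mem_nhds hγO)
    filter_upwards [h1, h3, h4] with s e1 e2 e3
    obtain ⟨e4, e5⟩ := e1.eq ((hΓ s).contMDiffAt (mem_univ _)) (hγ.contMDiffAt (mem_univ _))
      (hB.subset e2) (hB.subset hm₁)
    obtain ⟨e6, e7⟩ := hfl _ (hΓ s) e2 e3
    obtain ⟨e8, e9⟩ := hfl _ hγ hm₁ hγO
    have e10 : (B (Γ s s₁)).1 = (B (γ s₁)).1 := by rw [hB.fst_eq _ e2, hB.fst_eq _ hm₁, e4]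
    obtain ⟨e11, e12⟩ := hfe _ e3 _ hγO e10 e5
    rw [← e7, ← e9] at e11 e12
    refine ⟨i, hB.subset e6, hB.subset hm₂, ?_, e12⟩
    rw [← hB.fst_eq _ e6, ← hB.fst_eq _ hm₂]
    exact e11
  filter_upwards [Metric.ball_mem_nhds t hδ] with s hs
  exact ⟨key t (Metric.mem_ball_self hδ) s hs, key s hs t (Metric.mem_ball_self hδ)⟩

/-! ### Speed -/

/-- The squared speed of a curve. -/
def speedSq (g : SmoothMetric (q + 1) M) (γ : ℝ → M) (t : ℝ) : ℝ :=
  g.inner (γ t) (mfderiv 𝓘(ℝ, ℝ) (𝓡 (q + 1)) γ t (1 : ℝ))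
    (mfderiv 𝓘(ℝ, ℝ) (𝓡 (q + 1)) γ t (1 : ℝ))

theorem IsHG.speedSq_eq (H : c.Induces g h) (hγ : c.IsHG g h γ J) (ht : t ∈ J)
    (hi : γ t ∈ c.U i) : speedSq g γ t = h i (c.π i (γ t)) (deriv (fun s => c.π i (γ s)) t)
      (deriv (fun s => c.π i (γ s)) t) := by
  rw [deriv_π_comp (hγ.contMDiffAt ht) hi]
  exact H.inner_eq i _ hi _ _ (hγ.orth t ht) (hγ.orth t ht)

/-- The derivative of the squared speed is twice the geodesic expression tested against the
velocity. -/
theorem IsHG.speedSq_const (H : c.Induces g h) (hγ : c.IsHG g h γ univ) (s t : ℝ) :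
    speedSq g γ s = speedSq g γ t := by
  have hd : ∀ t, HasDerivAt (speedSq g γ) 0 t := by
    intro t
    obtain ⟨i, hi⟩ := c.exists_mem_U (γ t)
    have hev : speedSq g γ =ᶠ[𝓝 t] fun t => h i (c.π i (γ t)) (deriv (fun s => c.π i (γ s)) t)
        (deriv (fun s => c.π i (γ s)) t) := by
      filter_upwards [(hγ.continuousAt (mem_univ t)).preimage_mem_nhds
        ((c.isOpen_U i).mem_nhds hi)] with s hs using hγ.speedSq_eq H (mem_univ s) hs
    refine HasDerivAt.congr_of_eventuallyEq ?_ hev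
    have h1 : HasDerivAt (fun s => c.π i (γ s)) (deriv (fun s => c.π i (γ s)) t) t :=
      ((hγ.contDiffAt_π (mem_univ t) hi).differentiableAt (by simp)).hasDerivAt
    have h2 : HasDerivAt (deriv fun s => c.π i (γ s)) (deriv (deriv fun s => c.π i (γ s)) t) t :=
      ((hγ.contDiffAt_π (mem_univ t) hi).deriv_infty.differentiableAt (by simp)).hasDerivAt
    have h3 : HasDerivAt (fun s => h i (c.π i (γ s)))
        (fderiv ℝ (h i) (c.π i (γ t)) (deriv (fun s => c.π i (γ s)) t)) t :=
      HasFDerivAt.comp_hasDerivAt (l := h i) (f := fun s => c.π i (γ s)) t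
        ((H.contDiffAt hi).differentiableAt (by simp)).hasFDerivAt h1
    refine ((h3.clm_apply h2).clm_apply h2).congr_deriv ?_
    have h4 := (geoForm_eq_zero_iff (H.pos hi)).2 (hγ.geo t trivial i hi)
      (deriv (fun s => c.π i (γ s)) t)
    have h5 := H.isTransverseMetric.symm i _ (mem_image_of_mem _ hi)
      (deriv (deriv fun s => c.π i (γ s)) t) (deriv (fun s => c.π i (γ s)) t)
    simp only [geoForm] at h4
    simp only [add_apply, ← h5]
    linarith
  exact is_const_of_deriv_eq_zero (fun t => (hd t).differentiableAt) (fun t => (hd t).deriv) s t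

theorem speedSq_comp_affine (hγ : c.IsHG g h γ univ) (H : c.Induces g h) (a b t : ℝ) :
    speedSq g (fun t => γ (a * t + b)) t = a ^ 2 * speedSq g γ t := by
  rw [hγ.speedSq_const H t (a * t + b)]
  obtain ⟨i, hi⟩ := c.exists_mem_U (γ (a * t + b))
  rw [(hγ.comp_affine a b).speedSq_eq H (mem_univ t) (i := i) hi,
    hγ.speedSq_eq H (mem_univ (a * t + b)) hi]
  have hd : HasDerivAt (fun t : ℝ => a * t + b) a t := by
    simpa using ((hasDerivAt_id t).const_mul a).add_const b
  have h1 : HasDerivAt (fun s => c.π i (γ (a * s + b)))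
      (a • deriv (fun s => c.π i (γ s)) (a * t + b)) t :=
    HasDerivAt.scomp (g₁ := fun s => c.π i (γ s)) (h := fun s => a * s + b) t
      ((hγ.contDiffAt_π (mem_univ _) hi).differentiableAt (by simp)).hasDerivAt hd
  rw [h1.deriv]
  simp only [map_smul, smul_apply, smul_eq_mul]
  ring

theorem speedSq_eq_of_shareJet (H : c.Induces g h) (hγ : c.IsHG g h γ J) (hγ' : c.IsHG g h γ' J)
    (ht : t ∈ J) (hs : c.ShareJet γ γ' t) : speedSq g γ t = speedSq g γ' t := by
  obtain ⟨i, h1, h2, h3, h4⟩ := hs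
  rw [hγ.speedSq_eq H ht h1, hγ'.speedSq_eq H ht h2, h3, h4]

end HaefligerCocycle

/-! ### Short horizontal geodesics -/

/-- Comparison of the endpoints of two solutions of a second order equation that start at the same
point. -/
theorem norm_fst_sub_le_of_lipschitz {V : Type*} [NormedAddCommGroup V] [NormedSpace ℝ V]
    {S : V × V → V} {D : Set (V × V)} (hS : LipschitzOnWith (1 / 4) S D) {τ : ℝ} (hτ : 0 ≤ τ)
    (hτ1 : τ ≤ 1) {α β : ℝ → V × V}
    (hα : ∀ t ∈ Icc 0 τ, HasDerivAt α ((α t).2, S (α t)) t ∧ α t ∈ D)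
    (hβ : ∀ t ∈ Icc 0 τ, HasDerivAt β ((β t).2, S (β t)) t ∧ β t ∈ D)
    (h0 : (α 0).1 = (β 0).1) :
    ‖(α τ).1 - (β τ).1 - τ • ((α 0).2 - (β 0).2)‖ ≤ τ / 3 * ‖(α 0).2 - (β 0).2‖ := by
  set N₀ : ℝ := ‖(α 0).2 - (β 0).2‖ with hN₀
  have hcont : ContinuousOn (fun t => ‖(α t).2 - (β t).2‖) (Icc 0 τ) := fun t ht =>
    (((hα t ht).1.continuousAt.snd.sub (hβ t ht).1.continuousAt.snd).norm).continuousWithinAt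
  obtain ⟨T, hT, hmax⟩ := isCompact_Icc.exists_isMaxOn (nonempty_Icc.2 hτ) hcont
  set N : ℝ := ‖(α T).2 - (β T).2‖ with hN
  have hNle : ∀ t ∈ Icc 0 τ, ‖(α t).2 - (β t).2‖ ≤ N := fun t ht => hmax ht
  have hN0 : 0 ≤ N := norm_nonneg _
  have h1 : ∀ t ∈ Icc 0 τ, ‖(α t).1 - (β t).1‖ ≤ N := by
    intro t ht
    have := (convex_Icc 0 τ).norm_image_sub_le_of_norm_hasDerivWithin_le
      (f := fun t => (α t).1 - (β t).1) (f' := fun t => (α t).2 - (β t).2) (C := N)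
      (fun s hs => ((hα s hs).1.fst_comp.sub (hβ s hs).1.fst_comp).hasDerivWithinAt)
      hNle (left_mem_Icc.2 hτ) ht
    simp only [h0, sub_self, sub_zero, Real.norm_eq_abs, abs_of_nonneg ht.1] at this
    nlinarith [ht.1, ht.2]
  have h2 : ∀ t ∈ Icc 0 τ, ‖S (α t) - S (β t)‖ ≤ N / 4 := by
    intro t ht
    have h3 := hS.dist_le_mul _ (hα t ht).2 _ (hβ t ht).2
    rw [dist_eq_norm, dist_eq_norm] at h3
    have h4 : ‖α t - β t‖ ≤ N := max_le (h1 t ht) (hNle t ht)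
    have h5 : (((1 / 4 : NNReal)) : ℝ) = 1 / 4 := by norm_num
    rw [h5] at h3
    linarith
  have h3 : ∀ t ∈ Icc 0 τ, ‖(α t).2 - (β t).2 - ((α 0).2 - (β 0).2)‖ ≤ N / 4 := by
    intro t ht
    have := (convex_Icc 0 τ).norm_image_sub_le_of_norm_hasDerivWithin_le
      (f := fun t => (α t).2 - (β t).2) (f' := fun t => S (α t) - S (β t)) (C := N / 4)
      (fun s hs => ((hα s hs).1.snd_comp.sub (hβ s hs).1.snd_comp).hasDerivWithinAt)
      h2 (left_mem_Icc.2 hτ) ht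
    simp only [sub_zero, Real.norm_eq_abs, abs_of_nonneg ht.1] at this
    nlinarith [ht.1, ht.2]
  -- At the time of the maximum the velocity difference has changed by at most `N / 4`, so `N ≤ N₀ +
  -- N / 4`. The final error `τ * (N / 4)` is then at most `τ / 3 * N₀`.
  have h4 : N ≤ 4 / 3 * N₀ := by
    have h5 := norm_sub_norm_le ((α T).2 - (β T).2) ((α 0).2 - (β 0).2)
    have h6 := h3 T hT
    linarith
  have h7 := (convex_Icc 0 τ).norm_image_sub_le_of_norm_hasDerivWithin_le
      (f := fun t => (α t).1 - (β t).1 - t • ((α 0).2 - (β 0).2))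
      (f' := fun t => (α t).2 - (β t).2 - ((α 0).2 - (β 0).2)) (C := N / 4)
      (fun s hs => by
        have h5 := ((hα s hs).1.fst_comp.sub (hβ s hs).1.fst_comp).sub
          ((hasDerivAt_id s).smul_const ((α 0).2 - (β 0).2))
        rw [one_smul] at h5
        exact h5.hasDerivWithinAt)
      h3 (left_mem_Icc.2 hτ) (right_mem_Icc.2 hτ)
  simp only [h0, sub_self, sub_zero, zero_smul, Real.norm_eq_abs, abs_of_nonneg hτ] at h7
  nlinarith [norm_nonneg ((α 0).2 - (β 0).2)]

set_option maxSynthPendingDepth 5 in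
/-- A positive definite form that depends continuously on a parameter is locally uniformly
positive. -/
theorem exists_eventually_mul_sq_le {X : Type*} [TopologicalSpace X] {V : Type*}
    [NormedAddCommGroup V] [NormedSpace ℝ V] [FiniteDimensional ℝ V]
    {k : X → V →L[ℝ] V →L[ℝ] ℝ} {a : X} (hk : ContinuousAt k a)
    (hpos : ∀ v, v ≠ 0 → 0 < k a v v) :
    ∃ m > (0 : ℝ), ∀ᶠ b in 𝓝 a, ∀ v, m * ‖v‖ ^ 2 ≤ k b v v := by
  obtain ⟨m, hm, hm'⟩ : ∃ m > (0 : ℝ), ∀ v, m * ‖v‖ ^ 2 ≤ k a v v := by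
    have hsph : ∃ m > (0 : ℝ), ∀ v ∈ Metric.sphere (0 : V) 1, m ≤ k a v v := by
      -- The sphere is empty for the zero space, which occurs when `q = 0`.
      rcases (Metric.sphere (0 : V) 1).eq_empty_or_nonempty with h | h
      · exact ⟨1, one_pos, fun v hv => by simp [h] at hv⟩
      · obtain ⟨v, hv, hmin⟩ := (isCompact_sphere (0 : V) 1).exists_isMinOn h
          (f := fun v => k a v v) (by fun_prop)
        exact ⟨k a v v, hpos v (by rintro rfl; simp at hv), fun w hw => hmin hw⟩
    obtain ⟨m, hm, hle⟩ := hsph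
    refine ⟨m, hm, fun v => ?_⟩
    rcases eq_or_ne v 0 with rfl | hv
    · simp
    · have h1 := hle (‖v‖⁻¹ • v) (by simp [norm_smul, hv])
      simp only [map_smul, smul_apply, smul_eq_mul] at h1
      have h2 : 0 < ‖v‖ := norm_pos_iff.2 hv
      rw [← mul_assoc, ← mul_inv, inv_mul_eq_div, le_div_iff₀ (by positivity)] at h1
      rw [sq]
      exact h1
  refine ⟨m / 2, by positivity, ?_⟩
  have h1 : ∀ᶠ b in 𝓝 a, ‖k b - k a‖ < m / 2 := by
    have hc : ContinuousAt (fun b => ‖k b - k a‖) a := (hk.sub continuousAt_const).norm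
    exact hc.eventually_lt_const (by simpa using hm)
  filter_upwards [h1] with b hb v
  have h2 : |k b v v - k a v v| ≤ m / 2 * ‖v‖ ^ 2 := by
    have h3 := (k b - k a).le_opNorm₂ v v
    rw [Real.norm_eq_abs] at h3
    refine h3.trans ?_
    rw [mul_assoc, ← sq]
    gcongr
  have := (abs_le.1 h2).1
  linarith [hm' v]

namespace HaefligerCocycle

variable {q : ℕ} {M : Type u} [TopologicalSpace M]
  [ChartedSpace (Euc (q + 1)) M] [IsManifold (𝓡 (q + 1)) ∞ M]
  {c : HaefligerCocycle.{w} (q + 1) q M} {g : SmoothMetric (q + 1) M}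
  {h : c.ι → Euc q → Euc q →L[ℝ] Euc q →L[ℝ] ℝ} {γ γ' : ℝ → M} {J J' : Set ℝ} {i j : c.ι}
  {B : OpenPartialHomeomorph M (Euc q × ℝ)} {t : ℝ}

theorem IsHG.deriv_comp_mul (hγ : c.IsHG g h γ univ) (a : ℝ) (hi : γ 0 ∈ c.U i) :
    deriv (fun s => c.π i (γ (a * s + 0))) 0 = a • deriv (fun s => c.π i (γ s)) 0 := by
  have hd : HasDerivAt (fun t : ℝ => a * t + 0) a 0 := by
    simpa using (hasDerivAt_id (0 : ℝ)).const_mul a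
  have h0 : a * 0 + 0 = (0 : ℝ) := by simp
  have h1 : HasDerivAt (fun s => c.π i (γ (a * s + 0)))
      (a • deriv (fun s => c.π i (γ s)) (a * 0 + 0)) 0 :=
    HasDerivAt.scomp (g₁ := fun s => c.π i (γ s)) (h := fun s => a * s + 0) 0
      ((hγ.contDiffAt_π (mem_univ _) (by rwa [h0])).differentiableAt (by simp)).hasDerivAt hd
  rw [h0] at h1
  exact h1.deriv

/-- Slow horizontal geodesics stay close to their starting point. -/
theorem exists_isHG_mem_of_speedSq_lt [T2Space M] (H : c.Induces g h) (z : M) {V : Set M}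
    (hV : V ∈ 𝓝 z) : ∃ V' ∈ 𝓝 z, ∃ η > (0 : ℝ), ∀ γ, c.IsHG g h γ univ → γ 0 ∈ V' →
      speedSq g γ 0 < η → ∀ t ∈ Icc (0 : ℝ) 1, γ t ∈ V := by
  obtain ⟨i, hi⟩ := c.exists_mem_U z
  obtain ⟨B, hB, hzB⟩ := exists_isBox hi
  have hU : (fun p : (Euc q × ℝ) × Euc q => B.symm p.1) ⁻¹' V ∈ 𝓝 ((B z, 0) : (Euc q × ℝ) × Euc q) := by
    have h1 : ContinuousAt (fun p : (Euc q × ℝ) × Euc q => B.symm p.1) (B z, 0) :=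
      ContinuousAt.comp (g := B.symm) (f := Prod.fst) (B.continuousAt_symm (B.map_source hzB))
        continuousAt_fst
    refine h1.preimage_mem_nhds ?_
    rwa [B.left_inv hzB]
  obtain ⟨r, hr, ε, hε, α, -, hα, -, hαu⟩ := hB.exists_flow (g := g) (h := h) H
    (p₀ := (B z, 0)) (B.map_source hzB) hU
  obtain ⟨m, hm, hev⟩ := exists_eventually_mul_sq_le (H.contDiffAt hi).continuousAt (H.pos hi)
  obtain ⟨τ, hτ, hτε⟩ : ∃ τ > 0, τ < ε := exists_between hε
  have hev' : ∀ᶠ x in 𝓝 z, ∀ v, m * ‖v‖ ^ 2 ≤ h i (c.π i x) v v :=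
    (contMDiffAt_π hi).continuousAt.tendsto.eventually hev
  have hevB : ∀ᶠ x in 𝓝 z, B x ∈ Metric.ball (B z) r :=
    (B.continuousAt hzB).preimage_mem_nhds (Metric.ball_mem_nhds _ hr)
  -- Run faster by the factor `τ⁻¹`, the geodesic covers its unit time interval in time `τ < ε`. The
  -- bound on the squared speed makes the accelerated projected velocity smaller than `r`, so the
  -- local flow applies.
  refine ⟨_, hev'.and (hevB.and (B.open_source.mem_nhds hzB)), m * (τ * r) ^ 2, by positivity, ?_⟩
  rintro γ hγ ⟨h1, h2, (h3 : γ 0 ∈ B.source)⟩ h4 t ht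
  have hiγ := hB.subset h3
  rw [hγ.speedSq_eq H (mem_univ _) hiγ] at h4
  have h5 : ‖deriv (fun s => c.π i (γ s)) 0‖ < τ * r := by
    have h6 := (h1 (deriv (fun s => c.π i (γ s)) 0)).trans_lt h4
    exact lt_of_pow_lt_pow_left₀ 2 (by positivity) (lt_of_mul_lt_mul_left h6 hm.le)
  have h7 := hγ.comp_affine τ⁻¹ 0
  have h8 : deriv (fun s => c.π i (γ (τ⁻¹ * s + 0))) 0 = τ⁻¹ • deriv (fun s => c.π i (γ s)) 0 :=
    hγ.deriv_comp_mul _ hiγ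
  have h9 : c.boxState i B (fun s => γ (τ⁻¹ * s + 0)) 0 ∈ Metric.ball ((B z, 0) : (Euc q × ℝ) × Euc q) r := by
    rw [← ball_prod_same]
    refine ⟨by simpa [boxState] using h2, ?_⟩
    simp only [boxState, h8, mem_ball_zero_iff, norm_smul, norm_inv, Real.norm_eq_abs,
      abs_of_pos hτ]
    rw [inv_mul_lt_iff₀ hτ]
    exact h5
  have hτt : τ * t ∈ Ioo (-ε) ε := by constructor <;> nlinarith [ht.1, ht.2]
  obtain ⟨h10, h11⟩ := hαu _ univ 0 h7 trivial (by simpa using h3) h9 (τ * t)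
    ⟨trivial, by simpa using hτt⟩
  have h12 : B.symm (c.boxState i B (fun s => γ (τ⁻¹ * s + 0)) (τ * t)).1 ∈ V := by
    rw [h11]
    exact ((hα _ h9).2 _ (by simpa using hτt)).1
  have e : τ⁻¹ * (τ * t) + 0 = t := by field_simp; simp
  simp only [boxState] at h12 h10
  rw [B.left_inv h10, e] at h12
  exact h12

/-- Any two plaques close to a point are joined by short horizontal geodesics, starting at any
given point of the first plaque. -/
theorem exists_isHG_to_plaque [T2Space M] (H : c.Induces g h)
    (hcomp : c.IsTransversallyCompleteMetric g) {z : M} (hi : z ∈ c.U i) {η : ℝ} (hη : 0 < η)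
    {V : Set M} (hV : V ∈ 𝓝 z) : ∃ V' ∈ 𝓝 z, ∀ x ∈ V', ∀ x' ∈ V', ∃ γ, c.IsHG g h γ univ ∧
      γ 0 = x ∧ speedSq g γ 0 < η ∧ (∀ t ∈ Icc (0 : ℝ) 1, γ t ∈ V) ∧
      c.π i (γ 1) = c.π i x' := by
  obtain ⟨B, hB, hzB⟩ := exists_isBox hi
  have hπz : (B z).1 = c.π i z := hB.fst_eq z hzB
  -- Near zero velocity the acceleration has Lipschitz constant `1 / 4`, as
  -- `norm_fst_sub_le_of_lipschitz` requires.
  obtain ⟨D, hD, hlip⟩ := (hasStrictFDerivAt_geoVec (H.pos hi)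
    (H.contDiffAt hi)).exists_lipschitzOnWith_of_nnnorm_lt (1 / 4) (by simp)
  have hU₁ : (fun p : (Euc q × ℝ) × Euc q => B.symm p.1) ⁻¹' V ∈
      𝓝 ((B z, 0) : (Euc q × ℝ) × Euc q) := by
    have h1 : ContinuousAt (fun p : (Euc q × ℝ) × Euc q => B.symm p.1) (B z, 0) :=
      ContinuousAt.comp (g := B.symm) (f := Prod.fst) (B.continuousAt_symm (B.map_source hzB))
        continuousAt_fst
    refine h1.preimage_mem_nhds ?_
    rwa [B.left_inv hzB]
  have hU₂ : (fun p : (Euc q × ℝ) × Euc q => (p.1.1, p.2)) ⁻¹' D ∈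
      𝓝 ((B z, 0) : (Euc q × ℝ) × Euc q) := by
    have h1 : Continuous (fun p : (Euc q × ℝ) × Euc q => (p.1.1, p.2)) := by fun_prop
    refine h1.continuousAt.preimage_mem_nhds ?_
    simpa [hπz] using hD
  obtain ⟨r, hr, ε, hε, α, -, hα, hαHG, hαu⟩ := hB.exists_flow (g := g) (h := h) H
    (p₀ := (B z, 0)) (B.map_source hzB) (Filter.inter_mem hU₁ hU₂)
  obtain ⟨τ, hτ, hτε⟩ : ∃ τ > 0, τ < min ε 1 := exists_between (by positivity)
  have hτε' := hτε.trans_le (min_le_left _ _)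
  have hτ1 := hτε.trans_le (min_le_right _ _)
  -- slow initial velocities
  have hsp : ∀ᶠ p in 𝓝 ((c.π i z, 0) : Euc q × Euc q), h i p.1 p.2 p.2 < η := by
    have h1 : ContinuousAt (fun p : Euc q × Euc q => h i p.1 p.2 p.2) (c.π i z, 0) := by
      have h2 : ContinuousAt (fun p : Euc q × Euc q => h i p.1) (c.π i z, 0) :=
        ContinuousAt.comp (g := h i) (f := Prod.fst) (H.contDiffAt hi).continuousAt continuousAt_fst
      exact (h2.clm_apply continuousAt_snd).clm_apply continuousAt_snd
    exact h1.eventually_lt_const (by simpa using hη)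
  rw [nhds_prod_eq] at hsp
  obtain ⟨P₁, hP₁, P₂, hP₂, hP⟩ := Filter.eventually_prod_iff.1 hsp
  obtain ⟨r₁, hr₁, hball₁⟩ := Metric.eventually_nhds_iff_ball.1 hP₂
  obtain ⟨r₂, hr₂, hr₂'⟩ : ∃ r₂ > 0, r₂ < min r r₁ := exists_between (by positivity)
  have hr₂r := hr₂'.trans_le (min_le_left _ _)
  have hr₂r₁ := hr₂'.trans_le (min_le_right _ _)
  have hev₁ : ∀ᶠ x in 𝓝 z, P₁ (c.π i x) := (contMDiffAt_π hi).continuousAt.tendsto.eventually hP₁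
  have hev₂ : ∀ᶠ x in 𝓝 z, B x ∈ Metric.ball (B z) r :=
    (B.continuousAt hzB).preimage_mem_nhds (Metric.ball_mem_nhds _ hr)
  have hev₃ : ∀ᶠ x in 𝓝 z, c.π i x ∈ Metric.ball (c.π i z) (τ * r₂ / 3) :=
    (contMDiffAt_π hi).continuousAt.preimage_mem_nhds (Metric.ball_mem_nhds _ (by positivity))
  refine ⟨_, hev₁.and (hev₂.and (hev₃.and (B.open_source.mem_nhds hzB))), ?_⟩
  rintro x ⟨hx₁, hx₂, hx₃, hxB⟩ x' ⟨-, -, hx₃', -⟩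
  have hmem : ∀ ξ ∈ Metric.closedBall (0 : Euc q) r₂,
      ((B x, ξ) : (Euc q × ℝ) × Euc q) ∈ Metric.ball (B z, 0) r := by
    intro ξ hξ
    rw [← ball_prod_same]
    exact ⟨hx₂, Metric.closedBall_subset_ball hr₂r hξ⟩
  have hsol : ∀ ξ ∈ Metric.closedBall (0 : Euc q) r₂, ∀ t ∈ Icc 0 τ,
      HasDerivAt (fun s => ((α ((B x, ξ), s)).1.1, (α ((B x, ξ), s)).2))
        ((α ((B x, ξ), t)).2, geoVec (h i) (α ((B x, ξ), t)).1.1 (α ((B x, ξ), t)).2) t ∧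
        ((α ((B x, ξ), t)).1.1, (α ((B x, ξ), t)).2) ∈ D := by
    intro ξ hξ t ht
    obtain ⟨h1, -, h2⟩ := (hα _ (hmem ξ hξ)).2 t ⟨by linarith [ht.1], by linarith [ht.2]⟩
    exact ⟨(h2.fst_comp.fst_comp).prodMk h2.snd_comp, h1.2⟩
  -- The projected exponential map at `x`, for time `τ`; by `hest` it differs from `τ • id` by a map
  -- with Lipschitz constant `τ / 3`.
  let e : Euc q → Euc q := fun ξ => (α ((B x, ξ), τ)).1.1
  have hest : ∀ ξ ∈ Metric.closedBall (0 : Euc q) r₂, ∀ ξ' ∈ Metric.closedBall (0 : Euc q) r₂,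
      ‖e ξ - e ξ' - τ • (ξ - ξ')‖ ≤ τ / 3 * ‖ξ - ξ'‖ := by
    intro ξ hξ ξ' hξ'
    have := norm_fst_sub_le_of_lipschitz (S := fun p => geoVec (h i) p.1 p.2) hlip hτ.le hτ1.le
      (hsol ξ hξ) (hsol ξ' hξ') (by simp [(hα _ (hmem ξ hξ)).1, (hα _ (hmem ξ' hξ')).1])
    simpa [(hα _ (hmem ξ hξ)).1, (hα _ (hmem ξ' hξ')).1] using this
  -- The geodesic with zero projected velocity projects to a constant; this follows from the same
  -- estimate, applied to the constant solution.
  have he0 : e 0 = c.π i x := by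
    have h0m : (0 : Euc q) ∈ Metric.closedBall (0 : Euc q) r₂ := Metric.mem_closedBall_self hr₂.le
    have h1 := (hα _ (hmem 0 h0m)).1
    have hg0 : geoVec (h i) (c.π i x) 0 = 0 := by
      simpa using geoVec_smul (h i) (c.π i x) 0 0
    have hD0 : (c.π i x, (0 : Euc q)) ∈ D := by
      have := (hsol 0 h0m 0 (left_mem_Icc.2 hτ.le)).2
      rwa [h1, hB.fst_eq x hxB] at this
    have := norm_fst_sub_le_of_lipschitz (S := fun p => geoVec (h i) p.1 p.2) hlip hτ.le hτ1.le
      (hsol 0 h0m) (β := fun _ => (c.π i x, 0))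
      (fun t _ => ⟨by
        change HasDerivAt _ ((0 : Euc q), geoVec (h i) (c.π i x) 0) t
        rw [hg0]
        exact hasDerivAt_const t _, hD0⟩)
      (by simp [h1, hB.fst_eq x hxB])
    simp only [h1, sub_self, smul_zero, sub_zero, norm_zero, mul_zero] at this
    exact sub_eq_zero.1 (norm_le_zero_iff.1 this)
  -- By the quantitative inverse function theorem the image of this ball contains the ball of radius
  -- `(τ - τ / 3) * r₂` about `π i x`. It contains `π i x'`, since both projections are within `τ *
  -- r₂ / 3` of `π i z`.
  obtain ⟨ξ, hξ, hξe⟩ : ∃ ξ ∈ Metric.closedBall (0 : Euc q) r₂, e ξ = c.π i x' := by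
    let L : Euc q →L[ℝ] Euc q := τ • ContinuousLinearMap.id ℝ (Euc q)
    have hA : ApproximatesLinearOn e L (Metric.closedBall 0 r₂) ⟨τ / 3, by positivity⟩ :=
      fun ξ hξ ξ' hξ' => hest ξ hξ ξ' hξ'
    let Li : L.NonlinearRightInverse :=
      { toFun := fun v => τ⁻¹ • v
        nnnorm := ⟨τ⁻¹, by positivity⟩
        bound' := fun v => by
          rw [norm_smul, norm_inv, Real.norm_eq_abs, abs_of_pos hτ]
          rfl
        right_inv' := fun v => by
          simp [L, smul_smul, hτ.ne'] }
    have h1 := hA.surjOn_closedBall_of_nonlinearRightInverse Li hr₂.le subset_rfl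
    have h2 : c.π i x' ∈ Metric.closedBall (e 0) (((Li.nnnorm : ℝ)⁻¹ -
        ((⟨τ / 3, by positivity⟩ : NNReal) : ℝ)) * r₂) := by
      rw [he0]
      have h3 := dist_triangle_right (c.π i x') (c.π i x) (c.π i z)
      have h4 := Metric.mem_ball.1 hx₃
      have h5 := Metric.mem_ball.1 hx₃'
      have h6 : (((Li.nnnorm : ℝ)⁻¹ - ((⟨τ / 3, by positivity⟩ : NNReal) : ℝ)) * r₂) =
          2 * (τ * r₂ / 3) := by
        have h7 : (Li.nnnorm : ℝ) = τ⁻¹ := rfl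
        have h8 : ((⟨τ / 3, by positivity⟩ : NNReal) : ℝ) = τ / 3 := rfl
        rw [h7, h8, inv_inv]
        ring
      rw [h6, Metric.mem_closedBall]
      linarith
    exact h1 h2
  obtain ⟨γ, hγ, hγ0, hγξ⟩ := exists_isHG H hcomp (hB.subset hxB) ξ
  have hst : c.boxState i B γ 0 = (B x, ξ) := by simp [boxState, hγ0, hγξ]
  have key : ∀ t ∈ Icc (0 : ℝ) 1, γ (τ * t) ∈ B.source ∧
      c.boxState i B γ (τ * t) = α ((B x, ξ), τ * t) ∧ γ (τ * t) ∈ V := by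
    intro t ht
    have hτt : τ * t ∈ Ioo (-ε) ε := by constructor <;> nlinarith [ht.1, ht.2]
    obtain ⟨h1, h2⟩ := hαu γ univ 0 hγ trivial (by rwa [hγ0]) (by rw [hst]; exact hmem ξ hξ)
      (τ * t) ⟨trivial, by simpa using hτt⟩
    rw [sub_zero, hst] at h2
    refine ⟨h1, h2, ?_⟩
    have h3 := ((hα _ (hmem ξ hξ)).2 _ hτt).1.1
    simp only [mem_preimage, ← h2, boxState, B.left_inv h1] at h3
    exact h3
  refine ⟨fun t => γ (τ * t + 0), hγ.comp_affine τ 0, by simpa using hγ0, ?_, ?_, ?_⟩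
  · rw [speedSq_comp_affine hγ H, hγ.speedSq_eq H (mem_univ 0) (by rw [hγ0]; exact hB.subset hxB),
      hγξ, hγ0]
    have h1 := hP hx₁ (hball₁ ξ (Metric.closedBall_subset_ball hr₂r₁ hξ))
    have h2 : τ ^ 2 ≤ 1 := pow_le_one₀ hτ.le hτ1.le
    have h3 : 0 < τ ^ 2 := by positivity
    simp only at h1
    nlinarith [mul_pos h3 (sub_pos.2 h1), mul_nonneg (sub_nonneg.2 h2) hη.le]
  · intro t ht
    simpa using (key t ht).2.2
  · obtain ⟨h1, h2, -⟩ := key 1 ⟨zero_le_one, le_rfl⟩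
    simp only [mul_one, add_zero] at h1 h2 ⊢
    rw [← hB.fst_eq _ h1, ← hξe]
    exact congrArg (fun p => p.1.1) h2

end HaefligerCocycle

/-! ### Sliding horizontal geodesics along the leaves -/

namespace HaefligerCocycle

variable {q : ℕ} {M : Type u} [TopologicalSpace M]
  [ChartedSpace (Euc (q + 1)) M] [IsManifold (𝓡 (q + 1)) ∞ M]
  {c : HaefligerCocycle.{w} (q + 1) q M} {g : SmoothMetric (q + 1) M}
  {h : c.ι → Euc q → Euc q →L[ℝ] Euc q →L[ℝ] ℝ} {γ γ' γ'' ℓ : ℝ → M} {J J' : Set ℝ} {i j : c.ι}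
  {B : OpenPartialHomeomorph M (Euc q × ℝ)} {t : ℝ} {Γ : ℝ → ℝ → M} {T : ℝ}

theorem ShareJet.symm (H : c.ShareJet γ γ' t) : c.ShareJet γ' γ t :=
  let ⟨i, h1, h2, h3, h4⟩ := H
  ⟨i, h2, h1, h3.symm, h4.symm⟩

/-- The relation is witnessed by a single submersion, so transitivity needs one that is defined at
all three points. -/
theorem ShareJet.trans (H : c.ShareJet γ γ' t) (H' : c.ShareJet γ' γ'' t)
    (h1 : c.IsHG g h γ' univ) (h2 : c.IsHG g h γ'' univ) (hi : ∃ i, γ t ∈ c.U i ∧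
      γ' t ∈ c.U i ∧ γ'' t ∈ c.U i) (h0 : c.IsHG g h γ univ) : c.ShareJet γ γ'' t := by
  obtain ⟨i, hi₀, hi₁, hi₂⟩ := hi
  obtain ⟨e1, e2⟩ := H.eq (h0.contMDiffAt (mem_univ t)) (h1.contMDiffAt (mem_univ t)) hi₀ hi₁
  obtain ⟨e3, e4⟩ := H'.eq (h1.contMDiffAt (mem_univ t)) (h2.contMDiffAt (mem_univ t)) hi₁ hi₂
  exact ⟨i, hi₀, hi₂, e1.trans e3, e2.trans e4⟩

theorem ShareJet.rfl : c.ShareJet γ γ t :=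
  let ⟨i, hi⟩ := c.exists_mem_U (γ t)
  ⟨i, hi, hi, Eq.refl _, Eq.refl _⟩

/-- A curve in a leaf. -/
structure IsLeafCurveOn (c : HaefligerCocycle.{w} (q + 1) q M) (σ : ℝ → M) (S : Set ℝ) : Prop where
  continuousOn : ContinuousOn σ S
  eventually_eq : ∀ s ∈ S, ∀ i, σ s ∈ c.U i → ∀ᶠ r in 𝓝[S] s, c.π i (σ r) = c.π i (σ s)

theorem IsLeafCurveOn.mono {σ : ℝ → M} {S S' : Set ℝ} (hσ : c.IsLeafCurveOn σ S) (hS : S' ⊆ S) :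
    c.IsLeafCurveOn σ S' :=
  ⟨hσ.continuousOn.mono hS, fun s hs i hi =>
    nhdsWithin_mono _ hS (hσ.eventually_eq s (hS hs) i hi)⟩

theorem IsLeafCurveOn.π_eq {σ : ℝ → M} {S : Set ℝ} (hσ : c.IsLeafCurveOn σ S)
    (hS : IsPreconnected S) (hi : ∀ s ∈ S, σ s ∈ c.U i) {s s' : ℝ} (hs : s ∈ S) (hs' : s' ∈ S) :
    c.π i (σ s') = c.π i (σ s) := by
  refine hS.forall_of_eventually_iff (P := fun r => c.π i (σ r) = c.π i (σ s))
    (fun r hr => ?_) hs rfl s' hs'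
  filter_upwards [hσ.eventually_eq r hr i (hi r hr)] with r' hr' using by rw [hr']

/-- A family of horizontal geodesics that start on the curve `ℓ` and have, locally in the
parameter, the same projected initial jet. -/
structure IsSlide (c : HaefligerCocycle.{w} (q + 1) q M) (g : SmoothMetric (q + 1) M)
    (h : c.ι → Euc q → Euc q →L[ℝ] Euc q →L[ℝ] ℝ) (ℓ : ℝ → M) (Γ : ℝ → ℝ → M) (T : ℝ) :
    Prop where
  isHG : ∀ s, c.IsHG g h (Γ s) univ
  apply_zero : ∀ s ∈ Icc 0 T, Γ s 0 = ℓ s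
  shareJet : ∀ s ∈ Icc 0 T, ∀ᶠ r in 𝓝[Icc 0 T] s, c.ShareJet (Γ r) (Γ s) 0

/-- The projected initial velocity is transported along `ℓ`. While `ℓ` stays in one `c.U i` its
projection is locally constant, so the same vector `ξ` of `ℝ^q` can be used; the parameter interval
grows by a continuity argument. -/
theorem exists_isSlide [T2Space M] (H : c.Induces g h) (hcomp : c.IsTransversallyCompleteMetric g)
    (hℓ : c.IsLeafCurveOn ℓ univ) (hγ : c.IsHG g h γ univ) (h0 : γ 0 = ℓ 0) (hT : 0 ≤ T) :
    ∃ Γ, c.IsSlide g h ℓ Γ T ∧ Γ 0 = γ := by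
  refine (isPreconnected_Ici (a := (0 : ℝ))).forall_of_eventually_iff
    (P := fun b => ∃ Γ, c.IsSlide g h ℓ Γ b ∧ Γ 0 = γ) (fun b hb => ?_)
    (t₀ := 0) self_mem_Ici ?_ T hT
  swap
  · refine ⟨fun _ => γ, ⟨fun _ => hγ, ?_, ?_⟩, rfl⟩
    · rintro s ⟨h1, h2⟩
      rw [le_antisymm h2 h1, h0]
    · exact fun s hs => Filter.Eventually.of_forall fun _ => ShareJet.rfl
  obtain ⟨i, hi⟩ := c.exists_mem_U (ℓ b)
  have h1 : ∀ᶠ s in 𝓝 b, ℓ s ∈ c.U i :=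
    (hℓ.continuousOn.continuousAt Filter.univ_mem).preimage_mem_nhds ((c.isOpen_U i).mem_nhds hi)
  have h2 : ∀ᶠ s in 𝓝 b, c.π i (ℓ s) = c.π i (ℓ b) := by
    simpa [nhdsWithin_univ] using hℓ.eventually_eq b trivial i hi
  obtain ⟨δ, hδ, hball⟩ := Metric.eventually_nhds_iff_ball.1 (h1.and h2)
  have key : ∀ b₁ ∈ Metric.ball b δ, ∀ b₂ ∈ Metric.ball b δ, 0 ≤ b₁ →
      (∃ Γ, c.IsSlide g h ℓ Γ b₁ ∧ Γ 0 = γ) → ∃ Γ, c.IsSlide g h ℓ Γ b₂ ∧ Γ 0 = γ := by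
    rintro b₁ hb₁ b₂ hb₂ hb₁0 ⟨Γ, hΓ, hΓ0⟩
    have hmem : ∀ s ∈ Icc b₁ b₂, s ∈ Metric.ball b δ := by
      rw [Real.ball_eq_Ioo] at hb₁ hb₂ ⊢
      exact fun s hs => ⟨hb₁.1.trans_le hs.1, hs.2.trans_lt hb₂.2⟩
    set ξ := deriv (fun t => c.π i (Γ b₁ t)) 0 with hξ
    -- Outside the ball `γ` serves as a default value.
    have hex : ∀ s : ℝ, ∃ β, c.IsHG g h β univ ∧ (s ∈ Metric.ball b δ → β 0 = ℓ s ∧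
        deriv (fun t => c.π i (β t)) 0 = ξ) := by
      intro s
      by_cases hs : s ∈ Metric.ball b δ
      · obtain ⟨β, h3, h4, h5⟩ := exists_isHG H hcomp (hball s hs).1 ξ
        exact ⟨β, h3, fun _ => ⟨h4, h5⟩⟩
      · exact ⟨γ, hγ, fun h => absurd h hs⟩
    choose β hβ hβ' using hex
    have hb₁e := hΓ.apply_zero b₁ ⟨hb₁0, le_rfl⟩
    have hjet : ∀ s ∈ Icc b₁ b₂, ∀ s' ∈ Icc b₁ b₂,
        c.ShareJet (if s ≤ b₁ then Γ s else β s) (if s' ≤ b₁ then Γ s' else β s') 0 := by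
      have h3 : ∀ s ∈ Icc b₁ b₂, (if s ≤ b₁ then Γ s else β s) 0 = ℓ s ∧
          deriv (fun t => c.π i ((if s ≤ b₁ then Γ s else β s) t)) 0 = ξ := by
        intro s hs
        split_ifs with h
        · rw [le_antisymm h hs.1]
          exact ⟨hb₁e, rfl⟩
        · exact hβ' s (hmem s hs)
      intro s hs s' hs'
      obtain ⟨e1, e2⟩ := h3 s hs
      obtain ⟨e3, e4⟩ := h3 s' hs'
      refine ⟨i, ?_, ?_, ?_, ?_⟩
      · rw [e1]; exact (hball s (hmem s hs)).1
      · rw [e3]; exact (hball s' (hmem s' hs')).1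
      · rw [e1, e3, (hball s (hmem s hs)).2, (hball s' (hmem s' hs')).2]
      · rw [e2, e4]
    refine ⟨fun s => if s ≤ b₁ then Γ s else β s, ⟨?_, ?_, ?_⟩, ?_⟩
    · intro s
      by_cases h : s ≤ b₁ <;> simp only [h, if_true, if_false]
      · exact hΓ.isHG s
      · exact hβ s
    · intro s hs
      by_cases h : s ≤ b₁ <;> simp only [h, if_true, if_false]
      · exact hΓ.apply_zero s ⟨hs.1, h⟩
      · exact (hβ' s (hmem s ⟨(not_le.1 h).le, hs.2⟩)).1
    · intro s hs
      rcases lt_trichotomy s b₁ with h | h | h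
      · have h3 := hΓ.shareJet s ⟨hs.1, h.le⟩
        rw [eventually_nhdsWithin_iff] at h3 ⊢
        filter_upwards [h3, Iio_mem_nhds h] with r hr hr' hr''
        simp only [h.le, (show r < b₁ from hr').le, if_true]
        exact hr ⟨hr''.1, (show r < b₁ from hr').le⟩
      · subst h
        have h3 := hΓ.shareJet s ⟨hs.1, le_rfl⟩
        rw [eventually_nhdsWithin_iff] at h3 ⊢
        filter_upwards [h3] with r hr hr'
        by_cases hrs : r ≤ s
        · simp only [hrs, le_refl, if_true]
          exact hr ⟨hr'.1, hrs⟩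
        · exact hjet r ⟨(not_le.1 hrs).le, hr'.2⟩ s ⟨le_rfl, hs.2⟩
      · rw [eventually_nhdsWithin_iff]
        filter_upwards [Ioi_mem_nhds h] with r hr hr'
        exact hjet r ⟨(show b₁ < r from hr).le, hr'.2⟩ s ⟨h.le, hs.2⟩
    · simp only [hb₁0, if_true]
      exact hΓ0
  rw [eventually_nhdsWithin_iff]
  filter_upwards [Metric.ball_mem_nhds b hδ] with s hs hs0
  exact ⟨key b (Metric.mem_ball_self hδ) s hs hb, key s hs b (Metric.mem_ball_self hδ) hs0⟩

namespace IsSlide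

variable {s : ℝ}

theorem stateTendsto_zero (hℓ : c.IsLeafCurveOn ℓ univ) (hΓ : c.IsSlide g h ℓ Γ T)
    (hs : s ∈ Icc 0 T) :
    c.StateTendsto (𝓝[Icc 0 T] s) Γ (Γ s) 0 := by
  have h1 : Filter.Tendsto (fun r => Γ r 0) (𝓝[Icc 0 T] s) (𝓝 (Γ s 0)) := by
    rw [hΓ.apply_zero s hs]
    refine ((hℓ.continuousOn.continuousAt Filter.univ_mem).tendsto.mono_left
      nhdsWithin_le_nhds).congr' ?_
    filter_upwards [self_mem_nhdsWithin] with r hr using (hΓ.apply_zero r hr).symm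
  refine ⟨h1, fun i hi => tendsto_const_nhds.congr' ?_⟩
  filter_upwards [hΓ.shareJet s hs, h1.eventually ((c.isOpen_U i).mem_nhds hi)] with r hr hr'
  exact (hr.eq ((hΓ.isHG r).contMDiffAt trivial) ((hΓ.isHG s).contMDiffAt trivial) hr' hi).2.symm

theorem stateTendsto [T2Space M] (H : c.Induces g h) (hℓ : c.IsLeafCurveOn ℓ univ)
    (hΓ : c.IsSlide g h ℓ Γ T) (hs : s ∈ Icc 0 T) (t : ℝ) :
    c.StateTendsto (𝓝[Icc 0 T] s) Γ (Γ s) t :=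
  StateTendsto.of_zero H hΓ.isHG (hΓ.isHG s) (hΓ.stateTendsto_zero hℓ hs) t

theorem eventually_shareJet [T2Space M] (H : c.Induces g h) (hℓ : c.IsLeafCurveOn ℓ univ)
    (hΓ : c.IsSlide g h ℓ Γ T) (hs : s ∈ Icc 0 T) (t : ℝ) :
    ∀ᶠ r in 𝓝[Icc 0 T] s, c.ShareJet (Γ r) (Γ s) t :=
  StateTendsto.eventually_shareJet H hΓ.isHG (hΓ.isHG s) (hΓ.stateTendsto_zero hℓ hs)
    (hΓ.shareJet s hs) t

/-- Shared projected jets persist for all times, so at every time `t`, not only at time zero, the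
points of the slide stay locally in one fibre of the submersions. -/
theorem isLeafCurveOn [T2Space M] (H : c.Induces g h) (hℓ : c.IsLeafCurveOn ℓ univ)
    (hΓ : c.IsSlide g h ℓ Γ T) (t : ℝ) : c.IsLeafCurveOn (fun s => Γ s t) (Icc 0 T) := by
  refine ⟨fun s hs => (hΓ.stateTendsto H hℓ hs t).1, fun s hs i hi => ?_⟩
  filter_upwards [hΓ.eventually_shareJet H hℓ hs t,
    (hΓ.stateTendsto H hℓ hs t).1.eventually ((c.isOpen_U i).mem_nhds hi)] with r hr hr'
  exact (hr.eq ((hΓ.isHG r).contMDiffAt trivial) ((hΓ.isHG s).contMDiffAt trivial) hr' hi).1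

theorem speedSq_eq (H : c.Induces g h) (hΓ : c.IsSlide g h ℓ Γ T)
    (hs : s ∈ Icc 0 T) (t : ℝ) : speedSq g (Γ s) t = speedSq g (Γ 0) 0 := by
  rw [(hΓ.isHG s).speedSq_const H t 0]
  refine isPreconnected_Icc.forall_of_eventually_iff
    (P := fun s => speedSq g (Γ s) 0 = speedSq g (Γ 0) 0) (fun r hr => ?_)
    (t₀ := 0) ⟨le_rfl, hs.1.trans hs.2⟩ rfl s hs
  filter_upwards [hΓ.shareJet r hr] with r' hr'
  rw [speedSq_eq_of_shareJet H (hΓ.isHG r') (hΓ.isHG r) trivial hr']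

/-- Two geodesics of a slide that share their jet and their position at some time start at the same
point. -/
theorem eq_of_apply_eq [T2Space M] (H : c.Induces g h)
    (hΓ : c.IsSlide g h ℓ Γ T) {s s' : ℝ} (hs : s ∈ Icc 0 T) (hs' : s' ∈ Icc 0 T)
    (hj : c.ShareJet (Γ s) (Γ s') t) (he : Γ s t = Γ s' t) : ℓ s = ℓ s' := by
  rw [← hΓ.apply_zero s hs, ← hΓ.apply_zero s' hs']
  exact (hΓ.isHG s).eqOn H (hΓ.isHG s') (mem_univ t) he hj (mem_univ 0)

end IsSlide

/-- The endpoints of horizontal geodesics of bounded speed that start in a compact set form a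
relatively compact set. -/
theorem isCompact_closure_endpoints [T2Space M] [LocallyCompactSpace M]
    (H : c.Induces g h) (hcomp : c.IsTransversallyCompleteMetric g)
    {C : Set M} (hC : IsCompact C) (σ : ℝ) :
    IsCompact (closure {y | ∃ γ, c.IsHG g h γ univ ∧ γ 0 ∈ C ∧ speedSq g γ 0 ≤ σ ∧ γ 1 = y}) := by
  suffices h1 : ∃ K, IsCompact K ∧
      ∀ γ, c.IsHG g h γ univ → γ 0 ∈ C → speedSq g γ 0 ≤ σ → γ 1 ∈ K by
    obtain ⟨K, hK, h1⟩ := h1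
    refine hK.closure_of_subset ?_
    rintro _ ⟨γ, h2, h3, h4, rfl⟩
    exact h1 γ h2 h3 h4
  refine hC.induction_on (p := fun C => ∃ K, IsCompact K ∧
      ∀ γ, c.IsHG g h γ univ → γ 0 ∈ C → speedSq g γ 0 ≤ σ → γ 1 ∈ K)
    ⟨∅, isCompact_empty, fun γ _ h => h.elim⟩ ?_ ?_ ?_
  · rintro C₁ C₂ h12 ⟨K, hK, h1⟩
    exact ⟨K, hK, fun γ hγ h2 => h1 γ hγ (h12 h2)⟩
  · rintro C₁ C₂ ⟨K₁, hK₁, h1⟩ ⟨K₂, hK₂, h2⟩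
    exact ⟨K₁ ∪ K₂, hK₁.union hK₂, fun γ hγ h3 h4 =>
      h3.elim (fun h => Or.inl (h1 γ hγ h h4)) (fun h => Or.inr (h2 γ hγ h h4))⟩
  intro z _
  obtain ⟨i, hi⟩ := c.exists_mem_U z
  obtain ⟨m, hm, hev⟩ := exists_eventually_mul_sq_le (H.contDiffAt hi).continuousAt (H.pos hi)
  have hev' : ∀ᶠ x in 𝓝 z, ∀ v, m * ‖v‖ ^ 2 ≤ h i (c.π i x) v v :=
    (contMDiffAt_π hi).continuousAt.tendsto.eventually hev
  obtain ⟨N, hN, hNs, hNc⟩ := local_compact_nhds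
    (Filter.inter_mem hev' ((c.isOpen_U i).mem_nhds hi))
  have hex : ∀ p : M × Euc q, ∃ γ, c.IsHG g h γ univ ∧ (p.1 ∈ c.U i → γ 0 = p.1 ∧
      deriv (fun s => c.π i (γ s)) 0 = p.2) := by
    intro p
    by_cases hp : p.1 ∈ c.U i
    · obtain ⟨γ, h1, h2⟩ := exists_isHG H hcomp hp p.2
      exact ⟨γ, h1, fun _ => h2⟩
    · obtain ⟨γ, h1, -⟩ := exists_isHG H hcomp hi 0
      exact ⟨γ, h1, fun h => absurd h hp⟩
  choose G hG hG' using hex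
  -- Over `N`, squared speed at most `σ` bounds the projected velocity by `√(σ / m)`. The endpoints
  -- thus lie in the image of a compact set of initial states under a continuous map.
  have hcont : ContinuousOn (fun p => G p 1) (N ×ˢ Metric.closedBall (0 : Euc q) √(σ / m)) := by
    refine ContinuousOn.mono (s := c.U i ×ˢ univ) ?_ fun p hp => ⟨(hNs hp.1).2, trivial⟩
    intro p hp
    refine ContinuousAt.continuousWithinAt ?_
    have hnear : ∀ᶠ p' in 𝓝 p, p' ∈ c.U i ×ˢ (univ : Set (Euc q)) :=
      ((c.isOpen_U i).prod isOpen_univ).mem_nhds hp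
    refine (StateTendsto.of_zero H (t₀ := 0) hG (hG p) ?_ 1).1
    refine StateTendsto.of_exists (i := i) hG (hG p) ?_ (by rw [(hG' p hp.1).1]; exact hp.1) ?_
    · rw [(hG' p hp.1).1]
      refine (continuous_fst.tendsto p).congr' ?_
      filter_upwards [hnear] with p' hp' using (hG' p' hp'.1).1.symm
    · rw [(hG' p hp.1).2]
      refine (continuous_snd.tendsto p).congr' ?_
      filter_upwards [hnear] with p' hp' using (hG' p' hp'.1).2.symm
  refine ⟨N, mem_nhdsWithin_of_mem_nhds hN, _, (hNc.prod (isCompact_closedBall _ _)).image_of_continuousOn hcont,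
    ?_⟩
  intro γ hγ hγN hsp
  have hγi := (hNs hγN).2
  set ξ := deriv (fun s => c.π i (γ s)) 0 with hξ
  refine ⟨(γ 0, ξ), ⟨hγN, ?_⟩, ?_⟩
  · rw [hγ.speedSq_eq H (mem_univ 0) hγi] at hsp
    have h1 := (hNs hγN).1 ξ
    rw [mem_closedBall_zero_iff]
    refine Real.le_sqrt_of_sq_le ?_
    rw [le_div_iff₀ hm]
    linarith
  · have h1 := hG' (γ 0, ξ) hγi
    exact (hG (γ 0, ξ)).eqOn H hγ (mem_univ 0) h1.1
      ⟨i, by rw [h1.1]; exact hγi, hγi, by rw [h1.1], h1.2⟩ (mem_univ 1)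

end HaefligerCocycle

/-! ### A proper function and smooth primitives -/

/-- A smooth function with compact sublevel sets. -/
theorem exists_smooth_exhaustion (n : ℕ) (M : Type u) [TopologicalSpace M] [T2Space M]
    [SecondCountableTopology M] [ChartedSpace (Euc n) M] [IsManifold (𝓡 n) ∞ M] :
    ∃ ρ : M → ℝ, ContMDiff (𝓡 n) 𝓘(ℝ, ℝ) ∞ ρ ∧ ∀ R, IsCompact {x | ρ x ≤ R} := by
  have : LocallyCompactSpace M := ChartedSpace.locallyCompactSpace (Euc n) M
  have : SigmaCompactSpace M := inferInstance
  let K : CompactExhaustion M := default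
  -- The value at `x` must be at least each `m` with `x ∉ K m`. This condition is convex and locally
  -- satisfied by constants, so a partition of unity yields `ρ`.
  have hconv : ∀ x, Convex ℝ {r : ℝ | ∀ m : ℕ, x ∉ K m → (m : ℝ) ≤ r} := by
    intro x a ha b hb s t hs ht hst m hm
    have h1 := ha m hm
    have h2 := hb m hm
    simp only [smul_eq_mul]
    nlinarith
  have hloc : ∀ x, ∃ r : ℝ, ∀ᶠ y in 𝓝 x, r ∈ {r : ℝ | ∀ m : ℕ, y ∉ K m → (m : ℝ) ≤ r} := by
    intro x
    obtain ⟨m, hm⟩ := K.exists_mem_nhds x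
    refine ⟨m, ?_⟩
    filter_upwards [hm] with y hy k hk
    by_contra h
    exact hk (K.subset (Nat.cast_le.1 (not_le.1 h).le) hy)
  obtain ⟨ρ, hρ⟩ := exists_contMDiffMap_forall_mem_convex_of_local_const (n := ⊤) (𝓡 n) hconv hloc
  refine ⟨ρ, ρ.contMDiff, fun R => ?_⟩
  obtain ⟨m, hm⟩ := exists_nat_gt R
  refine (K.isCompact m).of_isClosed_subset (isClosed_le ρ.contMDiff.continuous continuous_const)
    fun x hx => ?_
  by_contra hxm
  exact absurd (hρ x m hxm) (not_le.2 (lt_of_le_of_lt hx hm))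

open MeasureTheory in
/-- A smooth function has locally a smooth primitive in the last variable. -/
theorem exists_smooth_primitive {V : Type*} [NormedAddCommGroup V] [NormedSpace ℝ V]
    [FiniteDimensional ℝ V] {f : V × ℝ → ℝ} {Ω : Set (V × ℝ)}
    (hf : ContDiffOn ℝ ∞ f Ω) {p : V × ℝ} (hΩ : Ω ∈ 𝓝 p) : ∃ F : V × ℝ → ℝ, ContDiff ℝ ∞ F ∧
      ∀ᶠ y in 𝓝 p, fderiv ℝ F y (0, 1) = f y := by
  have hΩ' : interior Ω ∈ 𝓝 p := interior_mem_nhds.2 hΩ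
  obtain ⟨r, hr, hrΩ⟩ := Metric.mem_nhds_iff.1 hΩ'
  let χ : ContDiffBump p := ⟨r / 4, r / 2, by positivity, by linarith⟩
  let k : V × ℝ → ℝ := fun y => χ y * f y
  have hk0 : ∀ y, y ∉ Metric.closedBall p (r / 2) → k y = 0 := by
    intro y hy
    have : χ y = 0 := χ.zero_of_le_dist (not_le.1 hy).le
    simp [k, this]
  have hk : ContDiff ℝ ∞ k := by
    rw [contDiff_iff_contDiffAt]
    intro y
    by_cases hy : y ∈ Metric.closedBall p (r / 2)
    · have h1 : y ∈ interior Ω := hrΩ (Metric.closedBall_subset_ball (by linarith) hy)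
      exact χ.contDiff.contDiffAt.mul (hf.contDiffAt (mem_interior_iff_mem_nhds.1 h1))
    · have h1 : k =ᶠ[𝓝 y] fun _ => 0 := by
        filter_upwards [Metric.isClosed_closedBall.isOpen_compl.mem_nhds hy] with z hz using hk0 z hz
      exact contDiffAt_const.congr_of_eventuallyEq h1
  -- Convolution with the Heaviside function integrates from `-∞`, and smoothness in the parameter
  -- comes from the theory of convolutions. The cut-off `χ` provides the compact support.
  let H : ℝ → ℝ := indicator (Ici 0) fun _ => 1
  have hH : LocallyIntegrable H volume :=
    (locallyIntegrable_const (1 : ℝ)).indicator measurableSet_Ici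
  let F : V × ℝ → ℝ := fun y =>
    (convolution H (fun u => k (y.1, u)) (ContinuousLinearMap.mul ℝ ℝ) volume) y.2
  have hcpt : ∀ (a : V) (u : ℝ), u ∉ Metric.closedBall p.2 (r / 2) → k (a, u) = 0 := by
    intro a u hu
    refine hk0 _ fun h => hu ?_
    rw [← Prod.mk.eta (p := p), ← closedBall_prod_same] at h
    exact h.2
  have hF : ContDiff ℝ ∞ F := by
    have := contDiffOn_convolution_right_with_param (n := ⊤) (μ := volume) (f := H)
      (g := fun (a : V) (u : ℝ) => k (a, u)) (ContinuousLinearMap.mul ℝ ℝ) isOpen_univ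
      (isCompact_closedBall p.2 (r / 2)) (fun a u _ hu => hcpt a u hu) hH
      (by exact hk.contDiffOn)
    rw [univ_prod_univ, contDiffOn_univ] at this
    exact this
  have hFd : ∀ y, fderiv ℝ F y (0, 1) = k y := by
    rintro ⟨a, s⟩
    have hkc : Continuous fun u => k (a, u) := hk.continuous.comp (by fun_prop)
    have hki : Integrable (fun u => k (a, u)) volume :=
      hkc.integrable_of_hasCompactSupport
        (HasCompactSupport.intro (isCompact_closedBall p.2 (r / 2)) (hcpt a))
    have h1 : ∀ s, F (a, s) = ∫ u in Iic s, k (a, u) := by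
      intro s
      have h2 : F (a, s) = ∫ t, H t * k (a, s - t) := rfl
      rw [h2, ← integral_sub_left_eq_self _ volume s, ← integral_indicator measurableSet_Iic]
      refine integral_congr_ae (Filter.Eventually.of_forall fun u => ?_)
      by_cases hu : u ≤ s
      · simp [H, indicator, hu]
      · simp [H, indicator, hu]
    have h2 : HasDerivAt (fun s => F (a, s)) (k (a, s)) s := by
      have h3 : ∀ s', F (a, s') = F (a, s) + ∫ u in s..s', k (a, u) := by
        intro s'
        rw [h1, h1, ← intervalIntegral.integral_Iic_sub_Iic hki.integrableOn hki.integrableOn]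
        ring
      have h4 : HasDerivAt (fun s' => F (a, s) + ∫ u in s..s', k (a, u)) (k (a, s)) s :=
        (intervalIntegral.integral_hasDerivAt_right (hkc.intervalIntegrable _ _)
          (hkc.stronglyMeasurableAtFilter _ _) hkc.continuousAt).const_add _
      exact h4.congr_of_eventuallyEq (Filter.Eventually.of_forall h3)
    have h3 : HasDerivAt (fun s : ℝ => ((a, s) : V × ℝ)) (0, 1) s :=
      (hasDerivAt_const s a).prodMk (hasDerivAt_id s)
    have h4 := HasFDerivAt.comp_hasDerivAt (l := F) (f := fun s : ℝ => ((a, s) : V × ℝ)) s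
      ((hF.contDiffAt).differentiableAt (by simp)).hasFDerivAt h3
    exact h4.unique h2
  refine ⟨F, hF, ?_⟩
  filter_upwards [Metric.ball_mem_nhds p (show 0 < r / 4 by positivity)] with y hy
  have : χ y = 1 := χ.one_of_mem_closedBall (Metric.ball_subset_closedBall hy)
  simp [hFd, k, this]

section PullMetric

variable {n : ℕ} {M : Type u} [TopologicalSpace M]
  [ChartedSpace (Euc n) M] [IsManifold (𝓡 n) ∞ M]
  {E' E'' : Type*} [NormedAddCommGroup E'] [NormedSpace ℝ E'] [NormedAddCommGroup E'']
  [NormedSpace ℝ E'']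

theorem pullMetric_comp (g : SmoothMetric n M) {ψ : E' → M} {ψ' : E'' → M} {τ : E' → E''} {y : E'}
    (h : ψ =ᶠ[𝓝 y] ψ' ∘ τ) (hτ : DifferentiableAt ℝ τ y)
    (hψ' : MDifferentiableAt 𝓘(ℝ, E'') (𝓡 n) ψ' (τ y)) (v w : E') :
    pullMetric g ψ y v w = pullMetric g ψ' (τ y) (fderiv ℝ τ y v) (fderiv ℝ τ y w) := by
  have h1 : (mfderiv 𝓘(ℝ, E') (𝓡 n) ψ y : E' →L[ℝ] Euc n) =
      (mfderiv 𝓘(ℝ, E'') (𝓡 n) ψ' (τ y) : E'' →L[ℝ] Euc n).comp (fderiv ℝ τ y) := by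
    rw [h.mfderiv_eq]
    have h3 := mfderiv_comp y hψ' hτ.mdifferentiableAt
    rw [mfderiv_eq_fderiv] at h3
    exact h3
  have h2 : ∀ (x x' : M) (a b : Euc n), x = x' → (g.inner x : Euc n →L[ℝ] Euc n →L[ℝ] ℝ) a b =
      (g.inner x' : Euc n →L[ℝ] Euc n →L[ℝ] ℝ) a b := by
    rintro x _ a b rfl
    rfl
  simp only [pullMetric, h1]
  exact h2 _ _ _ _ h.eq_of_nhds

end PullMetric

/-! ### Flow boxes adapted to arc length -/

namespace HaefligerCocycle

variable {q : ℕ} {M : Type u} [TopologicalSpace M]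
  [ChartedSpace (Euc (q + 1)) M] [IsManifold (𝓡 (q + 1)) ∞ M]

/-- The squared length of the last coordinate vector field of a flow box, for the metric
`g + dρ ⊗ dρ`. -/
def boxDensity (g : SmoothMetric (q + 1) M) (ρ : M → ℝ)
    (B : OpenPartialHomeomorph M (Euc q × ℝ)) (y : Euc q × ℝ) : ℝ :=
  pullMetric g B.symm y (0, 1) (0, 1) + (fderiv ℝ (fun z => ρ (B.symm z)) y (0, 1)) ^ 2

/-- A flow box onto a ball whose last coordinate vector field has length one. -/
structure IsUnitBox (c : HaefligerCocycle.{w} (q + 1) q M) (g : SmoothMetric (q + 1) M)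
    (ρ : M → ℝ) (i : c.ι) (B : OpenPartialHomeomorph M (Euc q × ℝ)) : Prop extends
    c.IsBox i B where
  exists_ball : ∃ y r, B.target = Metric.ball y r
  density_eq : ∀ y ∈ B.target, boxDensity g ρ B y = 1

variable {c : HaefligerCocycle.{w} (q + 1) q M} {g : SmoothMetric (q + 1) M} {ρ : M → ℝ}
  {i j : c.ι} {B B' : OpenPartialHomeomorph M (Euc q × ℝ)}

theorem IsBox.contDiffOn_comp_symm (hB : c.IsBox i B)
    (hρ : ContMDiff (𝓡 (q + 1)) 𝓘(ℝ, ℝ) ∞ ρ) :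
    ContDiffOn ℝ ∞ (fun z => ρ (B.symm z)) B.target := by
  rw [← contMDiffOn_iff_contDiffOn]
  exact hρ.comp_contMDiffOn hB.contMDiffOn_symm

theorem IsBox.contDiffOn_boxDensity (hB : c.IsBox i B) (g : SmoothMetric (q + 1) M)
    (hρ : ContMDiff (𝓡 (q + 1)) 𝓘(ℝ, ℝ) ∞ ρ) : ContDiffOn ℝ ∞ (boxDensity g ρ B) B.target := by
  have h1 := contDiffOn_pullMetric g B.open_target hB.contMDiffOn_symm
  have h2 : ContDiffOn ℝ ∞ (fun y => pullMetric g B.symm y (0, 1) (0, 1)) B.target :=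
    (h1.clm_apply contDiffOn_const).clm_apply contDiffOn_const
  have h3 := (hB.contDiffOn_comp_symm hρ).fderiv_of_isOpen (m := ∞) B.open_target (by simp)
  exact h2.add ((h3.clm_apply contDiffOn_const).pow 2)

theorem IsBox.boxDensity_pos (hB : c.IsBox i B) (g : SmoothMetric (q + 1) M) (ρ : M → ℝ)
    {y : Euc q × ℝ} (hy : y ∈ B.target) : 0 < boxDensity g ρ B y :=
  add_pos_of_pos_of_nonneg (hB.pullMetric_pos g hy) (sq_nonneg _)

/-- The change of coordinates between flow boxes. -/
theorem IsBox.contDiffOn_transition (hB : c.IsBox i B) (hB' : c.IsBox j B') :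
    ContDiffOn ℝ ∞ (fun y => B' (B.symm y)) (B.target ∩ B.symm ⁻¹' B'.source) := by
  rw [← contMDiffOn_iff_contDiffOn]
  exact hB'.contMDiffOn.comp (hB.contMDiffOn_symm.mono inter_subset_left) fun y hy => hy.2

theorem IsBox.transition_fst (hB : c.IsBox i B) (hB' : c.IsBox j B') {y : Euc q × ℝ}
    (hy : y ∈ B.target ∩ B.symm ⁻¹' B'.source) : (B' (B.symm y)).1 = c.γ j i y.1 := by
  have h1 := B.map_target hy.1
  rw [hB'.fst_eq _ hy.2, c.π_eq j i _ ⟨hB'.subset hy.2, hB.subset h1⟩, ← hB.fst_eq _ h1,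
    B.right_inv hy.1]

/-- The density transforms by the square of the derivative of the change of coordinates. -/
theorem IsBox.fderiv_transition (hB : c.IsBox i B) (hB' : c.IsBox j B')
    (hρ : ContMDiff (𝓡 (q + 1)) 𝓘(ℝ, ℝ) ∞ ρ) {y : Euc q × ℝ}
    (hy : y ∈ B.target ∩ B.symm ⁻¹' B'.source) :
    (fderiv ℝ (fun z => B' (B.symm z)) y (0, 1)).1 = 0 ∧
      boxDensity g ρ B y = (fderiv ℝ (fun z => B' (B.symm z)) y (0, 1)).2 ^ 2 *
        boxDensity g ρ B' (B' (B.symm y)) := by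
  have hΩ : IsOpen (B.target ∩ B.symm ⁻¹' B'.source) := B.isOpen_inter_preimage_symm B'.open_source
  have hd : DifferentiableAt ℝ (fun z => B' (B.symm z)) y :=
    ((hB.contDiffOn_transition hB').contDiffAt (hΩ.mem_nhds hy)).differentiableAt (by simp)
  have h1 : (fderiv ℝ (fun z => B' (B.symm z)) y (0, 1)).1 = 0 := by
    have h2 : HasDerivAt (fun s : ℝ => y + s • ((0, 1) : Euc q × ℝ)) (0, 1) 0 := by
      simpa using ((hasDerivAt_id (0 : ℝ)).smul_const ((0, 1) : Euc q × ℝ)).const_add y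
    have h3 : HasFDerivAt (fun z => B' (B.symm z)) (fderiv ℝ (fun z => B' (B.symm z)) y)
        (y + (0 : ℝ) • ((0, 1) : Euc q × ℝ)) := by simpa using hd.hasFDerivAt
    have h4 := (HasFDerivAt.comp_hasDerivAt (l := fun z => B' (B.symm z))
      (f := fun s : ℝ => y + s • ((0, 1) : Euc q × ℝ)) 0 h3 h2).fst_comp
    have h5 : (fun s : ℝ => (((fun z => B' (B.symm z)) ∘ fun s : ℝ =>
        y + s • ((0, 1) : Euc q × ℝ)) s).1) =ᶠ[𝓝 0] fun _ => c.γ j i y.1 := by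
      have h6 : ∀ᶠ s : ℝ in 𝓝 0, y + s • ((0, 1) : Euc q × ℝ) ∈ B.target ∩ B.symm ⁻¹' B'.source :=
        h2.continuousAt.preimage_mem_nhds (hΩ.mem_nhds (by simpa using hy))
      filter_upwards [h6] with s hs
      simp only [Function.comp, hB.transition_fst hB' hs]
      simp
    exact (h4.congr_of_eventuallyEq h5.symm).unique (hasDerivAt_const 0 _)
  refine ⟨h1, ?_⟩
  have h2 : fderiv ℝ (fun z => B' (B.symm z)) y (0, 1) =
      (fderiv ℝ (fun z => B' (B.symm z)) y (0, 1)).2 • ((0, 1) : Euc q × ℝ) := by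
    ext1 <;> simp [h1]
  have h3 : (B.symm : Euc q × ℝ → M) =ᶠ[𝓝 y] B'.symm ∘ fun z => B' (B.symm z) := by
    filter_upwards [hΩ.mem_nhds hy] with z hz using (B'.left_inv hz.2).symm
  have hy' : B' (B.symm y) ∈ B'.target := B'.map_source hy.2
  have h4 : (fun z => ρ (B.symm z)) =ᶠ[𝓝 y]
      (fun z => ρ (B'.symm z)) ∘ fun z => B' (B.symm z) := by
    filter_upwards [h3] with z hz
    simp only [Function.comp] at hz ⊢
    rw [← hz]
  have h5 : fderiv ℝ (fun z => ρ (B.symm z)) y (0, 1) =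
      fderiv ℝ (fun z => ρ (B'.symm z)) (B' (B.symm y))
        (fderiv ℝ (fun z => B' (B.symm z)) y (0, 1)) := by
    rw [h4.fderiv_eq, fderiv_comp y (((hB'.contDiffOn_comp_symm hρ).contDiffAt
      (B'.open_target.mem_nhds hy')).differentiableAt (by simp)) hd]
    rfl
  rw [boxDensity, h5, pullMetric_comp g h3 hd
    ((hB'.contMDiffAt_symm hy').mdifferentiableAt (by simp)), h2]
  simp only [map_smul, smul_apply, smul_eq_mul, boxDensity]
  simp
  ring

/-- Two unit flow boxes differ by a translation and possibly a reflection along the leaves. -/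
theorem IsUnitBox.exists_sign (hB : c.IsUnitBox g ρ i B) (hB' : c.IsUnitBox g ρ j B')
    (hρ : ContMDiff (𝓡 (q + 1)) 𝓘(ℝ, ℝ) ∞ ρ) {x : M} (hx : x ∈ B.source) (hx' : x ∈ B'.source) :
    ∃ ε : ℝ, (ε = 1 ∨ ε = -1) ∧ ∃ r > 0, ∀ y ∈ Metric.ball (B x) r, ∀ y' ∈ Metric.ball (B x) r,
      y ∈ B.target ∧ B.symm y ∈ B'.source ∧
      (y.1 = y'.1 → B' (B.symm y') = B' (B.symm y) + (0, ε * (y'.2 - y.2))) := by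
  have hΩ : IsOpen (B.target ∩ B.symm ⁻¹' B'.source) := B.isOpen_inter_preimage_symm B'.open_source
  have hxΩ : B x ∈ B.target ∩ B.symm ⁻¹' B'.source :=
    ⟨B.map_source hx, by simpa [B.left_inv hx] using hx'⟩
  obtain ⟨r, hr, hrΩ⟩ := Metric.isOpen_iff.1 hΩ _ hxΩ
  let d : Euc q × ℝ → ℝ := fun y => (fderiv ℝ (fun z => B' (B.symm z)) y (0, 1)).2
  have hC := hB.toIsBox.contDiffOn_transition hB'.toIsBox
  have hdc : ContinuousOn d (Metric.ball (B x) r) := by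
    have h1 := (hC.continuousOn_fderiv_of_isOpen hΩ (by simp)).mono hrΩ
    exact (h1.clm_apply continuousOn_const).snd
  -- Both densities are one, so the transformation rule gives `d y ^ 2 = 1`; by continuity the sign
  -- is constant on the ball.
  have hd1 : ∀ y ∈ Metric.ball (B x) r, d y = 1 ∨ d y = -1 := by
    intro y hy
    have h1 := (hB.toIsBox.fderiv_transition (g := g) hB'.toIsBox hρ (hrΩ hy)).2
    rw [hB.density_eq _ (hrΩ hy).1, hB'.density_eq _ (B'.map_source (hrΩ hy).2), mul_one] at h1
    have h2 : (d y - 1) * (d y + 1) = 0 := by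
      have : d y ^ 2 = 1 := h1.symm
      linarith
    rcases mul_eq_zero.1 h2 with h3 | h3
    · left; linarith
    · right; linarith
  have hconst : ∀ y ∈ Metric.ball (B x) r, d y = d (B x) := by
    have hpre : IsPreconnected (Metric.ball (B x) r) := (convex_ball _ _).isPreconnected
    refine hpre.forall_of_eventually_iff (P := fun y => d y = d (B x)) (fun y hy => ?_)
      (Metric.mem_ball_self hr) rfl
    have h1 : ∀ᶠ z in 𝓝[Metric.ball (B x) r] y, |d z - d y| < 1 :=
      ((hdc y hy).sub continuousWithinAt_const).abs.eventually_lt_const (by simp [d])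
    filter_upwards [h1, self_mem_nhdsWithin] with z hz hzb
    have h2 : d z = d y := by
      rcases hd1 z hzb with e | e <;> rcases hd1 y hy with e' | e' <;> rw [e, e'] at hz ⊢ <;>
        norm_num at hz
    rw [h2]
  refine ⟨d (B x), hd1 _ (Metric.mem_ball_self hr), r, hr, fun y hy y' hy' =>
    ⟨(hrΩ hy).1, (hrΩ hy).2, fun he => ?_⟩⟩
  have hdv : ∀ s ∈ uIcc y.2 y'.2, HasDerivWithinAt (fun s => B' (B.symm (y.1, s)) -
      (0, d (B x) * s)) 0 (uIcc y.2 y'.2) s := by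
    intro s hs
    have hmem : (y.1, s) ∈ Metric.ball (B x) r := by
      rw [← Prod.mk.eta (p := B x), ← ball_prod_same] at hy hy' ⊢
      exact ⟨hy.1, (convex_ball (B x).2 r).ordConnected.uIcc_subset hy.2 hy'.2 hs⟩
    have h2 : HasDerivAt (fun s : ℝ => ((y.1, s) : Euc q × ℝ)) (0, 1) s :=
      (hasDerivAt_const s y.1).prodMk (hasDerivAt_id s)
    have h3 := HasFDerivAt.comp_hasDerivAt (l := fun z => B' (B.symm z))
      (f := fun s : ℝ => ((y.1, s) : Euc q × ℝ)) s
      ((hC.contDiffAt (hΩ.mem_nhds (hrΩ hmem))).differentiableAt (by simp)).hasFDerivAt h2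
    have h4 : fderiv ℝ (fun z => B' (B.symm z)) (y.1, s) (0, 1) = (0, d (B x)) := by
      ext1
      · exact (hB.toIsBox.fderiv_transition (g := g) hB'.toIsBox hρ (hrΩ hmem)).1
      · exact hconst _ hmem
    rw [h4] at h3
    have h5 : HasDerivAt (fun s : ℝ => ((0, d (B x) * s) : Euc q × ℝ)) (0, d (B x)) s :=
      (hasDerivAt_const s _).prodMk (by simpa using (hasDerivAt_id s).const_mul (d (B x)))
    have h6 := h3.sub h5
    rw [sub_self] at h6
    exact h6.hasDerivWithinAt
  have := (convex_uIcc y.2 y'.2).norm_image_sub_le_of_norm_hasDerivWithin_le (C := 0) hdv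
    (fun s _ => by simp) left_mem_uIcc right_mem_uIcc
  rw [zero_mul, norm_le_zero_iff, sub_eq_zero] at this
  have e1 : ((y.1, y'.2) : Euc q × ℝ) = y' := by rw [he]
  rw [e1] at this
  rw [sub_eq_iff_eq_add.1 this]
  ext1
  · simp
  · simp; ring

/-- The last coordinate of a flow box is replaced by a primitive, along the leaves, of the square
root of the density. As the density transforms by the square of a derivative, it becomes one. The
target is cut down to a ball so that its coordinate lines are intervals. -/
theorem exists_isUnitBox (hρ : ContMDiff (𝓡 (q + 1)) 𝓘(ℝ, ℝ) ∞ ρ) (g : SmoothMetric (q + 1) M)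
    {x : M} (hx : x ∈ c.U i) : ∃ B, c.IsUnitBox g ρ i B ∧ x ∈ B.source := by
  obtain ⟨B, hB, hxB⟩ := exists_isBox hx
  have hf : ContDiffOn ℝ ∞ (fun y => √(boxDensity g ρ B y)) B.target :=
    (hB.contDiffOn_boxDensity g hρ).sqrt fun y hy => (hB.boxDensity_pos g ρ hy).ne'
  obtain ⟨F, hF, hFd⟩ := exists_smooth_primitive hf (B.open_target.mem_nhds (B.map_source hxB))
  obtain ⟨Ω, hΩs, hΩ, hxΩ⟩ := mem_nhds_iff.1
    (hFd.and (B.open_target.mem_nhds (B.map_source hxB)))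
  have hfp : ∀ y ∈ Ω, 0 < fderiv ℝ F y (0, 1) := fun y hy => by
    rw [(hΩs hy).1]
    exact Real.sqrt_pos.2 (hB.boxDensity_pos g ρ (hΩs hy).2)
  let L : Euc q × ℝ →L[ℝ] Euc q × ℝ := (ContinuousLinearMap.fst ℝ (Euc q) ℝ).prod
    (fderiv ℝ F (B x))
  have hLinj : Function.Injective L.toLinearMap := by
    rw [← LinearMap.ker_eq_bot, LinearMap.ker_eq_bot']
    rintro ⟨v, s⟩ hv
    have hv' : (v, fderiv ℝ F (B x) (v, s)) = ((0, 0) : Euc q × ℝ) := hv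
    rw [Prod.mk.injEq] at hv'
    obtain ⟨rfl, h2⟩ := hv'
    have h3 : ((0, s) : Euc q × ℝ) = s • (0, 1) := by simp
    rw [h3, map_smul, smul_eq_mul, mul_eq_zero] at h2
    rcases h2 with rfl | h2
    · rfl
    · exact absurd h2 (hfp _ hxΩ).ne'
  let eL : (Euc q × ℝ) ≃L[ℝ] Euc q × ℝ :=
    (LinearEquiv.ofInjectiveEndo L.toLinearMap hLinj).toContinuousLinearEquiv
  have hΘ : ContDiffOn ℝ ∞ (fun y : Euc q × ℝ => (y.1, F y)) Ω :=
    (contDiff_fst.prodMk hF).contDiffOn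
  have hFa : ∀ y, HasFDerivAt (fun y : Euc q × ℝ => (y.1, F y))
      ((ContinuousLinearMap.fst ℝ (Euc q) ℝ).prod (fderiv ℝ F y)) y := fun y =>
    hasFDerivAt_fst.prodMk ((hF.contDiffAt.differentiableAt (by simp)).hasFDerivAt)
  have hΘd : HasFDerivAt (fun y : Euc q × ℝ => (y.1, F y))
      (eL : Euc q × ℝ →L[ℝ] Euc q × ℝ) (B x) := by
    have : (eL : Euc q × ℝ →L[ℝ] Euc q × ℝ) = L := ContinuousLinearMap.ext fun v => rfl
    rw [this]
    exact hFa _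
  obtain ⟨T, haT, hTΩ, hTeq, hTs⟩ := hΘ.exists_openPartialHomeomorph hΩ hxΩ hΘd
  obtain ⟨r, hr, hrT⟩ := Metric.isOpen_iff.1 T.open_target _ (T.map_source haT)
  let T₁ : OpenPartialHomeomorph (Euc q × ℝ) (Euc q × ℝ) :=
    (T.symm.restrOpen (Metric.ball (T (B x)) r) Metric.isOpen_ball).symm
  have hT₁t : T₁.target = Metric.ball (T (B x)) r := by
    change (T.symm.restrOpen _ Metric.isOpen_ball).source = _
    rw [OpenPartialHomeomorph.restrOpen_source]
    exact inter_eq_right.2 hrT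
  have hT₁s : T₁.source ⊆ T.source := by
    intro y hy
    have h1 := T₁.map_source hy
    rw [hT₁t] at h1
    rw [← T₁.left_inv hy]
    exact T.map_target (hrT h1)
  have hxT₁ : B x ∈ T₁.source := by
    have h1 : T (B x) ∈ T₁.target := by
      rw [hT₁t]
      exact Metric.mem_ball_self hr
    have h2 := T₁.map_target h1
    have h3 : T₁.symm (T (B x)) = B x := T.left_inv haT
    rwa [h3] at h2
  have hTc : ContDiffOn ℝ ∞ T₁ T₁.source := (hΘ.mono (hT₁s.trans hTΩ)).congr fun y _ => hTeq y
  have hTcs : ContDiffOn ℝ ∞ T₁.symm T₁.target := hTs.mono fun y hy => by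
    rw [hT₁t] at hy
    exact hrT hy
  have hB' : c.IsBox i (B.trans T₁) := by
    refine ⟨?_, ?_, fun y hy => hB.subset hy.1, fun y hy => ?_⟩
    · exact (contMDiffOn_iff_contDiffOn.2 hTc).comp (hB.contMDiffOn.mono fun y hy => hy.1)
        fun y hy => hy.2
    · exact hB.contMDiffOn_symm.comp ((contMDiffOn_iff_contDiffOn.2 hTcs).mono fun y hy => hy.1)
        fun y hy => hy.2
    · have h1 : T₁ (B y) = ((B y).1, F (B y)) := hTeq (B y)
      rw [← hB.fst_eq y hy.1]
      change (T₁ (B y)).1 = _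
      rw [h1]
  have htgt : (B.trans T₁).target = Metric.ball (T (B x)) r := by
    rw [OpenPartialHomeomorph.trans_target, ← hT₁t]
    exact inter_eq_left.2 fun y hy => (hΩs (hTΩ (hT₁s (T₁.map_target hy)))).2
  refine ⟨B.trans T₁, ⟨hB', ⟨_, _, htgt⟩, fun y hy => ?_⟩, ⟨hxB, hxT₁⟩⟩
  set z := T₁.symm y with hz
  have hyT : y ∈ T₁.target := hy.1
  have hzs : z ∈ T₁.source := T₁.map_target hyT
  have hzΩ : z ∈ Ω := hTΩ (hT₁s hzs)
  have hzB : z ∈ B.target := (hΩs hzΩ).2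
  have hzm : z ∈ B.target ∩ B.symm ⁻¹' (B.trans T₁).source :=
    ⟨hzB, B.map_target hzB, by
      change B (B.symm z) ∈ T₁.source
      rwa [B.right_inv hzB]⟩
  have h1 := (hB.fderiv_transition (g := g) hB' hρ hzm).2
  have h2 : (fun z => (B.trans T₁) (B.symm z)) =ᶠ[𝓝 z] fun y : Euc q × ℝ => (y.1, F y) := by
    filter_upwards [B.open_target.mem_nhds hzB] with z' hz'
    have : T₁ (B (B.symm z')) = _ := hTeq _
    simp only [OpenPartialHomeomorph.coe_trans, Function.comp]
    rw [this, B.right_inv hz']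
  have h3 : (B.trans T₁) (B.symm z) = y := by
    simp only [OpenPartialHomeomorph.coe_trans, Function.comp, B.right_inv hzB]
    exact T₁.right_inv hyT
  have h4 : (fderiv ℝ F z (0, 1)) ^ 2 = boxDensity g ρ B z := by
    rw [(hΩs hzΩ).1, Real.sq_sqrt (hB.boxDensity_pos g ρ hzB).le]
  rw [h2.fderiv_eq, (hFa z).fderiv, h3] at h1
  have h5 : boxDensity g ρ B z = boxDensity g ρ B z * boxDensity g ρ (B.trans T₁) y := by
    conv_lhs => rw [h1]
    rw [← h4]
    rfl
  have h6 := hB.boxDensity_pos g ρ hzB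
  exact mul_left_cancel₀ h6.ne' (by rw [← h5, mul_one])

end HaefligerCocycle

/-! ### Leaf curves parametrized by arc length -/

namespace HaefligerCocycle

section HasDir

variable {q : ℕ} {M : Type u} [TopologicalSpace M]
  {B B' : OpenPartialHomeomorph M (Euc q × ℝ)} {ℓ ℓ' : ℝ → M} {t t₀ ε ε' : ℝ}

/-- Near `t`, the curve `ℓ` runs through the last coordinate of the flow box `B` with velocity
`ε = ±1`. -/
structure HasDir (B : OpenPartialHomeomorph M (Euc q × ℝ)) (ℓ : ℝ → M) (t ε : ℝ) : Prop where
  sign : ε = 1 ∨ ε = -1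
  mem : ℓ t ∈ B.source
  eventually : ∀ᶠ s in 𝓝 t, ℓ s = B.symm (B (ℓ t) + (0, ε * (s - t)))

theorem HasDir.sq (H : HasDir B ℓ t ε) : ε * ε = 1 := by
  rcases H.sign with rfl | rfl <;> norm_num

theorem HasDir.tendsto (_H : HasDir B ℓ t ε) :
    Filter.Tendsto (fun s => B (ℓ t) + (0, ε * (s - t))) (𝓝 t) (𝓝 (B (ℓ t))) := by
  have : Continuous fun s => B (ℓ t) + ((0, ε * (s - t)) : Euc q × ℝ) := by fun_prop
  simpa [Prod.mk_zero_zero] using this.tendsto t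

theorem HasDir.eventually_eq (H : HasDir B ℓ t ε) :
    ∀ᶠ s in 𝓝 t, ℓ s ∈ B.source ∧ B (ℓ s) = B (ℓ t) + (0, ε * (s - t)) := by
  filter_upwards [H.eventually, H.tendsto.eventually (B.open_target.mem_nhds (B.map_source H.mem))]
    with s h1 h2
  exact ⟨h1 ▸ B.map_target h2, by rw [h1, B.right_inv h2]⟩

theorem HasDir.continuousAt (H : HasDir B ℓ t ε) : ContinuousAt ℓ t := by
  have h1 := (B.continuousAt_symm (B.map_source H.mem)).tendsto.comp H.tendsto
  rw [B.left_inv H.mem] at h1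
  exact h1.congr' (H.eventually.mono fun s hs => hs.symm)

theorem HasDir.of_eventually_eq (hε : ε = 1 ∨ ε = -1) (hm : ℓ t ∈ B.source)
    (h : ∀ᶠ s in 𝓝 t, ℓ s ∈ B.source ∧ B (ℓ s) = B (ℓ t) + (0, ε * (s - t))) :
    HasDir B ℓ t ε :=
  ⟨hε, hm, h.mono fun s hs => by rw [← hs.2, B.left_inv hs.1]⟩

theorem HasDir.congr (H : HasDir B ℓ t ε) (h : ℓ =ᶠ[𝓝 t] ℓ') : HasDir B ℓ' t ε := by
  refine ⟨H.sign, by rw [← h.eq_of_nhds]; exact H.mem, ?_⟩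
  rw [← h.eq_of_nhds]
  filter_upwards [H.eventually, h] with s h1 h2 using by rw [← h2, h1]

theorem HasDir.unique (H : HasDir B ℓ t ε) (H' : HasDir B ℓ t ε') : ε = ε' := by
  obtain ⟨δ, hδ, hb⟩ := Metric.eventually_nhds_iff_ball.1 (H.eventually_eq.and H'.eventually_eq)
  obtain ⟨⟨-, h1⟩, -, h2⟩ := hb (t + δ / 2) (by
    rw [Metric.mem_ball, Real.dist_eq, add_sub_cancel_left, abs_of_pos] <;> linarith)
  rw [h1] at h2
  have h3 := congrArg Prod.snd (add_left_cancel h2)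
  simp only [add_sub_cancel_left] at h3
  exact mul_right_cancel₀ (by positivity) h3

theorem HasDir.eventually_hasDir (H : HasDir B ℓ t ε) : ∀ᶠ s in 𝓝 t, HasDir B ℓ s ε := by
  filter_upwards [H.eventually_eq.eventually_nhds] with s hs
  refine HasDir.of_eventually_eq H.sign hs.self_of_nhds.1 ?_
  filter_upwards [hs] with r hr
  refine ⟨hr.1, ?_⟩
  rw [hr.2, hs.self_of_nhds.2, add_assoc]
  congr 1
  ext1
  · simp
  · simp; ring

theorem HasDir.comp_affine {a b : ℝ} (ha : a = 1 ∨ a = -1) (H : HasDir B ℓ (a * t + b) ε) :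
    HasDir B (fun s => ℓ (a * s + b)) t (a * ε) := by
  refine ⟨?_, H.mem, ?_⟩
  · rcases ha with rfl | rfl <;> rcases H.sign with rfl | rfl <;> norm_num
  · have h1 : Filter.Tendsto (fun s => a * s + b) (𝓝 t) (𝓝 (a * t + b)) := by
      have : Continuous fun s => a * s + b := by fun_prop
      exact this.tendsto t
    filter_upwards [h1.eventually H.eventually] with s hs
    rw [hs]
    congr 3
    ring

end HasDir

variable {q : ℕ} {M : Type u} [TopologicalSpace M]
  [ChartedSpace (Euc (q + 1)) M] [IsManifold (𝓡 (q + 1)) ∞ M]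
  {c : HaefligerCocycle.{w} (q + 1) q M} {g : SmoothMetric (q + 1) M} {ρ : M → ℝ}
  {i j : c.ι} {B B' : OpenPartialHomeomorph M (Euc q × ℝ)} {ℓ ℓ' : ℝ → M} {J J' : Set ℝ}
  {t t₀ ε ε' : ℝ}

/-- A curve in a leaf that is parametrized by arc length. -/
structure IsUnitCurve (c : HaefligerCocycle.{w} (q + 1) q M) (g : SmoothMetric (q + 1) M)
    (ρ : M → ℝ) (ℓ : ℝ → M) (J : Set ℝ) : Prop where
  isOpen : IsOpen J
  ordConnected : J.OrdConnected
  exists_hasDir : ∀ t ∈ J, ∃ i B ε, c.IsUnitBox g ρ i B ∧ HasDir B ℓ t ε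

/-- Unit flow boxes see the same curves as unit speed curves. -/
theorem HasDir.exists_change (hρ : ContMDiff (𝓡 (q + 1)) 𝓘(ℝ, ℝ) ∞ ρ)
    (hB : c.IsUnitBox g ρ i B) (hB' : c.IsUnitBox g ρ j B') {x : M} (hx : x ∈ B.source)
    (hx' : x ∈ B'.source) : ∃ σ : ℝ, (σ = 1 ∨ σ = -1) ∧ ∀ᶠ y in 𝓝 x, ∀ (ℓ : ℝ → M) (t ε : ℝ),
      ℓ t = y → HasDir B ℓ t ε → HasDir B' ℓ t (σ * ε) := by
  obtain ⟨σ, hσ, r, hr, hball⟩ := hB.exists_sign hB' hρ hx hx'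
  refine ⟨σ, hσ, ?_⟩
  have h1 : ∀ᶠ y in 𝓝 x, B y ∈ Metric.ball (B x) r :=
    (B.continuousAt hx).preimage_mem_nhds (Metric.ball_mem_nhds _ hr)
  filter_upwards [h1] with y hy ℓ t ε hℓ H
  subst hℓ
  have hs : σ * ε = 1 ∨ σ * ε = -1 := by
    rcases hσ with rfl | rfl <;> rcases H.sign with rfl | rfl <;> norm_num
  have hm : ∀ y ∈ B.source, B y ∈ Metric.ball (B x) r → y ∈ B'.source := by
    intro z hz hzr
    have := (hball _ hzr _ hzr).2.1
    rwa [B.left_inv hz] at this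
  refine HasDir.of_eventually_eq hs (hm _ H.mem hy) ?_
  filter_upwards [H.eventually_eq, H.tendsto.eventually (Metric.isOpen_ball.mem_nhds hy)]
    with s h2 h3
  rw [← h2.2] at h3
  refine ⟨hm _ h2.1 h3, ?_⟩
  have h4 := (hball _ hy _ h3).2.2 (by rw [h2.2]; simp)
  rw [B.left_inv h2.1, B.left_inv H.mem] at h4
  rw [h4, h2.2]
  simp [mul_assoc]

theorem IsUnitCurve.hasDir (hρ : ContMDiff (𝓡 (q + 1)) 𝓘(ℝ, ℝ) ∞ ρ)
    (hℓ : c.IsUnitCurve g ρ ℓ J) (ht : t ∈ J) (hB : c.IsUnitBox g ρ i B) (hm : ℓ t ∈ B.source) :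
    ∃ ε, HasDir B ℓ t ε := by
  obtain ⟨j, B', ε, hB', hd⟩ := hℓ.exists_hasDir t ht
  obtain ⟨σ, -, h1⟩ := HasDir.exists_change hρ hB' hB hd.mem hm
  exact ⟨_, h1.self_of_nhds ℓ t ε rfl hd⟩

theorem IsUnitCurve.continuousAt (hℓ : c.IsUnitCurve g ρ ℓ J) (ht : t ∈ J) : ContinuousAt ℓ t :=
  let ⟨_, _, _, _, hd⟩ := hℓ.exists_hasDir t ht
  hd.continuousAt

theorem IsUnitCurve.isLeafCurveOn (hℓ : c.IsUnitCurve g ρ ℓ J) : c.IsLeafCurveOn ℓ J := by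
  refine ⟨fun t ht => (hℓ.continuousAt ht).continuousWithinAt, fun t ht i hi => ?_⟩
  obtain ⟨j, B, ε, hB, hd⟩ := hℓ.exists_hasDir t ht
  refine Filter.Eventually.filter_mono nhdsWithin_le_nhds ?_
  have h1 : ∀ᶠ s in 𝓝 t, ℓ s ∈ c.U i :=
    (hℓ.continuousAt ht).preimage_mem_nhds ((c.isOpen_U i).mem_nhds hi)
  filter_upwards [hd.eventually_eq, h1] with s hs hs'
  rw [c.π_eq i j _ ⟨hs', hB.subset hs.1⟩, c.π_eq i j _ ⟨hi, hB.subset hd.mem⟩,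
    ← hB.fst_eq _ hs.1, ← hB.fst_eq _ hd.mem, hs.2]
  simp

theorem IsUnitCurve.mono (hℓ : c.IsUnitCurve g ρ ℓ J) (hJ : IsOpen J') (hJ' : J'.OrdConnected)
    (hs : J' ⊆ J) : c.IsUnitCurve g ρ ℓ J' :=
  ⟨hJ, hJ', fun t ht => hℓ.exists_hasDir t (hs ht)⟩

/-- The continuity argument runs on germs, since curves of opposite directions may meet at a single
time. Where the values agree, equal signs give equal germs, and opposite signs give different germs
at all nearby times. -/
theorem IsUnitCurve.eqOn_of_eventuallyEq [T2Space M] (hρ : ContMDiff (𝓡 (q + 1)) 𝓘(ℝ, ℝ) ∞ ρ)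
    (hℓ : c.IsUnitCurve g ρ ℓ J) (hℓ' : c.IsUnitCurve g ρ ℓ' J) (ht₀ : t₀ ∈ J)
    (h0 : ℓ =ᶠ[𝓝 t₀] ℓ') : EqOn ℓ ℓ' J := by
  suffices h : ∀ t ∈ J, ℓ =ᶠ[𝓝 t] ℓ' from fun t ht => (h t ht).eq_of_nhds
  refine hℓ.ordConnected.isPreconnected.forall_of_eventually_iff (P := fun t => ℓ =ᶠ[𝓝 t] ℓ')
    (fun t ht => ?_) ht₀ h0
  rw [hℓ.isOpen.nhdsWithin_eq ht]
  by_cases he : ℓ t = ℓ' t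
  · obtain ⟨i, B, ε, hB, hd⟩ := hℓ.exists_hasDir t ht
    obtain ⟨ε', hd'⟩ := hℓ'.hasDir hρ ht hB (he ▸ hd.mem)
    by_cases hε : ε = ε'
    · have h1 : ℓ =ᶠ[𝓝 t] ℓ' := by
        filter_upwards [hd.eventually, hd'.eventually] with s h1 h2
        rw [h1, h2, he, hε]
      filter_upwards [h1.eventually_nhds] with s hs using ⟨fun _ => hs, fun _ => h1⟩
    · filter_upwards [hd.eventually_hasDir, hd'.eventually_hasDir] with s h1 h2
      refine ⟨fun h => absurd (hd.unique (hd'.congr (Filter.EventuallyEq.symm h))) hε,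
        fun h => absurd (h1.unique (h2.congr (Filter.EventuallyEq.symm h))) hε⟩
  · have h1 : ∀ᶠ s in 𝓝 t, ℓ s ≠ ℓ' s :=
      ((hℓ.continuousAt ht).prodMk (hℓ'.continuousAt ht)).preimage_mem_nhds
        (isClosed_diagonal.isOpen_compl.mem_nhds he)
    filter_upwards [h1] with s hs
    exact ⟨fun h => absurd (Filter.EventuallyEq.eq_of_nhds h) he,
      fun h => absurd (Filter.EventuallyEq.eq_of_nhds h) hs⟩

theorem IsUnitCurve.eqOn [T2Space M] (hρ : ContMDiff (𝓡 (q + 1)) 𝓘(ℝ, ℝ) ∞ ρ)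
    (hℓ : c.IsUnitCurve g ρ ℓ J) (hℓ' : c.IsUnitCurve g ρ ℓ' J) (ht₀ : t₀ ∈ J)
    (h0 : ℓ t₀ = ℓ' t₀) (hd : HasDir B ℓ t₀ ε) (hd' : HasDir B ℓ' t₀ ε) : EqOn ℓ ℓ' J := by
  refine hℓ.eqOn_of_eventuallyEq hρ hℓ' ht₀ ?_
  filter_upwards [hd.eventually, hd'.eventually] with s h1 h2
  rw [h1, h2, h0]

/-- The coordinate lines of a unit flow box. -/
theorem IsUnitBox.isUnitCurve (hB : c.IsUnitBox g ρ i B) (hε : ε = 1 ∨ ε = -1)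
    (y : Euc q × ℝ) (t₀ : ℝ) : c.IsUnitCurve g ρ (fun t => B.symm (y + (0, ε * (t - t₀))))
      {t | y + (0, ε * (t - t₀)) ∈ B.target} ∧ ∀ t, y + (0, ε * (t - t₀)) ∈ B.target →
      HasDir B (fun t => B.symm (y + (0, ε * (t - t₀)))) t ε := by
  have hd : ∀ t, y + (0, ε * (t - t₀)) ∈ B.target →
      HasDir B (fun t => B.symm (y + (0, ε * (t - t₀)))) t ε := by
    intro t ht
    refine ⟨hε, B.map_target ht, Filter.Eventually.of_forall fun s => ?_⟩
    simp only [B.right_inv ht]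
    congr 1
    ext1
    · simp
    · simp; ring
  have hc : Continuous fun t => y + ((0, ε * (t - t₀)) : Euc q × ℝ) := by fun_prop
  refine ⟨⟨B.open_target.preimage hc, ?_, fun t ht => ⟨i, B, ε, hB, hd t ht⟩⟩, hd⟩
  obtain ⟨y₀, r, hr⟩ := hB.exists_ball
  -- The target is a ball, so the parameters for which the coordinate line lies in it form an
  -- interval.
  have h1 : Convex ℝ ((fun t => y + ((0, ε * (t - t₀)) : Euc q × ℝ)) ⁻¹' B.target) := by
    rw [hr]
    intro a ha b hb s t hs ht hst
    have := convex_ball y₀ r ha hb hs ht hst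
    have e : y + ((0, ε * (s • a + t • b - t₀)) : Euc q × ℝ) =
        s • (y + ((0, ε * (a - t₀)) : Euc q × ℝ)) + t • (y + ((0, ε * (b - t₀)) : Euc q × ℝ)) := by
      have h2 : y = (s + t) • y := by rw [hst, one_smul]
      ext1
      · conv_lhs => rw [h2]
        simp [add_smul]
      · conv_lhs => rw [h2]
        have h3 : t₀ = (s + t) * t₀ := by rw [hst, one_mul]
        simp only [Prod.snd_add, Prod.smul_snd, smul_eq_mul]
        linear_combination (-ε) * h3
    rw [← e] at this
    exact this
  exact h1.ordConnected

/-- A unit curve follows a coordinate line as long as the latter stays in the flow box. -/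
theorem IsUnitCurve.eq_of_mem_target [T2Space M] (hρ : ContMDiff (𝓡 (q + 1)) 𝓘(ℝ, ℝ) ∞ ρ)
    (hℓ : c.IsUnitCurve g ρ ℓ J) (ht₀ : t₀ ∈ J) (hB : c.IsUnitBox g ρ i B)
    (hd : HasDir B ℓ t₀ ε) (ht : t ∈ J) (hm : B (ℓ t₀) + (0, ε * (t - t₀)) ∈ B.target) :
    ℓ t = B.symm (B (ℓ t₀) + (0, ε * (t - t₀))) ∧ HasDir B ℓ t ε := by
  obtain ⟨h1, h2⟩ := hB.isUnitCurve hd.sign (B (ℓ t₀)) t₀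
  have h0 : B (ℓ t₀) + (0, ε * (t₀ - t₀)) ∈ B.target := by
    simpa [Prod.mk_zero_zero] using B.map_source hd.mem
  have ho := hℓ.isOpen.inter h1.isOpen
  have hoc := hℓ.ordConnected.inter h1.ordConnected
  have h3 := (hℓ.mono ho hoc inter_subset_left).eqOn hρ (h1.mono ho hoc inter_subset_right)
    ⟨ht₀, h0⟩ (by simp [Prod.mk_zero_zero, B.left_inv hd.mem]) hd (h2 t₀ h0)
  exact ⟨h3 ⟨ht, hm⟩, (h2 t hm).congr (h3.eventuallyEq_of_mem (ho.mem_nhds ⟨ht, hm⟩)).symm⟩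

theorem IsUnitCurve.comp_affine {a b : ℝ} (ha : a = 1 ∨ a = -1)
    (hℓ : c.IsUnitCurve g ρ ℓ univ) : c.IsUnitCurve g ρ (fun t => ℓ (a * t + b)) univ :=
  ⟨isOpen_univ, ordConnected_univ, fun t _ =>
    let ⟨i, B, ε, hB, hd⟩ := hℓ.exists_hasDir (a * t + b) trivial
    ⟨i, B, a * ε, hB, hd.comp_affine ha⟩⟩

/-! ### Completeness -/

/-- Density one is a positive term plus the square of the derivative of `ρ` along the leaf, so this
derivative is at most one in absolute value. Since `ρ` is proper, unit curves cannot escape in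
finite time. -/
theorem IsUnitCurve.abs_sub_le (hρ : ContMDiff (𝓡 (q + 1)) 𝓘(ℝ, ℝ) ∞ ρ)
    (hℓ : c.IsUnitCurve g ρ ℓ J) (ht₀ : t₀ ∈ J) (ht : t ∈ J) :
    |ρ (ℓ t) - ρ (ℓ t₀)| ≤ |t - t₀| := by
  have hd : ∀ t ∈ J, ∃ d : ℝ, HasDerivAt (fun s => ρ (ℓ s)) d t ∧ ‖d‖ ≤ 1 := by
    intro t ht
    obtain ⟨i, B, ε, hB, hd⟩ := hℓ.exists_hasDir t ht
    have hy := B.map_source hd.mem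
    have h1 : HasFDerivAt (fun z => ρ (B.symm z)) (fderiv ℝ (fun z => ρ (B.symm z)) (B (ℓ t)))
        (B (ℓ t) + (0, ε * (t - t))) := by
      simpa [Prod.mk_zero_zero] using
        (((hB.contDiffOn_comp_symm hρ).contDiffAt
          (B.open_target.mem_nhds hy)).differentiableAt (by simp)).hasFDerivAt
    have h2 : HasDerivAt (fun s : ℝ => B (ℓ t) + ((0, ε * (s - t)) : Euc q × ℝ)) (0, ε) t := by
      refine HasDerivAt.const_add _ ((hasDerivAt_const t _).prodMk ?_)
      simpa using ((hasDerivAt_id t).sub_const t).const_mul ε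
    have h3 := HasFDerivAt.comp_hasDerivAt (l := fun z => ρ (B.symm z))
      (f := fun s : ℝ => B (ℓ t) + ((0, ε * (s - t)) : Euc q × ℝ)) t h1 h2
    refine ⟨_, h3.congr_of_eventuallyEq ?_, ?_⟩
    · filter_upwards [hd.eventually] with s hs
      simp only [Function.comp, ← hs]
    · have h4 := hB.density_eq _ hy
      have h5 := hB.toIsBox.pullMetric_pos g hy
      have h6 : ((0, ε) : Euc q × ℝ) = ε • (0, 1) := by simp
      rw [h6, map_smul, smul_eq_mul, Real.norm_eq_abs, abs_mul]
      have h7 : |ε| = 1 := by rcases hd.sign with rfl | rfl <;> simp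
      rw [h7, one_mul, ← sq_le_one_iff_abs_le_one]
      simp only [boxDensity] at h4
      linarith
  choose! d hd hd1 using hd
  have := hℓ.ordConnected.convex.norm_image_sub_le_of_norm_hasDerivWithin_le (C := 1)
    (fun s hs => (hd s hs).hasDerivWithinAt) hd1 ht₀ ht
  simpa using this

end HaefligerCocycle

namespace HaefligerCocycle

variable {q : ℕ} {M : Type u} [TopologicalSpace M]
  [ChartedSpace (Euc (q + 1)) M] [IsManifold (𝓡 (q + 1)) ∞ M]
  {c : HaefligerCocycle.{w} (q + 1) q M} {g : SmoothMetric (q + 1) M} {ρ : M → ℝ}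
  {i j : c.ι} {B B' : OpenPartialHomeomorph M (Euc q × ℝ)} {ℓ ℓ' : ℝ → M} {J J' : Set ℝ}
  {t t₀ ε ε' : ℝ}

theorem IsUnitCurve.of_eventuallyEq (hJ : IsOpen J) (hJ' : J.OrdConnected)
    (H : ∀ t ∈ J, ∃ ℓ' J', c.IsUnitCurve g ρ ℓ' J' ∧ t ∈ J' ∧ ℓ =ᶠ[𝓝 t] ℓ') :
    c.IsUnitCurve g ρ ℓ J :=
  ⟨hJ, hJ', fun t ht =>
    let ⟨_, _, h1, h2, h3⟩ := H t ht
    let ⟨i, B, ε, hB, hd⟩ := h1.exists_hasDir t h2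
    ⟨i, B, ε, hB, hd.congr h3.symm⟩⟩

theorem IsUnitCurve.union [T2Space M] (hρ : ContMDiff (𝓡 (q + 1)) 𝓘(ℝ, ℝ) ∞ ρ)
    (hℓ : c.IsUnitCurve g ρ ℓ J) (hℓ' : c.IsUnitCurve g ρ ℓ' J')
    (ht : t ∈ J ∩ J') (h0 : ℓ =ᶠ[𝓝 t] ℓ') :
    ∃ ℓ'', c.IsUnitCurve g ρ ℓ'' (J ∪ J') ∧ EqOn ℓ'' ℓ J := by
  classical
  have ho := hℓ.isOpen.inter hℓ'.isOpen
  have hoc := hℓ.ordConnected.inter hℓ'.ordConnected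
  have he : EqOn ℓ ℓ' (J ∩ J') := (hℓ.mono ho hoc inter_subset_left).eqOn_of_eventuallyEq hρ
    (hℓ'.mono ho hoc inter_subset_right) ht h0
  have h1 : EqOn (J.piecewise ℓ ℓ') ℓ J := piecewise_eqOn J ℓ ℓ'
  have h2 : EqOn (J.piecewise ℓ ℓ') ℓ' J' := by
    intro s hs
    by_cases hsJ : s ∈ J
    · rw [h1 hsJ, he ⟨hsJ, hs⟩]
    · exact piecewise_eqOn_compl J ℓ ℓ' hsJ
  refine ⟨J.piecewise ℓ ℓ', IsUnitCurve.of_eventuallyEq (hℓ.isOpen.union hℓ'.isOpen) ?_ ?_, h1⟩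
  · exact (hℓ.ordConnected.isPreconnected.union t ht.1 ht.2
      hℓ'.ordConnected.isPreconnected).ordConnected
  · rintro s (hs | hs)
    · exact ⟨ℓ, J, hℓ, hs, h1.eventuallyEq_of_mem (hℓ.isOpen.mem_nhds hs)⟩
    · exact ⟨ℓ', J', hℓ', hs, h2.eventuallyEq_of_mem (hℓ'.isOpen.mem_nhds hs)⟩

/-- Unit curves that start in a compact set exist for a uniform time. -/
theorem exists_uniform_time (hρ : ContMDiff (𝓡 (q + 1)) 𝓘(ℝ, ℝ) ∞ ρ) {K : Set M}
    (hK : IsCompact K) : ∃ δ > (0 : ℝ), ∀ (ℓ : ℝ → M) (J : Set ℝ) (t : ℝ), c.IsUnitCurve g ρ ℓ J →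
      t ∈ J → ℓ t ∈ K → ∃ ℓ', c.IsUnitCurve g ρ ℓ' (Ioo (t - δ) (t + δ)) ∧ ℓ =ᶠ[𝓝 t] ℓ' := by
  refine hK.induction_on (p := fun K => ∃ δ > (0 : ℝ), ∀ (ℓ : ℝ → M) (J : Set ℝ) (t : ℝ),
    c.IsUnitCurve g ρ ℓ J → t ∈ J → ℓ t ∈ K → ∃ ℓ', c.IsUnitCurve g ρ ℓ' (Ioo (t - δ) (t + δ)) ∧
      ℓ =ᶠ[𝓝 t] ℓ') ⟨1, one_pos, fun _ _ _ _ _ h => h.elim⟩ ?_ ?_ ?_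
  · rintro s s' hs ⟨δ, hδ, h⟩
    exact ⟨δ, hδ, fun ℓ J t h1 h2 h3 => h ℓ J t h1 h2 (hs h3)⟩
  · rintro s s' ⟨δ, hδ, h⟩ ⟨δ', hδ', h'⟩
    refine ⟨min δ δ', by positivity, fun ℓ J t h1 h2 h3 => ?_⟩
    have hmin := min_le_left δ δ'
    have hmin' := min_le_right δ δ'
    rcases h3 with h3 | h3
    · obtain ⟨ℓ', h4, h5⟩ := h ℓ J t h1 h2 h3
      exact ⟨ℓ', h4.mono isOpen_Ioo ordConnected_Ioo
        (Ioo_subset_Ioo (by linarith) (by linarith)), h5⟩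
    · obtain ⟨ℓ', h4, h5⟩ := h' ℓ J t h1 h2 h3
      exact ⟨ℓ', h4.mono isOpen_Ioo ordConnected_Ioo
        (Ioo_subset_Ioo (by linarith) (by linarith)), h5⟩
  · intro z _
    obtain ⟨i, hi⟩ := c.exists_mem_U z
    obtain ⟨B, hB, hzB⟩ := exists_isUnitBox hρ g hi
    obtain ⟨r, hr, hrB⟩ := Metric.isOpen_iff.1 B.open_target _ (B.map_source hzB)
    have hN₁ : ∀ᶠ x in 𝓝 z, x ∈ B.source := B.open_source.mem_nhds hzB
    have hN₂ : ∀ᶠ x in 𝓝 z, B x ∈ Metric.ball (B z) (r / 2) :=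
      (B.continuousAt hzB).preimage_mem_nhds (Metric.ball_mem_nhds _ (by positivity))
    have hN := hN₁.and hN₂
    refine ⟨_, mem_nhdsWithin_of_mem_nhds hN, r / 2, by positivity, fun ℓ J t h1 h2 h3 => ?_⟩
    obtain ⟨ε, hd⟩ := h1.hasDir hρ h2 hB h3.1
    refine ⟨_, (hB.isUnitCurve hd.sign (B (ℓ t)) t).1.mono isOpen_Ioo ordConnected_Ioo ?_,
      hd.eventually⟩
    intro s hs
    refine hrB ?_
    rw [Metric.mem_ball]
    have h4 : dist (B (ℓ t) + ((0, ε * (s - t)) : Euc q × ℝ)) (B (ℓ t)) < r / 2 := by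
      rw [dist_self_add_left, Prod.norm_def, norm_zero, Real.norm_eq_abs, abs_mul]
      have h5 : |ε| = 1 := by rcases hd.sign with rfl | rfl <;> simp
      have h6 : |s - t| < r / 2 := abs_lt.2 ⟨by linarith [hs.1], by linarith [hs.2]⟩
      simp only [h5, one_mul]
      exact max_lt (by positivity) h6
    have h5 := dist_triangle (B (ℓ t) + ((0, ε * (s - t)) : Euc q × ℝ)) (B (ℓ t)) (B z)
    have h6 := Metric.mem_ball.1 h3.2
    linarith

/-- A unit curve extends to a complete one. -/
theorem IsUnitCurve.exists_extension [T2Space M] (hρ : ContMDiff (𝓡 (q + 1)) 𝓘(ℝ, ℝ) ∞ ρ)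
    (hρK : ∀ R, IsCompact {x | ρ x ≤ R}) (hℓ : c.IsUnitCurve g ρ ℓ J) (h0 : 0 ∈ J) :
    ∃ ℓ', c.IsUnitCurve g ρ ℓ' univ ∧ ℓ' =ᶠ[𝓝 0] ℓ := by
  have hE : ∀ T : ℝ, 0 < T → ∃ ℓ', c.IsUnitCurve g ρ ℓ' (Ioo (-T) T) ∧ ℓ' =ᶠ[𝓝 0] ℓ := by
    obtain ⟨T₀, hT₀, hT₀J⟩ := Metric.isOpen_iff.1 hℓ.isOpen 0 h0
    rw [Real.ball_eq_Ioo, zero_sub, zero_add] at hT₀J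
    have hmono : ∀ T T', T' ≤ T → (∃ ℓ', c.IsUnitCurve g ρ ℓ' (Ioo (-T) T) ∧ ℓ' =ᶠ[𝓝 0] ℓ) →
        ∃ ℓ', c.IsUnitCurve g ρ ℓ' (Ioo (-T') T') ∧ ℓ' =ᶠ[𝓝 0] ℓ := fun T T' h ⟨ℓ', h1, h2⟩ =>
      ⟨ℓ', h1.mono isOpen_Ioo ordConnected_Ioo (Ioo_subset_Ioo (by linarith) h), h2⟩
    refine (isPreconnected_Ioi (a := (0 : ℝ))).forall_of_eventually_iff
      (P := fun T => ∃ ℓ', c.IsUnitCurve g ρ ℓ' (Ioo (-T) T) ∧ ℓ' =ᶠ[𝓝 0] ℓ) (fun b hb => ?_)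
      (t₀ := T₀) hT₀ ⟨ℓ, hℓ.mono isOpen_Ioo ordConnected_Ioo hT₀J, Filter.EventuallyEq.rfl⟩
    have hb0 : 0 < b := hb
    -- The intervals considered have half-length below `2 * b`, so the curves stay in this sublevel
    -- set, and `δ` serves for all of them.
    obtain ⟨δ, hδ, hstep⟩ := exists_uniform_time (c := c) (g := g) hρ (hρK (ρ (ℓ 0) + 2 * b))
    set δ' := min δ b with hδ'
    have hδ'0 : 0 < δ' := by positivity
    have hδδ : δ' ≤ δ := min_le_left _ _
    have hδb : δ' ≤ b := min_le_right _ _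
    have key : ∀ T, b - δ' / 8 < T → T < b + δ' / 8 →
        (∃ ℓ', c.IsUnitCurve g ρ ℓ' (Ioo (-T) T) ∧ ℓ' =ᶠ[𝓝 0] ℓ) →
        ∃ ℓ', c.IsUnitCurve g ρ ℓ' (Ioo (-(T + δ' / 2)) (T + δ' / 2)) ∧ ℓ' =ᶠ[𝓝 0] ℓ := by
      rintro T hT1 hT2 ⟨ℓ₁, h1, h2⟩
      have hT0 : 0 < T := by linarith
      have hm0 : (0 : ℝ) ∈ Ioo (-T) T := ⟨by linarith, hT0⟩
      have hmem : ∀ s ∈ Ioo (-T) T, ℓ₁ s ∈ {x | ρ x ≤ ρ (ℓ 0) + 2 * b} := by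
        intro s hs
        have h3 := (abs_le.1 (h1.abs_sub_le hρ hm0 hs)).2
        have h4 : |s - 0| < T := by rw [sub_zero]; exact abs_lt.2 hs
        rw [h2.eq_of_nhds] at h3
        simp only [mem_ofPred_eq]
        linarith
      -- The curve is restarted at distance `δ' / 4` from either end; lifetime `δ ≥ δ'` from there
      -- reaches beyond `T + δ' / 2` in absolute value.
      have ha : T - δ' / 4 ∈ Ioo (-T) T := by constructor <;> linarith
      have ha' : -T + δ' / 4 ∈ Ioo (-T) T := by constructor <;> linarith
      obtain ⟨ℓ₂, h3, h4⟩ := hstep ℓ₁ _ _ h1 ha (hmem _ ha)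
      obtain ⟨ℓ₃, h5, h6⟩ := h1.union hρ h3 ⟨ha, by constructor <;> linarith⟩ h4
      have ha'' : -T + δ' / 4 ∈ Ioo (-T) T ∪ Ioo (T - δ' / 4 - δ) (T - δ' / 4 + δ) := Or.inl ha'
      obtain ⟨ℓ₄, h7, h8⟩ := hstep ℓ₃ _ _ h5 ha'' (by rw [h6 ha']; exact hmem _ ha')
      obtain ⟨ℓ₅, h9, h10⟩ := h5.union hρ h7 ⟨ha'', by constructor <;> linarith⟩ h8
      refine ⟨ℓ₅, h9.mono isOpen_Ioo ordConnected_Ioo ?_, ?_⟩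
      · intro s hs
        rcases le_or_gt s (-T) with h | h
        · exact Or.inr ⟨by linarith [hs.1], by linarith⟩
        · rcases lt_or_ge s T with h' | h'
          · exact Or.inl (Or.inl ⟨h, h'⟩)
          · exact Or.inl (Or.inr ⟨by linarith, by linarith [hs.2]⟩)
      · have h11 : ℓ₅ =ᶠ[𝓝 0] ℓ₁ := by
          filter_upwards [isOpen_Ioo.mem_nhds hm0] with s hs
          rw [h10 (Or.inl hs), h6 hs]
        exact h11.trans h2
    refine Filter.Eventually.filter_mono nhdsWithin_le_nhds ?_
    filter_upwards [isOpen_Ioo.mem_nhds (show b ∈ Ioo (b - δ' / 8) (b + δ' / 8) from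
      ⟨by linarith, by linarith⟩)] with T hT
    exact ⟨fun h => hmono _ _ (by linarith [hT.2]) (key b (by linarith) (by linarith) h),
      fun h => hmono _ _ (by linarith [hT.1]) (key T hT.1 hT.2 h)⟩
  choose L hL hL0 using fun n : ℕ => hE (n + 1) (by positivity)
  have hagree : ∀ n m : ℕ, n ≤ m → EqOn (L m) (L n) (Ioo (-((n : ℝ) + 1)) (n + 1)) := by
    intro n m hnm
    have hnm' : (n : ℝ) ≤ m := Nat.cast_le.2 hnm
    refine ((hL m).mono isOpen_Ioo ordConnected_Ioo (Ioo_subset_Ioo (by linarith)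
      (by linarith))).eqOn_of_eventuallyEq hρ (hL n) (t₀ := 0) ?_ ((hL0 m).trans (hL0 n).symm)
    have : (0 : ℝ) ≤ n := Nat.cast_nonneg n
    constructor <;> linarith
  have hcomm : ∀ n m : ℕ, ∀ s, s ∈ Ioo (-((n : ℝ) + 1)) (n + 1) →
      s ∈ Ioo (-((m : ℝ) + 1)) (m + 1) → L n s = L m s := by
    intro n m s hn hm
    rcases le_total n m with h | h
    · exact (hagree n m h hn).symm
    · exact hagree m n h hm
  have hceil : ∀ s : ℝ, s ∈ Ioo (-((⌈|s|⌉₊ : ℝ) + 1)) (⌈|s|⌉₊ + 1) := fun s => by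
    have := Nat.le_ceil |s|
    exact abs_lt.1 (by linarith)
  let ℓ' : ℝ → M := fun s => L ⌈|s|⌉₊ s
  have heq : ∀ n : ℕ, EqOn ℓ' (L n) (Ioo (-((n : ℝ) + 1)) (n + 1)) := fun n s hs =>
    hcomm _ _ s (hceil s) hs
  refine ⟨ℓ', IsUnitCurve.of_eventuallyEq isOpen_univ ordConnected_univ fun s _ => ?_, ?_⟩
  · exact ⟨_, _, hL ⌈|s|⌉₊, hceil s, (heq _).eventuallyEq_of_mem (isOpen_Ioo.mem_nhds (hceil s))⟩
  · refine Filter.EventuallyEq.trans ((heq 0).eventuallyEq_of_mem (isOpen_Ioo.mem_nhds ?_)) (hL0 0)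
    simp

/-- There is a complete unit curve through each point, in each direction. -/
theorem exists_isUnitCurve [T2Space M] (hρ : ContMDiff (𝓡 (q + 1)) 𝓘(ℝ, ℝ) ∞ ρ)
    (hρK : ∀ R, IsCompact {x | ρ x ≤ R}) (hB : c.IsUnitBox g ρ i B) {x : M} (hx : x ∈ B.source)
    (hε : ε = 1 ∨ ε = -1) :
    ∃ ℓ, c.IsUnitCurve g ρ ℓ univ ∧ ℓ 0 = x ∧ HasDir B ℓ 0 ε := by
  obtain ⟨h1, h2⟩ := hB.isUnitCurve hε (B x) 0
  have h0 : B x + (0, ε * (0 - 0)) ∈ B.target := by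
    simpa [Prod.mk_zero_zero] using B.map_source hx
  obtain ⟨ℓ, h3, h4⟩ := h1.exists_extension hρ hρK h0
  exact ⟨ℓ, h3, by simp [h4.eq_of_nhds, Prod.mk_zero_zero, B.left_inv hx], (h2 0 h0).congr h4.symm⟩

/-! ### Dependence on the initial point -/

/-- Unit curves depend smoothly on the starting point and the direction. -/
theorem IsUnitCurve.exists_transfer [T2Space M] (hρ : ContMDiff (𝓡 (q + 1)) 𝓘(ℝ, ℝ) ∞ ρ)
    (hℓ : c.IsUnitCurve g ρ ℓ univ) (hB : c.IsUnitBox g ρ i B) (hd : HasDir B ℓ t₀ ε) (t : ℝ) :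
    ∀ j B' ε', c.IsUnitBox g ρ j B' → HasDir B' ℓ t ε' → ∃ f : M → M,
      ContMDiffAt (𝓡 (q + 1)) (𝓡 (q + 1)) ∞ f (ℓ t₀) ∧
      ∀ᶠ x in 𝓝 (ℓ t₀), ∀ ℓ', c.IsUnitCurve g ρ ℓ' univ → ℓ' t₀ = x → HasDir B ℓ' t₀ ε →
        ℓ' t = f x ∧ HasDir B' ℓ' t ε' := by
  refine isPreconnected_univ.forall_of_eventually_iff (P := fun t =>
      ∀ j B' ε', c.IsUnitBox g ρ j B' → HasDir B' ℓ t ε' → ∃ f : M → M,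
      ContMDiffAt (𝓡 (q + 1)) (𝓡 (q + 1)) ∞ f (ℓ t₀) ∧
      ∀ᶠ x in 𝓝 (ℓ t₀), ∀ ℓ', c.IsUnitCurve g ρ ℓ' univ → ℓ' t₀ = x → HasDir B ℓ' t₀ ε →
        ℓ' t = f x ∧ HasDir B' ℓ' t ε') (fun t _ => ?_) (mem_univ t₀) ?_ t trivial
  swap
  · intro j B' ε' hB' hd'
    obtain ⟨σ, -, h1⟩ := HasDir.exists_change hρ hB hB' hd.mem hd'.mem
    refine ⟨id, contMDiffAt_id, ?_⟩
    have h2 := hd'.unique (h1.self_of_nhds ℓ t₀ ε rfl hd)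
    filter_upwards [h1] with x hx ℓ' hℓ' h3 h4
    exact ⟨h3, h2 ▸ hx ℓ' t₀ ε h3 h4⟩
  obtain ⟨k, B₀, ε₀, hB₀, hd₀⟩ := hℓ.exists_hasDir t trivial
  have hgood : ∀ᶠ s in 𝓝 t, HasDir B₀ ℓ s ε₀ ∧ B₀ (ℓ s) = B₀ (ℓ t) + (0, ε₀ * (s - t)) ∧
      B₀ (ℓ t) + (0, ε₀ * (s - t)) ∈ B₀.target :=
    hd₀.eventually_hasDir.and ((hd₀.eventually_eq.mono fun s hs => hs.2).and
      (hd₀.tendsto.eventually (B₀.open_target.mem_nhds (B₀.map_source hd₀.mem))))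
  have key : ∀ s₁ s₂, (HasDir B₀ ℓ s₁ ε₀ ∧ B₀ (ℓ s₁) = B₀ (ℓ t) + (0, ε₀ * (s₁ - t)) ∧
      B₀ (ℓ t) + (0, ε₀ * (s₁ - t)) ∈ B₀.target) → (HasDir B₀ ℓ s₂ ε₀ ∧
      B₀ (ℓ s₂) = B₀ (ℓ t) + (0, ε₀ * (s₂ - t)) ∧
      B₀ (ℓ t) + (0, ε₀ * (s₂ - t)) ∈ B₀.target) → (∀ j B' ε', c.IsUnitBox g ρ j B' →
      HasDir B' ℓ s₁ ε' → ∃ f : M → M,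
      ContMDiffAt (𝓡 (q + 1)) (𝓡 (q + 1)) ∞ f (ℓ t₀) ∧
      ∀ᶠ x in 𝓝 (ℓ t₀), ∀ ℓ', c.IsUnitCurve g ρ ℓ' univ → ℓ' t₀ = x → HasDir B ℓ' t₀ ε →
        ℓ' s₁ = f x ∧ HasDir B' ℓ' s₁ ε') → ∀ j B' ε', c.IsUnitBox g ρ j B' →
      HasDir B' ℓ s₂ ε' → ∃ f : M → M,
      ContMDiffAt (𝓡 (q + 1)) (𝓡 (q + 1)) ∞ f (ℓ t₀) ∧
      ∀ᶠ x in 𝓝 (ℓ t₀), ∀ ℓ', c.IsUnitCurve g ρ ℓ' univ → ℓ' t₀ = x → HasDir B ℓ' t₀ ε →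
        ℓ' s₂ = f x ∧ HasDir B' ℓ' s₂ ε' := by
    rintro s₁ s₂ ⟨h1, h2, -⟩ ⟨h3, h4, h5⟩ hP j B' ε' hB' hd'
    obtain ⟨f, hf, hfe⟩ := hP k B₀ ε₀ hB₀ h1
    obtain ⟨σ, -, hσ⟩ := HasDir.exists_change hρ hB₀ hB' h3.mem hd'.mem
    have hε' := hd'.unique (hσ.self_of_nhds ℓ s₂ ε₀ rfl h3)
    have hft : f (ℓ t₀) = ℓ s₁ := ((hfe.self_of_nhds ℓ hℓ rfl hd).1).symm
    -- In the box `B₀`, passing from time `s₁` to time `s₂` is translation by `v`, so the new map is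
    -- `f` followed by this translation.
    let v : Euc q × ℝ := (0, ε₀ * (s₂ - s₁))
    have hv : B₀ (ℓ s₁) + v = B₀ (ℓ t) + (0, ε₀ * (s₂ - t)) := by
      rw [h2, add_assoc]
      congr 1
      ext1
      · simp [v]
      · simp [v]; ring
    have hvt : B₀ (ℓ s₁) + v ∈ B₀.target := hv ▸ h5
    have hf₁ : ContMDiffAt (𝓡 (q + 1)) 𝓘(ℝ, Euc q × ℝ) ∞ (fun x => B₀ (f x) + v) (ℓ t₀) := by
      have h6 : ContMDiffAt (𝓡 (q + 1)) 𝓘(ℝ, Euc q × ℝ) ∞ (fun x => B₀ (f x)) (ℓ t₀) :=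
        ContMDiffAt.comp (ℓ t₀) (by rw [hft]; exact hB₀.contMDiffAt h1.mem) hf
      exact h6.add contMDiffAt_const
    have hf₂ : ContMDiffAt (𝓡 (q + 1)) (𝓡 (q + 1)) ∞ (fun x => B₀.symm (B₀ (f x) + v)) (ℓ t₀) :=
      ContMDiffAt.comp (g := B₀.symm) (ℓ t₀)
        (by rw [hft]; exact hB₀.contMDiffAt_symm hvt) hf₁
    refine ⟨_, hf₂, ?_⟩
    have h6 : ∀ᶠ x in 𝓝 (ℓ t₀), B₀ (f x) + v ∈ B₀.target :=
      hf₁.continuousAt.preimage_mem_nhds (B₀.open_target.mem_nhds (by rwa [hft]))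
    have h7 : B₀.symm (B₀ (f (ℓ t₀)) + v) = ℓ s₂ := by
      rw [hft, hv, ← h4, B₀.left_inv h3.mem]
    have h8 := hf₂.continuousAt.tendsto.eventually (h7.symm ▸ hσ)
    filter_upwards [h6, h8, hfe] with x hx hx' hx'' ℓ' hℓ' h9 h10
    obtain ⟨h11, h12⟩ := hx'' ℓ' hℓ' h9 h10
    obtain ⟨h13, h14⟩ := hℓ'.eq_of_mem_target hρ (mem_univ s₁) hB₀ h12 (mem_univ s₂)
      (by rw [h11]; exact hx)
    rw [h11] at h13
    exact ⟨h13, hε' ▸ hx' ℓ' s₂ ε₀ h13 h14⟩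
  rw [nhdsWithin_univ]
  filter_upwards [hgood] with s hs
  exact ⟨key t s hgood.self_of_nhds hs, key s t hs hgood.self_of_nhds⟩

end HaefligerCocycle

namespace HaefligerCocycle

variable {q : ℕ} {M : Type u} [TopologicalSpace M]
  [ChartedSpace (Euc (q + 1)) M] [IsManifold (𝓡 (q + 1)) ∞ M]
  {c : HaefligerCocycle.{w} (q + 1) q M} {g : SmoothMetric (q + 1) M} {ρ : M → ℝ}
  {i j : c.ι} {B B' : OpenPartialHomeomorph M (Euc q × ℝ)} {ℓ ℓ' : ℝ → M} {J J' : Set ℝ}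
  {t t' t₀ ε ε' : ℝ}

theorem IsUnitCurve.continuous (hℓ : c.IsUnitCurve g ρ ℓ univ) : Continuous ℓ :=
  continuous_iff_continuousAt.2 fun t => hℓ.continuousAt (mem_univ t)

theorem exists_isUnitCurve_through [T2Space M] (hρ : ContMDiff (𝓡 (q + 1)) 𝓘(ℝ, ℝ) ∞ ρ)
    (hρK : ∀ R, IsCompact {x | ρ x ≤ R}) (c : HaefligerCocycle.{w} (q + 1) q M)
    (g : SmoothMetric (q + 1) M) (x : M) : ∃ ℓ, c.IsUnitCurve g ρ ℓ univ ∧ ℓ 0 = x := by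
  obtain ⟨i, hi⟩ := c.exists_mem_U x
  obtain ⟨B, hB, hx⟩ := exists_isUnitBox hρ g hi
  obtain ⟨ℓ, h1, h2, -⟩ := exists_isUnitCurve hρ hρK hB hx (Or.inl rfl)
  exact ⟨ℓ, h1, h2⟩

/-- Two unit curves that meet are reparametrizations of each other. -/
theorem IsUnitCurve.exists_eq_comp [T2Space M] (hρ : ContMDiff (𝓡 (q + 1)) 𝓘(ℝ, ℝ) ∞ ρ)
    (hℓ : c.IsUnitCurve g ρ ℓ univ) (hℓ' : c.IsUnitCurve g ρ ℓ' univ) (h : ℓ t = ℓ' t') :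
    ∃ a : ℝ, (a = 1 ∨ a = -1) ∧ ∀ s, ℓ' s = ℓ (a * (s - t') + t) := by
  obtain ⟨i, B, ε, hB, hd⟩ := hℓ.exists_hasDir t trivial
  obtain ⟨ε', hd'⟩ := hℓ'.hasDir hρ (mem_univ t') hB (h ▸ hd.mem)
  have ha : ε' * ε = 1 ∨ ε' * ε = -1 := by
    rcases hd.sign with rfl | rfl <;> rcases hd'.sign with rfl | rfl <;> norm_num
  refine ⟨ε' * ε, ha, ?_⟩
  have e : ∀ s : ℝ, ε' * ε * (s - t') + t = ε' * ε * s + (t - ε' * ε * t') := fun s => by ring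
  have e0 : ε' * ε * t' + (t - ε' * ε * t') = t := by ring
  have hd'' : HasDir B (fun s => ℓ (ε' * ε * s + (t - ε' * ε * t'))) t' (ε' * ε * ε) :=
    HasDir.comp_affine ha (by rw [e0]; exact hd)
  rw [show ε' * ε * ε = ε' by rw [mul_assoc, hd.sq, mul_one]] at hd''
  have := hℓ'.eqOn hρ (hℓ.comp_affine (b := t - ε' * ε * t') ha) (mem_univ t') (by rw [e0, h])
    hd' hd''
  intro s
  rw [this (mem_univ s), e]

/-- Curves in a leaf factor through unit curves. -/
theorem IsUnitCurve.exists_lift [T2Space M] (hρ : ContMDiff (𝓡 (q + 1)) 𝓘(ℝ, ℝ) ∞ ρ)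
    (hℓ : c.IsUnitCurve g ρ ℓ univ) {σ : ℝ → M} {T : ℝ} (hT : 0 ≤ T)
    (hσ : c.IsLeafCurveOn σ (Icc 0 T)) (h0 : ℓ t₀ = σ 0) :
    ∃ θ : ℝ → ℝ, ContinuousOn θ (Icc 0 T) ∧ θ 0 = t₀ ∧ ∀ s ∈ Icc 0 T, σ s = ℓ (θ s) := by
  refine isPreconnected_Icc.forall_of_eventually_iff (J := Icc 0 T) (P := fun b => ∃ θ : ℝ → ℝ,
    ContinuousOn θ (Icc 0 b) ∧ θ 0 = t₀ ∧ ∀ s ∈ Icc 0 b, σ s = ℓ (θ s)) (fun b hb => ?_)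
    (t₀ := 0) (left_mem_Icc.2 hT) ⟨fun _ => t₀, continuousOn_const, rfl, ?_⟩ T
    (right_mem_Icc.2 hT)
  swap
  · rintro s ⟨h1, h2⟩
    rw [le_antisymm h2 h1, h0]
  obtain ⟨i, hi⟩ := c.exists_mem_U (σ b)
  obtain ⟨B, hB, hbB⟩ := exists_isUnitBox hρ g hi
  have h1 : ∀ᶠ s in 𝓝[Icc 0 T] b, σ s ∈ B.source :=
    (hσ.continuousOn b hb).preimage_mem_nhdsWithin (B.open_source.mem_nhds hbB)
  have h2 := hσ.eventually_eq b hb i hi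
  obtain ⟨δ, hδ, hball⟩ := Metric.mem_nhdsWithin_iff.1 (h1.and h2)
  have hball' : ∀ s ∈ Metric.ball b δ ∩ Icc 0 T, σ s ∈ B.source ∧ (B (σ s)).1 = (B (σ b)).1 := by
    intro s hs
    obtain ⟨h3, h4⟩ : σ s ∈ B.source ∧ c.π i (σ s) = c.π i (σ b) := hball hs
    exact ⟨h3, by rw [hB.fst_eq _ h3, hB.fst_eq _ hbB, h4]⟩
  have key : ∀ b₁ ∈ Metric.ball b δ ∩ Icc 0 T, ∀ b₂ ∈ Metric.ball b δ ∩ Icc 0 T,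
      (∃ θ : ℝ → ℝ, ContinuousOn θ (Icc 0 b₁) ∧ θ 0 = t₀ ∧ ∀ s ∈ Icc 0 b₁, σ s = ℓ (θ s)) →
      ∃ θ : ℝ → ℝ, ContinuousOn θ (Icc 0 b₂) ∧ θ 0 = t₀ ∧ ∀ s ∈ Icc 0 b₂, σ s = ℓ (θ s) := by
    rintro b₁ hb₁ b₂ hb₂ ⟨θ, hθc, hθ0, hθ⟩
    rcases le_total b₂ b₁ with h | h
    · exact ⟨θ, hθc.mono (Icc_subset_Icc le_rfl h), hθ0, fun s hs =>
        hθ s ⟨hs.1, hs.2.trans h⟩⟩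
    have hmem : ∀ s ∈ Icc b₁ b₂, s ∈ Metric.ball b δ ∩ Icc 0 T := by
      have h3 := hb₁.1
      have h4 := hb₂.1
      rw [Real.ball_eq_Ioo] at h3 h4 ⊢
      exact fun s hs => ⟨⟨h3.1.trans_le hs.1, hs.2.trans_lt h4.2⟩, hb₁.2.1.trans hs.1,
        hs.2.trans hb₂.2.2⟩
    have hb₁' := hball' b₁ hb₁
    have hb₁e : ℓ (θ b₁) = σ b₁ := (hθ b₁ ⟨hb₁.2.1, le_rfl⟩).symm
    obtain ⟨ε, hd⟩ := hℓ.hasDir hρ (mem_univ (θ b₁)) hB (by rw [hb₁e]; exact hb₁'.1)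
    -- Within one plaque the parameter advances by `ε` times the increment of the last coordinate.
    let f : ℝ → ℝ := fun s => (B (σ s)).2
    have hf : ContinuousOn f (Icc b₁ b₂) := fun s hs =>
      (((B.continuousAt (hball' s (hmem s hs)).1).comp_continuousWithinAt
        ((hσ.continuousOn s (hmem s hs).2).mono fun r hr => (hmem r hr).2)).snd)
    refine ⟨fun s => θ (min s b₁) + ε * (f (max s b₁) - f b₁), ?_, ?_, ?_⟩
    · refine ContinuousOn.add ?_ (continuousOn_const.mul (ContinuousOn.sub ?_ continuousOn_const))
      · exact hθc.comp (by fun_prop) fun s hs => ⟨le_min hs.1 hb₁.2.1, min_le_right _ _⟩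
      · exact hf.comp (by fun_prop) fun s hs => ⟨le_max_right _ _, max_le hs.2 h⟩
    · simp [hb₁.2.1, hθ0]
    · intro s hs
      rcases le_total s b₁ with hsb | hsb
      · simp only [min_eq_left hsb, max_eq_right hsb, sub_self, mul_zero, add_zero]
        exact hθ s ⟨hs.1, hsb⟩
      · have hs' := hball' s (hmem s ⟨hsb, hs.2⟩)
        have e : B (ℓ (θ b₁)) + (0, ε * (θ b₁ + ε * (f s - f b₁) - θ b₁)) = B (σ s) := by
          rw [hb₁e]
          ext1
          · simp [hb₁'.2, hs'.2]
          · simp only [Prod.snd_add, add_sub_cancel_left, ← mul_assoc, hd.sq, one_mul, f]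
            ring
        have h3 := (hℓ.eq_of_mem_target hρ (mem_univ _) hB hd
          (mem_univ (θ b₁ + ε * (f s - f b₁))) (by rw [e]; exact B.map_source hs'.1)).1
        rw [e, B.left_inv hs'.1] at h3
        simp only [min_eq_right hsb, max_eq_left hsb, h3]
  filter_upwards [self_mem_nhdsWithin, nhdsWithin_le_nhds (Metric.ball_mem_nhds b hδ)] with s h3 h4
  have hbb : b ∈ Metric.ball b δ ∩ Icc 0 T := ⟨Metric.mem_ball_self hδ, hb⟩
  exact ⟨key b hbb s ⟨h4, h3⟩, key s ⟨h4, h3⟩ b hbb⟩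

/-- Leaves are the images of unit curves. -/
theorem IsUnitCurve.leaf_eq_range [T2Space M] (hρ : ContMDiff (𝓡 (q + 1)) 𝓘(ℝ, ℝ) ∞ ρ)
    (hℓ : c.IsUnitCurve g ρ ℓ univ) (t : ℝ) : c.leaf (ℓ t) = range ℓ := by
  refine Subset.antisymm ?_ ?_
  · rintro y ⟨σ, hσ⟩
    have hleaf : c.IsLeafCurveOn σ.extend (Icc 0 1) := by
      refine ⟨σ.continuous_extend.continuousOn, fun s hs i hi => ?_⟩
      have e : σ.extend s = σ ⟨s, hs⟩ := σ.extend_apply hs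
      rw [e] at hi
      have h1 := hσ ⟨s, hs⟩ i hi
      rw [e]
      rw [nhds_subtype_eq_comap, Filter.eventually_comap] at h1
      rw [eventually_nhdsWithin_iff]
      filter_upwards [h1] with r hr hr'
      rw [σ.extend_apply hr']
      exact hr ⟨r, hr'⟩ rfl
    obtain ⟨θ, -, -, h⟩ := hℓ.exists_lift hρ zero_le_one hleaf (t₀ := t) (by simp)
    exact ⟨θ 1, by rw [← h 1 ⟨zero_le_one, le_rfl⟩]; simp⟩
  · rintro _ ⟨s, rfl⟩
    have hc : Continuous fun r : unitInterval => ℓ (t + r * (s - t)) :=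
      hℓ.continuous.comp (by fun_prop)
    refine ⟨⟨⟨_, hc⟩, by simp, by simp⟩, fun r i hi => ?_⟩
    have h1 := (hℓ.isLeafCurveOn).eventually_eq (t + r * (s - t)) trivial i hi
    rw [nhdsWithin_univ] at h1
    have h2 : Continuous fun r : unitInterval => t + (r : ℝ) * (s - t) := by fun_prop
    exact (h2.tendsto r).eventually h1

theorem mem_leaf_self [T2Space M] (hρ : ContMDiff (𝓡 (q + 1)) 𝓘(ℝ, ℝ) ∞ ρ)
    (hρK : ∀ R, IsCompact {x | ρ x ≤ R}) (c : HaefligerCocycle.{w} (q + 1) q M)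
    (g : SmoothMetric (q + 1) M) (x : M) : x ∈ c.leaf x := by
  obtain ⟨ℓ, hℓ, rfl⟩ := exists_isUnitCurve_through hρ hρK c g x
  rw [hℓ.leaf_eq_range hρ 0]
  exact mem_range_self 0

theorem leaf_eq_of_mem [T2Space M] (hρ : ContMDiff (𝓡 (q + 1)) 𝓘(ℝ, ℝ) ∞ ρ)
    (hρK : ∀ R, IsCompact {x | ρ x ≤ R}) (g : SmoothMetric (q + 1) M) {x y : M}
    (h : y ∈ c.leaf x) : c.leaf y = c.leaf x := by
  obtain ⟨ℓ, hℓ, rfl⟩ := exists_isUnitCurve_through hρ hρK c g x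
  rw [hℓ.leaf_eq_range hρ 0] at h ⊢
  obtain ⟨s, rfl⟩ := h
  rw [hℓ.leaf_eq_range hρ s]

/-- A leaf whose unit curves are not injective is compact. -/
theorem IsUnitCurve.isCompact_range [T2Space M] (hρ : ContMDiff (𝓡 (q + 1)) 𝓘(ℝ, ℝ) ∞ ρ)
    (hℓ : c.IsUnitCurve g ρ ℓ univ) (h : ¬ Function.Injective ℓ) : IsCompact (range ℓ) := by
  obtain ⟨s, t, hst, he⟩ : ∃ s t, s < t ∧ ℓ s = ℓ t := by
    simp only [Function.Injective, not_forall] at h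
    obtain ⟨s, t, he, hne⟩ := h
    rcases lt_or_gt_of_ne hne with h | h
    · exact ⟨s, t, h, he⟩
    · exact ⟨t, s, h, he.symm⟩
  obtain ⟨a, ha | ha, hper⟩ := hℓ.exists_eq_comp hρ hℓ he
  · subst ha
    have hp : Function.Periodic ℓ (t - s) := fun r => by
      rw [hper (r + (t - s))]
      congr 1
      ring
    have h1 := hp.image_Icc (sub_pos.2 hst) s
    rw [← h1]
    exact isCompact_Icc.image hℓ.continuous
  -- For `a = -1` the curve would be invariant under reflection in the midpoint of `s` and `t`, but
  -- a unit curve is injective near each time.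
  · exfalso
    subst ha
    obtain ⟨i, B, ε, hB, hd⟩ := hℓ.exists_hasDir ((s + t) / 2) trivial
    obtain ⟨δ, hδ, hball⟩ := Metric.eventually_nhds_iff_ball.1 hd.eventually_eq
    have h1 := (hball ((s + t) / 2 + δ / 2) (by
      rw [Metric.mem_ball, Real.dist_eq, add_sub_cancel_left, abs_of_pos] <;> linarith)).2
    have h2 := (hball ((s + t) / 2 - δ / 2) (by
      rw [Metric.mem_ball, Real.dist_eq, sub_sub_cancel_left, abs_neg, abs_of_pos] <;> linarith)).2
    have h3 : ℓ ((s + t) / 2 + δ / 2) = ℓ ((s + t) / 2 - δ / 2) := by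
      rw [hper]
      congr 1
      ring
    rw [h3, h2] at h1
    have h4 := congrArg Prod.snd (add_left_cancel h1)
    simp only [add_sub_cancel_left, sub_sub_cancel_left] at h4
    rcases hd.sign with rfl | rfl <;> linarith

end HaefligerCocycle

/-- A continuous function on an interval that is locally injective is injective. -/
theorem ContinuousOn.injOn_of_locally_injOn {θ : ℝ → ℝ} {a b : ℝ} (hθ : ContinuousOn θ (Icc a b))
    (hloc : ∀ s ∈ Icc a b, ∃ U ∈ 𝓝[Icc a b] s, InjOn θ U) : InjOn θ (Icc a b) := by
  have key : ∀ s ∈ Icc a b, ∀ t ∈ Icc a b, s < t → θ s ≠ θ t := by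
    intro s hs t ht hst he
    have hsub : Icc s t ⊆ Icc a b := Icc_subset_Icc hs.1 ht.2
    -- Equal values force an interior local extremum, where a continuous function that is injective
    -- nearby, hence strictly monotone, cannot have one.
    obtain ⟨m, hm, hext⟩ := exists_isLocalExtr_Ioo hst (hθ.mono hsub) he
    obtain ⟨U, hU, hinj⟩ := hloc m (hsub (Ioo_subset_Icc_self hm))
    have hnb : Icc a b ∈ 𝓝 m := Filter.mem_of_superset (isOpen_Ioo.mem_nhds hm)
      (Ioo_subset_Icc_self.trans hsub)
    rw [nhdsWithin_eq_nhds.2 hnb] at hU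
    obtain ⟨d, hd, hball⟩ := Metric.mem_nhds_iff.1 (Filter.inter_mem hU hnb)
    have hcl : Icc (m - d / 2) (m + d / 2) ⊆ U ∩ Icc a b := by
      refine Subset.trans ?_ hball
      rw [Real.ball_eq_Ioo]
      exact Icc_subset_Ioo (by linarith) (by linarith)
    have h1 := (hθ.mono (hcl.trans inter_subset_right)).strictMonoOn_of_injOn_Icc' (by linarith)
      (hinj.mono (hcl.trans inter_subset_left))
    have hev : ∀ p : ℝ → Prop, (∀ᶠ x in 𝓝 m, p x) → ∃ e, 0 < e ∧ e ≤ d / 2 ∧ p (m + e) ∧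
        p (m - e) := by
      intro p hp
      obtain ⟨e, he, hb⟩ := Metric.eventually_nhds_iff_ball.1 hp
      refine ⟨min (e / 2) (d / 2), by positivity, min_le_right _ _, hb _ ?_, hb _ ?_⟩ <;>
      · have h2 : 0 < min (e / 2) (d / 2) := by positivity
        have h3 := min_le_left (e / 2) (d / 2)
        simp only [Metric.mem_ball, Real.dist_eq, add_sub_cancel_left, sub_sub_cancel_left, abs_neg,
          abs_of_pos h2]
        linarith
    rcases hext with hext | hext
    · obtain ⟨e, he0, hed, h2, h3⟩ := hev _ hext
      rcases h1 with h1 | h1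
      · have := h1 ⟨by linarith, by linarith⟩ (b := m) ⟨by linarith, by linarith⟩
          (show m - e < m by linarith)
        linarith
      · have := h1 (a := m) ⟨by linarith, by linarith⟩ ⟨by linarith, by linarith⟩
          (show m < m + e by linarith)
        linarith
    · obtain ⟨e, he0, hed, h2, h3⟩ := hev _ hext
      rcases h1 with h1 | h1
      · have := h1 (a := m) ⟨by linarith, by linarith⟩ ⟨by linarith, by linarith⟩
          (show m < m + e by linarith)
        linarith
      · have := h1 ⟨by linarith, by linarith⟩ (b := m) ⟨by linarith, by linarith⟩
          (show m - e < m by linarith)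
        linarith
  intro s hs t ht he
  rcases lt_trichotomy s t with h | h | h
  · exact absurd he (key s hs t ht h)
  · exact h
  · exact absurd he.symm (key t ht s hs h)

/-! ### Comparison of neighbouring leaves -/

namespace HaefligerCocycle

variable {q : ℕ} {M : Type u} [TopologicalSpace M]
  [ChartedSpace (Euc (q + 1)) M] [IsManifold (𝓡 (q + 1)) ∞ M]
  {c : HaefligerCocycle.{w} (q + 1) q M} {g : SmoothMetric (q + 1) M}
  {h : c.ι → Euc q → Euc q →L[ℝ] Euc q →L[ℝ] ℝ} {ρ : M → ℝ}
  {i j : c.ι} {B B' : OpenPartialHomeomorph M (Euc q × ℝ)} {ℓ ℓ' : ℝ → M} {J J' : Set ℝ}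
  {t t' t₀ ε ε' : ℝ}

/-- A unit curve reaches the points of its plaque. -/
theorem IsUnitCurve.eq_of_fst_eq [T2Space M] (hρ : ContMDiff (𝓡 (q + 1)) 𝓘(ℝ, ℝ) ∞ ρ)
    (hℓ : c.IsUnitCurve g ρ ℓ univ) (hB : c.IsUnitBox g ρ i B) (hd : HasDir B ℓ t ε) {x : M}
    (hx : x ∈ B.source) (he : (B x).1 = (B (ℓ t)).1) :
    x = ℓ (t + ε * ((B x).2 - (B (ℓ t)).2)) := by
  have e : B (ℓ t) + (0, ε * (t + ε * ((B x).2 - (B (ℓ t)).2) - t)) = B x := by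
    ext1
    · simp [he]
    · simp [← mul_assoc, hd.sq]
  have h1 := (hℓ.eq_of_mem_target hρ (mem_univ t) hB hd
    (mem_univ (t + ε * ((B x).2 - (B (ℓ t)).2))) (by rw [e]; exact B.map_source hx)).1
  rw [h1, e, B.left_inv hx]

theorem leaf_eq_of_fst_eq [T2Space M] (hρ : ContMDiff (𝓡 (q + 1)) 𝓘(ℝ, ℝ) ∞ ρ)
    (hρK : ∀ R, IsCompact {x | ρ x ≤ R}) (hB : c.IsUnitBox g ρ i B) {x x' : M}
    (hx : x ∈ B.source) (hx' : x' ∈ B.source) (he : (B x).1 = (B x').1) :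
    c.leaf x = c.leaf x' := by
  obtain ⟨ℓ, hℓ, rfl, hd⟩ := exists_isUnitCurve hρ hρK hB hx' (Or.inl rfl)
  rw [hℓ.eq_of_fst_eq hρ hB hd hx he, hℓ.leaf_eq_range hρ, hℓ.leaf_eq_range hρ]

/-- Points of a leaf are joined to each nearby leaf by short horizontal geodesics. -/
theorem exists_isHG_to_leaf [T2Space M] (H : c.Induces g h)
    (hcomp : c.IsTransversallyCompleteMetric g) (hρ : ContMDiff (𝓡 (q + 1)) 𝓘(ℝ, ℝ) ∞ ρ)
    (hρK : ∀ R, IsCompact {x | ρ x ≤ R}) (z : M) {η : ℝ} (hη : 0 < η) :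
    ∃ V ∈ 𝓝 z, ∀ x ∈ V, ∀ x' ∈ V, ∀ y ∈ c.leaf x, ∃ γ, c.IsHG g h γ univ ∧ γ 0 = y ∧
      speedSq g γ 0 < η ∧ γ 1 ∈ c.leaf x' := by
  obtain ⟨i, hi⟩ := c.exists_mem_U z
  obtain ⟨B, hB, hzB⟩ := exists_isUnitBox hρ g hi
  obtain ⟨V, hV, hVγ⟩ := exists_isHG_to_plaque H hcomp hi hη (B.open_source.mem_nhds hzB)
  refine ⟨V ∩ B.source, Filter.inter_mem hV (B.open_source.mem_nhds hzB),
    fun x hx x' hx' y hy => ?_⟩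
  obtain ⟨γ, hγ, hγ0, hγη, hγV, hγ1⟩ := hVγ x hx.1 x' hx'.1
  obtain ⟨ℓ, hℓ, hℓ0, T, hT, hℓT⟩ : ∃ ℓ, c.IsUnitCurve g ρ ℓ univ ∧ ℓ 0 = x ∧
      ∃ T, 0 ≤ T ∧ ℓ T = y := by
    obtain ⟨ℓ, hℓ, rfl⟩ := exists_isUnitCurve_through hρ hρK c g x
    rw [hℓ.leaf_eq_range hρ] at hy
    obtain ⟨T, rfl⟩ := hy
    -- Slides are defined for nonnegative parameters, so the unit curve is reversed if necessary.
    rcases le_total 0 T with hT | hT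
    · exact ⟨ℓ, hℓ, rfl, T, hT, rfl⟩
    · exact ⟨_, hℓ.comp_affine (b := 0) (Or.inr rfl), by simp, -T, by linarith, by simp⟩
  obtain ⟨Γ, hΓ, hΓ0⟩ := exists_isSlide H hcomp hℓ.isLeafCurveOn hγ (hγ0.trans hℓ0.symm) hT
  have hTm : T ∈ Icc 0 T := right_mem_Icc.2 hT
  refine ⟨Γ T, hΓ.isHG T, by rw [hΓ.apply_zero T hTm, hℓT], ?_, ?_⟩
  · rw [hΓ.speedSq_eq H hTm, hΓ0]
    exact hγη
  · obtain ⟨m, hm, hm0⟩ := exists_isUnitCurve_through hρ hρK c g (γ 1)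
    obtain ⟨θ, -, -, hθ⟩ := hm.exists_lift hρ hT (hΓ.isLeafCurveOn H hℓ.isLeafCurveOn 1)
      (t₀ := 0) (by rw [hΓ0, hm0])
    have h1 : γ 1 ∈ B.source := hγV 1 ⟨zero_le_one, le_rfl⟩
    rw [← leaf_eq_of_fst_eq hρ hρK hB h1 hx'.2
      (by rw [hB.fst_eq _ h1, hB.fst_eq _ hx'.2, hγ1]), ← hm0, hm.leaf_eq_range hρ]
    exact ⟨θ T, (hθ T hTm).symm⟩

/-- If a leaf passes close to two points, then every leaf close to the first point comes close to
the second one. -/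
theorem exists_nhds_leaf_meets [T2Space M] (H : c.Induces g h)
    (hcomp : c.IsTransversallyCompleteMetric g) (hρ : ContMDiff (𝓡 (q + 1)) 𝓘(ℝ, ℝ) ∞ ρ)
    (hρK : ∀ R, IsCompact {x | ρ x ≤ R}) (z₁ z₂ : M) {W : Set M} (hW : W ∈ 𝓝 z₂) :
    ∃ V₁ ∈ 𝓝 z₁, ∃ V₂ ∈ 𝓝 z₂, ∀ x ∈ V₁, ∀ x' ∈ V₁, ∀ y ∈ c.leaf x ∩ V₂,
      (c.leaf x' ∩ W).Nonempty := by
  obtain ⟨V₂, hV₂, η, hη, hslow⟩ := exists_isHG_mem_of_speedSq_lt H z₂ hW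
  obtain ⟨V₁, hV₁, hjoin⟩ := exists_isHG_to_leaf H hcomp hρ hρK z₁ hη
  refine ⟨V₁, hV₁, V₂, hV₂, fun x hx x' hx' y hy => ?_⟩
  obtain ⟨γ, hγ, hγ0, hγη, hγ1⟩ := hjoin x hx x' hx' y hy.1
  exact ⟨γ 1, hγ1, hslow γ hγ (hγ0 ▸ hy.2) hγη 1 ⟨zero_le_one, le_rfl⟩⟩

/-- Leaves close to a leaf with compact closure have compact closure. -/
theorem exists_nhds_isCompact_closure_leaf [T2Space M] (H : c.Induces g h)
    (hcomp : c.IsTransversallyCompleteMetric g) (hρ : ContMDiff (𝓡 (q + 1)) 𝓘(ℝ, ℝ) ∞ ρ)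
    (hρK : ∀ R, IsCompact {x | ρ x ≤ R}) (z : M) :
    ∃ V ∈ 𝓝 z, ∀ x ∈ V, ∀ x' ∈ V, IsCompact (closure (c.leaf x)) →
      IsCompact (closure (c.leaf x')) := by
  have : LocallyCompactSpace M := ChartedSpace.locallyCompactSpace (Euc (q + 1)) M
  obtain ⟨V, hV, hjoin⟩ := exists_isHG_to_leaf H hcomp hρ hρK z one_pos
  refine ⟨V, hV, fun x hx x' hx' hC => ?_⟩
  refine (isCompact_closure_endpoints H hcomp hC 1).of_isClosed_subset isClosed_closure
    (closure_mono fun y hy => ?_)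
  obtain ⟨γ, hγ, hγ0, hγη, hγ1⟩ := hjoin x' hx' x hx y hy
  -- Reversed, the geodesic starts on the leaf with compact closure and ends at `y`.
  refine ⟨fun t => γ (-1 * t + 1), hγ.comp_affine (-1) 1, ?_, ?_, ?_⟩
  · simpa using subset_closure hγ1
  · rw [speedSq_comp_affine hγ H]
    linarith
  · simpa using hγ0

/-- The dichotomy: leaves of nearby points have compact closure simultaneously, and `M` is
connected. -/
theorem isCompact_closure_leaf_of_exists [T2Space M] [ConnectedSpace M] (H : c.Induces g h)
    (hcomp : c.IsTransversallyCompleteMetric g) (hρ : ContMDiff (𝓡 (q + 1)) 𝓘(ℝ, ℝ) ∞ ρ)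
    (hρK : ∀ R, IsCompact {x | ρ x ≤ R}) {x₀ : M} (hx₀ : IsCompact (closure (c.leaf x₀))) (x : M) :
    IsCompact (closure (c.leaf x)) := by
  refine isPreconnected_univ.forall_of_eventually_iff
    (P := fun x => IsCompact (closure (c.leaf x))) (fun z _ => ?_) (mem_univ x₀) hx₀ x trivial
  obtain ⟨V, hV, h1⟩ := exists_nhds_isCompact_closure_leaf H hcomp hρ hρK z
  rw [nhdsWithin_univ]
  filter_upwards [hV] with y hy
  exact ⟨h1 z (mem_of_mem_nhds hV) y hy, h1 y hy z (mem_of_mem_nhds hV)⟩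

/-- If unit curves start close to each other in the same direction and one of them reaches a
neighbourhood of a point after a time bounded below, then so does the other one. -/
theorem exists_nhds_unitCurve_meets [T2Space M] (H : c.Induces g h)
    (hcomp : c.IsTransversallyCompleteMetric g) (hρ : ContMDiff (𝓡 (q + 1)) 𝓘(ℝ, ℝ) ∞ ρ)
    (hinj : ∀ ℓ, c.IsUnitCurve g ρ ℓ univ → Function.Injective ℓ)
    (hB : c.IsUnitBox g ρ i B) {z : M} (hz : z ∈ B.source) {κ : ℝ} (hκ : 0 < κ) :
    ∃ τ₀ > (0 : ℝ), ∀ z₂, ∀ W ∈ 𝓝 z₂, ∃ V₁ ∈ 𝓝 z, ∃ V₂ ∈ 𝓝 z₂, ∀ ℓ ℓ' ε T,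
      c.IsUnitCurve g ρ ℓ univ → c.IsUnitCurve g ρ ℓ' univ → ℓ 0 ∈ V₁ → ℓ' 0 ∈ V₁ →
      HasDir B ℓ 0 ε → HasDir B ℓ' 0 ε → κ ≤ T → ℓ T ∈ V₂ → ∃ T', τ₀ ≤ T' ∧ ℓ' T' ∈ W := by
  have hi : z ∈ c.U i := hB.subset hz
  obtain ⟨N, hN, η₁, hη₁, hslow₁⟩ := exists_isHG_mem_of_speedSq_lt H z (B.open_source.mem_nhds hz)
  have hN' : B.target ∩ B.symm ⁻¹' N ∈ 𝓝 (B z) := by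
    refine Filter.inter_mem (B.open_target.mem_nhds (B.map_source hz))
      ((B.continuousAt_symm (B.map_source hz)).preimage_mem_nhds ?_)
    rwa [B.left_inv hz]
  obtain ⟨r, hr, hball⟩ := Metric.mem_nhds_iff.1 hN'
  -- During the initial time `s₁ ≤ κ ≤ T` the curve `ℓ` follows a coordinate line inside the box;
  -- this stretch will fix the direction in which the endpoints of the slide move along `ℓ'`.
  obtain ⟨s₁, hs₁, hs₁κ, hs₁r⟩ : ∃ s₁ > 0, s₁ ≤ κ ∧ s₁ ≤ r / 2 :=
    ⟨min κ (r / 2), by positivity, min_le_left _ _, min_le_right _ _⟩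
  have hmove : ∀ y ∈ Metric.ball (B z) (r / 2), ∀ a : ℝ, |a| ≤ s₁ →
      y + (0, a) ∈ Metric.ball (B z) r := by
    intro y hy a ha
    have h1 : dist (y + ((0, a) : Euc q × ℝ)) y ≤ s₁ := by
      rw [dist_self_add_left, Prod.norm_def, norm_zero, Real.norm_eq_abs]
      exact max_le hs₁.le ha
    have h2 := dist_triangle (y + ((0, a) : Euc q × ℝ)) y (B z)
    have h3 := Metric.mem_ball.1 hy
    rw [Metric.mem_ball]
    linarith
  have hzball : B z ∈ Metric.ball (B z) (r / 2) := Metric.mem_ball_self (by positivity)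
  refine ⟨s₁ / 2, by positivity, fun z₂ W hW => ?_⟩
  obtain ⟨V₂, hV₂, η₂, hη₂, hslow₂⟩ := exists_isHG_mem_of_speedSq_lt H z₂ hW
  -- Slow geodesics that start at height about `(B z).2 + a` end near this height. It is used for `a
  -- = s₁` and `a = -s₁`, according to the direction of `ℓ`.
  have hside : ∀ a : ℝ, |a| ≤ s₁ → ∃ V ∈ 𝓝 z, ∃ η > (0 : ℝ), ∀ x ∈ V, ∀ γ, c.IsHG g h γ univ →
      γ 0 = B.symm (B x + (0, a)) → speedSq g γ 0 < η →
      γ 1 ∈ B.source ∧ |(B (γ 1)).2 - ((B z).2 + a)| < s₁ / 8 := by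
    intro a ha
    have hat := (hball (hmove _ hzball a ha)).1
    have hm := B.map_target hat
    have h1 : ∀ᶠ x in 𝓝 (B.symm (B z + (0, a))), x ∈ B.source := B.open_source.mem_nhds hm
    have h2 : ∀ᶠ x in 𝓝 (B.symm (B z + (0, a))), |(B x).2 - ((B z).2 + a)| < s₁ / 8 := by
      have h3 : ContinuousAt (fun x => |(B x).2 - ((B z).2 + a)|) (B.symm (B z + (0, a))) :=
        ((B.continuousAt hm).snd.sub continuousAt_const).abs
      refine h3.eventually_lt_const ?_
      beta_reduce
      rw [B.right_inv hat]
      simp [hs₁]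
    obtain ⟨V, hV, η, hη, hslow⟩ := exists_isHG_mem_of_speedSq_lt H _ (h1.and h2)
    have h4 : ContinuousAt (fun x => B.symm (B x + (0, a))) z :=
      ContinuousAt.comp (g := B.symm) (f := fun x => B x + (0, a)) (B.continuousAt_symm hat)
        ((B.continuousAt hz).add continuousAt_const)
    refine ⟨_, h4.preimage_mem_nhds hV, η, hη, fun x hx γ hγ h0 hs => ?_⟩
    exact hslow γ hγ (by rw [h0]; exact hx) hs 1 ⟨zero_le_one, le_rfl⟩
  obtain ⟨P, hP, η₃, hη₃, hside₃⟩ := hside s₁ (by rw [abs_of_pos hs₁])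
  obtain ⟨Q, hQ, η₄, hη₄, hside₄⟩ := hside (-s₁) (by rw [abs_neg, abs_of_pos hs₁])
  have hV₀ : B.source ∩ {x | |(B x).2 - (B z).2| < s₁ / 8} ∈ 𝓝 z := by
    refine Filter.inter_mem (B.open_source.mem_nhds hz) ?_
    have h3 : ContinuousAt (fun x => |(B x).2 - (B z).2|) z :=
      ((B.continuousAt hz).snd.sub continuousAt_const).abs
    exact h3.eventually_lt_const (by simp [hs₁])
  obtain ⟨η, hη, hηη₁, hηη₂, hηη₃, hηη₄⟩ : ∃ η > 0, η ≤ η₁ ∧ η ≤ η₂ ∧ η ≤ η₃ ∧ η ≤ η₄ :=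
    ⟨min (min η₁ η₂) (min η₃ η₄), by positivity, (min_le_left _ _).trans (min_le_left _ _),
      (min_le_left _ _).trans (min_le_right _ _), (min_le_right _ _).trans (min_le_left _ _),
      (min_le_right _ _).trans (min_le_right _ _)⟩
  obtain ⟨V', hV', hjoin⟩ := exists_isHG_to_plaque H hcomp hi hη hV₀
  have hVb : B ⁻¹' Metric.ball (B z) (r / 2) ∈ 𝓝 z :=
    (B.continuousAt hz).preimage_mem_nhds (Metric.ball_mem_nhds _ (by positivity))
  refine ⟨V' ∩ (B.source ∩ {x | |(B x).2 - (B z).2| < s₁ / 8}) ∩ B ⁻¹' Metric.ball (B z) (r / 2)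
    ∩ (P ∩ Q), Filter.inter_mem (Filter.inter_mem (Filter.inter_mem hV' hV₀) hVb)
    (Filter.inter_mem hP hQ), V₂, hV₂, ?_⟩
  rintro ℓ ℓ' ε T hℓ hℓ' ⟨⟨⟨h1, h2⟩, h3⟩, h4, h5⟩ ⟨⟨⟨h1', h2'⟩, h3'⟩, h4', h5'⟩ hd hd' hT hℓT
  obtain ⟨γ, hγ, hγ0, hγη, hγV, hγ1⟩ := hjoin _ h1 _ h1'
  have hT0 : 0 ≤ T := by linarith
  obtain ⟨Γ, hΓ, hΓ0⟩ := exists_isSlide H hcomp hℓ.isLeafCurveOn hγ hγ0 hT0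
  have hleaf := hΓ.isLeafCurveOn H hℓ.isLeafCurveOn 1
  have hsp : ∀ s ∈ Icc 0 T, speedSq g (Γ s) 0 < η := fun s hs => by
    rw [hΓ.speedSq_eq H hs, hΓ0]
    exact hγη
  have hsub : Icc 0 s₁ ⊆ Icc 0 T := Icc_subset_Icc le_rfl (by linarith)
  have hεabs : |ε| = 1 := by rcases hd.sign with rfl | rfl <;> simp
  have hℓs : ∀ s ∈ Icc 0 s₁, ℓ s = B.symm (B (ℓ 0) + (0, ε * s)) ∧ ℓ s ∈ N := by
    intro s hs
    have h6 := hball (hmove _ h3 (ε * s) (by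
      rw [abs_mul, hεabs, one_mul, abs_of_nonneg hs.1]; exact hs.2))
    have h7 := (hℓ.eq_of_mem_target hρ (mem_univ 0) hB hd (mem_univ s)
      (by rw [sub_zero]; exact h6.1)).1
    rw [sub_zero] at h7
    exact ⟨h7, h7 ▸ h6.2⟩
  have hΓB : ∀ s ∈ Icc 0 s₁, Γ s 1 ∈ B.source := fun s hs =>
    hslow₁ _ (hΓ.isHG s) (by rw [hΓ.apply_zero s (hsub hs)]; exact (hℓs s hs).2)
      ((hsp s (hsub hs)).trans_le hηη₁) 1 ⟨zero_le_one, le_rfl⟩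
  have hs₁m : s₁ ∈ Icc 0 s₁ := right_mem_Icc.2 hs₁.le
  have h0m : (0 : ℝ) ∈ Icc 0 s₁ := left_mem_Icc.2 hs₁.le
  have hγB : γ 1 ∈ B.source := (hγV 1 ⟨zero_le_one, le_rfl⟩).1
  have hγh : |(B (γ 1)).2 - (B z).2| < s₁ / 8 := (hγV 1 ⟨zero_le_one, le_rfl⟩).2
  have hend : |(B (Γ s₁ 1)).2 - ((B z).2 + ε * s₁)| < s₁ / 8 := by
    have h6 := (hΓ.apply_zero s₁ (hsub hs₁m)).trans (hℓs s₁ hs₁m).1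
    rcases hd.sign with rfl | rfl
    · rw [one_mul] at h6 ⊢
      exact (hside₃ _ h4 _ (hΓ.isHG s₁) h6 ((hsp _ (hsub hs₁m)).trans_le hηη₃)).2
    · rw [neg_one_mul] at h6 ⊢
      exact (hside₄ _ h5 _ (hΓ.isHG s₁) h6 ((hsp _ (hsub hs₁m)).trans_le hηη₄)).2
  have hπ : c.π i (Γ s₁ 1) = c.π i (ℓ' 0) := by
    rw [(hleaf.mono hsub).π_eq isPreconnected_Icc (fun s hs => hB.subset (hΓB s hs)) h0m hs₁m,
      hΓ0, hγ1]
  have e1 := hℓ'.eq_of_fst_eq hρ hB hd' hγB (by rw [hB.fst_eq _ hγB, hB.fst_eq _ hd'.mem, hγ1])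
  have e2 := hℓ'.eq_of_fst_eq hρ hB hd' (hΓB s₁ hs₁m)
    (by rw [hB.fst_eq _ (hΓB s₁ hs₁m), hB.fst_eq _ hd'.mem, hπ])
  -- The endpoints of the slide run along the leaf of `ℓ'`; `θ` is their arc length parameter.
  obtain ⟨θ, hθc, hθ0, hθ⟩ := hℓ'.exists_lift hρ hT0 hleaf
    (t₀ := 0 + ε * ((B (γ 1)).2 - (B (ℓ' 0)).2)) (by rw [hΓ0]; exact e1.symm)
  have hθs₁ : θ s₁ = 0 + ε * ((B (Γ s₁ 1)).2 - (B (ℓ' 0)).2) :=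
    hinj ℓ' hℓ' (by rw [← hθ s₁ (hsub hs₁m), ← e2])
  have h6 : |(B (ℓ' 0)).2 - (B z).2| < s₁ / 8 := h2'.2
  -- The heights are known up to errors of `s₁ / 8`, so `θ` starts below `s₁ / 4` and has passed `3
  -- * s₁ / 4` at `s₁`; the threshold `s₁ / 2` lies between.
  have hlow : s₁ / 2 ≤ θ s₁ := by
    rw [hθs₁, zero_add]
    rw [abs_lt] at h6 hend
    rcases hd.sign with rfl | rfl <;> linarith
  have hup : θ 0 < s₁ / 2 := by
    rw [hθ0, zero_add]
    rw [abs_lt] at h6 hγh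
    rcases hd.sign with rfl | rfl <;> linarith
  -- Nearby geodesics of the slide share their projected jet at time one. If their endpoints
  -- coincide, so do their origins on the injective curve `ℓ`. Thus `θ` is strictly monotone, and
  -- increasing by `hup` and `hlow`.
  have hθinj : InjOn θ (Icc 0 T) := by
    refine hθc.injOn_of_locally_injOn fun s hs => ?_
    obtain ⟨j, hj⟩ := c.exists_mem_U (Γ s 1)
    have h7 : ∀ᶠ r in 𝓝[Icc 0 T] s, Γ r 1 ∈ c.U j :=
      (hleaf.continuousOn s hs).preimage_mem_nhdsWithin ((c.isOpen_U j).mem_nhds hj)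
    refine ⟨_, ((hΓ.eventually_shareJet H hℓ.isLeafCurveOn hs 1).and h7).and self_mem_nhdsWithin,
      ?_⟩
    rintro r ⟨⟨hr1, hr2⟩, hr3⟩ r' ⟨⟨hr1', hr2'⟩, hr3'⟩ he
    have h8 : Γ r 1 = Γ r' 1 := by rw [hθ r hr3, hθ r' hr3', he]
    have h9 : c.ShareJet (Γ r) (Γ r') 1 := hr1.trans hr1'.symm (hΓ.isHG s) (hΓ.isHG r')
      ⟨j, hr2, hj, hr2'⟩ (hΓ.isHG r)
    exact hinj ℓ hℓ (hΓ.eq_of_apply_eq H hr3 hr3' h9 h8)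
  have hTm : T ∈ Icc 0 T := right_mem_Icc.2 hT0
  refine ⟨θ T, ?_, ?_⟩
  · rcases hθc.strictMonoOn_of_injOn_Icc' hT0 hθinj with h7 | h7
    · exact hlow.trans (h7.monotoneOn (hsub hs₁m) hTm (by linarith))
    · have := h7 (left_mem_Icc.2 hT0) (hsub hs₁m) hs₁
      linarith
  · rw [← hθ T hTm]
    exact hslow₂ _ (hΓ.isHG T) (by rw [hΓ.apply_zero T hTm]; exact hℓT)
      ((hsp T hTm).trans_le hηη₂) 1 ⟨zero_le_one, le_rfl⟩

end HaefligerCocycle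

namespace HaefligerCocycle

variable {q : ℕ} {M : Type u} [TopologicalSpace M]
  [ChartedSpace (Euc (q + 1)) M] [IsManifold (𝓡 (q + 1)) ∞ M]
  {c : HaefligerCocycle.{w} (q + 1) q M} {g : SmoothMetric (q + 1) M} {ρ : M → ℝ}
  {h : c.ι → Euc q → Euc q →L[ℝ] Euc q →L[ℝ] ℝ}
  {i j : c.ι} {B B' : OpenPartialHomeomorph M (Euc q × ℝ)} {ℓ m : ℝ → M}
  {t T ε ε' : ℝ}

/-! ### Limit points of the leaves -/

/-- Unit curves depend continuously on the starting point and the direction. -/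
theorem IsUnitCurve.exists_nhds_mem [T2Space M] (hρ : ContMDiff (𝓡 (q + 1)) 𝓘(ℝ, ℝ) ∞ ρ)
    (hm : c.IsUnitCurve g ρ m univ) (hB : c.IsUnitBox g ρ i B) (hd : HasDir B m 0 ε) {W : Set M}
    (hW : W ∈ 𝓝 (m T)) : ∃ V ∈ 𝓝 (m 0), ∀ ℓ t ε', c.IsUnitCurve g ρ ℓ univ → ℓ t ∈ V →
      HasDir B ℓ t ε' → ℓ (t + ε' * ε * T) ∈ W := by
  obtain ⟨j, B', ε₂, hB', hd'⟩ := hm.exists_hasDir T trivial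
  obtain ⟨f, hf, h1⟩ := hm.exists_transfer hρ hB hd T j B' ε₂ hB' hd'
  have h2 : f (m 0) = m T := (h1.self_of_nhds m hm rfl hd).1.symm
  have h3 : ∀ᶠ x in 𝓝 (m 0), f x ∈ W := hf.continuousAt.preimage_mem_nhds (h2 ▸ hW)
  refine ⟨_, h1.and h3, fun ℓ t ε' hℓ ht hdℓ => ?_⟩
  have ha : ε' * ε = 1 ∨ ε' * ε = -1 := by
    rcases hd.sign with rfl | rfl <;> rcases hdℓ.sign with rfl | rfl <;> norm_num
  have h4 : HasDir B (fun s => ℓ (ε' * ε * s + t)) 0 (ε' * ε * ε') :=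
    HasDir.comp_affine ha (by simpa using hdℓ)
  rw [mul_right_comm, hdℓ.sq, one_mul] at h4
  have h6 := (ht.1 _ (hℓ.comp_affine (b := t) ha) (by simp) h4).1
  rw [add_comm, h6]
  exact ht.2

/-- The limit set of a unit curve is saturated. -/
theorem IsUnitCurve.mapClusterPt_of_mem [T2Space M] (hρ : ContMDiff (𝓡 (q + 1)) 𝓘(ℝ, ℝ) ∞ ρ)
    (hℓ : c.IsUnitCurve g ρ ℓ univ) (hm : c.IsUnitCurve g ρ m univ)
    (hz : MapClusterPt (m 0) Filter.atTop ℓ) (s : ℝ) : MapClusterPt (m s) Filter.atTop ℓ := by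
  rw [mapClusterPt_iff_frequently] at hz ⊢
  intro W hW
  obtain ⟨i, B, ε, hB, hd⟩ := hm.exists_hasDir 0 trivial
  obtain ⟨V, hV, h1⟩ := hm.exists_nhds_mem hρ hB hd hW
  rw [Filter.frequently_atTop]
  intro N
  -- The margin `|s|` keeps the shifted time above `N`, in whichever direction `ℓ` passes the box.
  obtain ⟨t, ht, htV, htB⟩ := Filter.frequently_atTop.1
    (hz _ (Filter.inter_mem hV (B.open_source.mem_nhds hd.mem))) (N + |s|)
  obtain ⟨ε', hd'⟩ := hℓ.hasDir hρ (mem_univ t) hB htB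
  refine ⟨_, ?_, h1 ℓ t ε' hℓ htV hd'⟩
  have h2 := abs_le.1 (le_refl |s|)
  rcases hd.sign with rfl | rfl <;> rcases hd'.sign with rfl | rfl <;> simp <;> linarith

/-- The points of the limit set of a unit curve are recurrent. -/
theorem IsUnitCurve.mapClusterPt_self [T2Space M] (H : c.Induces g h)
    (hcomp : c.IsTransversallyCompleteMetric g) (hρ : ContMDiff (𝓡 (q + 1)) 𝓘(ℝ, ℝ) ∞ ρ)
    (hinj : ∀ ℓ, c.IsUnitCurve g ρ ℓ univ → Function.Injective ℓ)
    (hℓ : c.IsUnitCurve g ρ ℓ univ) (hm : c.IsUnitCurve g ρ m univ)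
    (hz : MapClusterPt (m 0) Filter.atTop ℓ) : MapClusterPt (m 0) Filter.atTop m := by
  obtain ⟨i, B, ε, hB, hd⟩ := hm.exists_hasDir 0 trivial
  obtain ⟨τ, hτ, hE⟩ := exists_nhds_unitCurve_meets H hcomp hρ hinj hB hd.mem one_pos
  have key : ∀ W ∈ 𝓝 (m 0), ∃ T, τ ≤ T ∧ m T ∈ W := by
    intro W hW
    obtain ⟨V₁, hV₁, V₂, hV₂, h1⟩ := hE _ W hW
    rw [mapClusterPt_iff_frequently] at hz
    have h2 := Filter.frequently_atTop.1 (hz _ (Filter.inter_mem (Filter.inter_mem hV₁ hV₂)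
      (B.open_source.mem_nhds hd.mem)))
    -- Three passages of `ℓ` near `m 0`, at least one unit of time apart. From the middle one,
    -- running in the direction of `m` leads to the third or, if `ℓ` passes in the opposite
    -- direction, to the first.
    obtain ⟨t₁, -, ⟨-, h₁⟩, -⟩ := h2 0
    obtain ⟨t₂, ht₂, ⟨h₂, -⟩, hB₂⟩ := h2 (t₁ + 1)
    obtain ⟨t₃, ht₃, ⟨-, h₃⟩, -⟩ := h2 (t₂ + 1)
    obtain ⟨ε₂, hd₂⟩ := hℓ.hasDir hρ (mem_univ t₂) hB hB₂
    have ha : ε₂ * ε = 1 ∨ ε₂ * ε = -1 := by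
      rcases hd.sign with rfl | rfl <;> rcases hd₂.sign with rfl | rfl <;> norm_num
    have h4 : HasDir B (fun s => ℓ (ε₂ * ε * s + t₂)) 0 (ε₂ * ε * ε₂) :=
      HasDir.comp_affine ha (by simpa using hd₂)
    rw [mul_right_comm, hd₂.sq, one_mul] at h4
    have h5 := hℓ.comp_affine (b := t₂) ha
    have h6 := mem_of_mem_nhds hV₁
    rcases ha with ha | ha
    · exact h1 _ m ε (t₃ - t₂) h5 hm (by simpa using h₂) h6 h4 hd (by linarith) (by simpa [ha])
    · exact h1 _ m ε (t₂ - t₁) h5 hm (by simpa using h₂) h6 h4 hd (by linarith) (by simpa [ha])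
  rw [mapClusterPt_iff_frequently]
  intro W hW
  rw [Filter.frequently_atTop]
  intro N
  -- By injectivity the compact arc `m '' Icc τ N` avoids `m 0`. Removing it from `W` makes the
  -- return time exceed `N`.
  have h3 : m 0 ∉ m '' Icc τ N := by
    rintro ⟨s, hs, he⟩
    have := hinj m hm he
    linarith [hs.1]
  obtain ⟨T, hT, hTW, hTN⟩ := key _ (Filter.inter_mem hW
    (((isCompact_Icc.image hm.continuous).isClosed.isOpen_compl).mem_nhds h3))
  exact ⟨T, le_of_not_ge fun hN => hTN ⟨T, ⟨hT, hN⟩, rfl⟩, hTW⟩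

/-- A unit curve has no limit point whose leaf is not relatively compact. -/
theorem IsUnitCurve.isCompact_closure_of_mapClusterPt [T2Space M] (H : c.Induces g h)
    (hcomp : c.IsTransversallyCompleteMetric g) (hρ : ContMDiff (𝓡 (q + 1)) 𝓘(ℝ, ℝ) ∞ ρ)
    (hρK : ∀ R, IsCompact {x | ρ x ≤ R})
    (hinj : ∀ ℓ, c.IsUnitCurve g ρ ℓ univ → Function.Injective ℓ)
    (hℓ : c.IsUnitCurve g ρ ℓ univ) {z : M} (hz : MapClusterPt z Filter.atTop ℓ) :
    IsCompact (closure (c.leaf z)) := by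
  have : LocallyCompactSpace M := ChartedSpace.locallyCompactSpace (Euc (q + 1)) M
  obtain ⟨K, hK, hzK⟩ := exists_compact_mem_nhds z
  -- The single leaf of `ℓ` passes close both to `w` and to `z`, so the leaf of `w` comes close to
  -- `z` as well.
  have hmeet : ∀ w, MapClusterPt w Filter.atTop ℓ → (c.leaf w ∩ interior K).Nonempty := by
    intro w hw
    obtain ⟨V₁, hV₁, V₂, hV₂, h1⟩ :=
      exists_nhds_leaf_meets H hcomp hρ hρK w z (interior_mem_nhds.2 hzK)
    rw [mapClusterPt_iff_frequently] at hw hz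
    obtain ⟨s, hs⟩ := (hw _ hV₁).exists
    obtain ⟨t, ht⟩ := (hz _ hV₂).exists
    refine h1 (ℓ s) hs w (mem_of_mem_nhds hV₁) (ℓ t) ⟨?_, ht⟩
    rw [hℓ.leaf_eq_range hρ]
    exact mem_range_self t
  have hret : ∀ m, c.IsUnitCurve g ρ m univ → MapClusterPt (m 0) Filter.atTop ℓ →
      ∃ T, 0 < T ∧ m T ∈ interior K := by
    intro m hm hw
    obtain ⟨y, hy, hyK⟩ := hmeet _ hw
    rw [hm.leaf_eq_range hρ] at hy
    obtain ⟨s, rfl⟩ := hy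
    have hms : c.IsUnitCurve g ρ (fun t => m (1 * t + s)) univ := hm.comp_affine (Or.inl rfl)
    have h1 := hℓ.mapClusterPt_self H hcomp hρ hinj hms
      (by simpa using hℓ.mapClusterPt_of_mem hρ hm hw s)
    rw [mapClusterPt_iff_frequently] at h1
    obtain ⟨T, hT, hTK⟩ := Filter.frequently_atTop.1
      (h1 _ (isOpen_interior.mem_nhds (by simpa using hyK))) (1 - s)
    exact ⟨1 * T + s, by linarith, hTK⟩
  have hX : IsCompact (K ∩ {w | MapClusterPt w Filter.atTop ℓ}) :=
    hK.inter_right isClosed_setOfPred_clusterPt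
  -- Returns to the interior of `K` are stable under small changes of the starting point, so the
  -- return time is locally bounded, and bounded on a compact set. Both directions along the leaf
  -- must be covered.
  obtain ⟨τ, hτ⟩ : ∃ τ, ∀ m t, c.IsUnitCurve g ρ m univ →
      m t ∈ K ∩ {w | MapClusterPt w Filter.atTop ℓ} → ∃ T, 0 < T ∧ T ≤ τ ∧ m (t + T) ∈ K := by
    refine hX.induction_on (p := fun S => ∃ τ, ∀ m t, c.IsUnitCurve g ρ m univ → m t ∈ S →
      ∃ T, 0 < T ∧ T ≤ τ ∧ m (t + T) ∈ K) ⟨0, fun _ _ _ h => h.elim⟩ ?_ ?_ ?_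
    · rintro S S' hS ⟨τ, h1⟩
      exact ⟨τ, fun m t hm ht => h1 m t hm (hS ht)⟩
    · rintro S S' ⟨τ, h1⟩ ⟨τ', h2⟩
      refine ⟨max τ τ', fun m t hm ht => ?_⟩
      rcases ht with ht | ht
      · obtain ⟨T, h3, h4, h5⟩ := h1 m t hm ht
        exact ⟨T, h3, h4.trans (le_max_left _ _), h5⟩
      · obtain ⟨T, h3, h4, h5⟩ := h2 m t hm ht
        exact ⟨T, h3, h4.trans (le_max_right _ _), h5⟩
    · rintro w ⟨-, hw⟩
      obtain ⟨i, hi⟩ := c.exists_mem_U w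
      obtain ⟨B, hB, hwB⟩ := exists_isUnitBox hρ g hi
      obtain ⟨m, hm, rfl, hd⟩ := exists_isUnitCurve hρ hρK hB hwB (Or.inl rfl)
      obtain ⟨T, hT, hTK⟩ := hret m hm hw
      obtain ⟨T', hT', hTK'⟩ := hret _ (hm.comp_affine (a := -1) (b := 0) (Or.inr rfl))
        (by simpa using hw)
      obtain ⟨V, hV, h1⟩ := hm.exists_nhds_mem hρ hB hd (isOpen_interior.mem_nhds hTK)
      obtain ⟨V', hV', h2⟩ := hm.exists_nhds_mem hρ hB hd (isOpen_interior.mem_nhds hTK')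
      refine ⟨_, mem_nhdsWithin_of_mem_nhds
        (Filter.inter_mem (Filter.inter_mem hV hV') (B.open_source.mem_nhds hwB)),
        max T T', fun m' t hm' ht => ?_⟩
      obtain ⟨ε', hd'⟩ := hm'.hasDir hρ (mem_univ t) hB ht.2
      rcases hd'.sign with rfl | rfl
      · refine ⟨T, hT, le_max_left _ _, interior_subset ?_⟩
        simpa using h1 m' t 1 hm' ht.1.1 hd'
      · refine ⟨T', hT', le_max_right _ _, interior_subset ?_⟩
        simpa using h2 m' t (-1) hm' ht.1.2 hd'
  obtain ⟨R, hR⟩ := (hK.image hρ.continuous).bddAbove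
  have hbound : ∀ m, c.IsUnitCurve g ρ m univ → m 0 = z → ∀ t, 0 ≤ t → ρ (m t) ≤ R + τ := by
    intro m hm h0 t ht
    have hS : IsCompact (Icc 0 t ∩ m ⁻¹' K) :=
      isCompact_Icc.inter_right (hK.isClosed.preimage hm.continuous)
    -- At the last visit `s` to `K` before time `t`, the next return within time `τ` comes after
    -- `t`. So `t - s < τ`, and `ρ` has grown by at most `τ` since.
    obtain ⟨s, ⟨hs, hsK⟩, hmax⟩ := hS.exists_isGreatest
      ⟨0, ⟨le_rfl, ht⟩, by simpa [h0] using mem_of_mem_nhds hzK⟩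
    obtain ⟨T, hT, hTτ, hTK⟩ := hτ m s hm ⟨hsK, hℓ.mapClusterPt_of_mem hρ hm (h0 ▸ hz) s⟩
    have h1 : t < s + T := by
      by_contra! h1
      have := hmax ⟨⟨by linarith [hs.1], h1⟩, hTK⟩
      linarith
    have h2 := hm.abs_sub_le hρ (mem_univ s) (mem_univ t)
    rw [abs_of_nonneg (sub_nonneg.2 hs.2)] at h2
    have h3 := hR (mem_image_of_mem ρ hsK)
    linarith [le_abs_self (ρ (m t) - ρ (m s))]
  obtain ⟨m, hm, h0⟩ := exists_isUnitCurve_through hρ hρK c g z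
  refine (hρK (R + τ)).of_isClosed_subset isClosed_closure
    (closure_minimal ?_ (hρK _).isClosed)
  rw [← h0, hm.leaf_eq_range hρ]
  rintro _ ⟨t, rfl⟩
  rcases le_total 0 t with ht | ht
  · exact hbound m hm h0 t ht
  · simpa using hbound _ (hm.comp_affine (a := -1) (b := 0) (Or.inr rfl)) (by simpa using h0)
      (-t) (by linarith)

/-- If no leaf is relatively compact, then unit curves are injective. -/
theorem IsUnitCurve.injective [T2Space M] (hρ : ContMDiff (𝓡 (q + 1)) 𝓘(ℝ, ℝ) ∞ ρ)
    (hA : ∀ x, ¬ IsCompact (closure (c.leaf x))) (hℓ : c.IsUnitCurve g ρ ℓ univ) :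
    Function.Injective ℓ := by
  by_contra hn
  have h1 := hℓ.isCompact_range hρ hn
  refine hA (ℓ 0) ?_
  rwa [hℓ.leaf_eq_range hρ, h1.isClosed.closure_eq]

/-- If no leaf is relatively compact, then unit curves are properly embedded. -/
theorem IsUnitCurve.isClosedEmbedding [T2Space M] (H : c.Induces g h)
    (hcomp : c.IsTransversallyCompleteMetric g) (hρ : ContMDiff (𝓡 (q + 1)) 𝓘(ℝ, ℝ) ∞ ρ)
    (hρK : ∀ R, IsCompact {x | ρ x ≤ R}) (hA : ∀ x, ¬ IsCompact (closure (c.leaf x)))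
    (hℓ : c.IsUnitCurve g ρ ℓ univ) : Topology.IsClosedEmbedding ℓ := by
  have : LocallyCompactSpace M := ChartedSpace.locallyCompactSpace (Euc (q + 1)) M
  have htop : ∀ ℓ, c.IsUnitCurve g ρ ℓ univ →
      Filter.Tendsto ℓ Filter.atTop (Filter.cocompact M) := by
    intro ℓ hℓ
    rw [(Filter.hasBasis_cocompact).tendsto_right_iff]
    intro K hK
    by_contra hn
    obtain ⟨z, -, hz⟩ := hK.exists_mapClusterPt_of_frequently
      (fun h => hn h)
    exact hA z (hℓ.isCompact_closure_of_mapClusterPt H hcomp hρ hρK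
      (fun m hm => hm.injective hρ hA) hz)
  refine Topology.IsClosedEmbedding.of_continuous_injective_isClosedMap hℓ.continuous
    (hℓ.injective hρ hA) (isProperMap_iff_tendsto_cocompact.2 ⟨hℓ.continuous, ?_⟩).isClosedMap
  rw [cocompact_eq_atBot_atTop, Filter.tendsto_sup]
  refine ⟨?_, htop ℓ hℓ⟩
  -- The behaviour at `-∞` is that of the reversed curve at `+∞`.
  have h1 := (htop _ (hℓ.comp_affine (a := -1) (b := 0) (Or.inr rfl))).comp
    Filter.tendsto_neg_atBot_atTop
  refine h1.congr fun t => ?_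
  simp

theorem isClosed_leaf [T2Space M] (H : c.Induces g h)
    (hcomp : c.IsTransversallyCompleteMetric g) (hρ : ContMDiff (𝓡 (q + 1)) 𝓘(ℝ, ℝ) ∞ ρ)
    (hρK : ∀ R, IsCompact {x | ρ x ≤ R}) (hA : ∀ x, ¬ IsCompact (closure (c.leaf x))) (x : M) :
    IsClosed (c.leaf x) := by
  obtain ⟨ℓ, hℓ, rfl⟩ := exists_isUnitCurve_through hρ hρK c g x
  rw [hℓ.leaf_eq_range hρ]
  exact (hℓ.isClosedEmbedding H hcomp hρ hρK hA).isClosed_range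

/-- Different leaves have disjoint saturated neighbourhoods. -/
theorem exists_nhds_disjoint_leaf [T2Space M] (H : c.Induces g h)
    (hcomp : c.IsTransversallyCompleteMetric g) (hρ : ContMDiff (𝓡 (q + 1)) 𝓘(ℝ, ℝ) ∞ ρ)
    (hρK : ∀ R, IsCompact {x | ρ x ≤ R}) (hA : ∀ x, ¬ IsCompact (closure (c.leaf x))) {x y : M}
    (hxy : y ∉ c.leaf x) : ∃ V ∈ 𝓝 x, ∃ W ∈ 𝓝 y, ∀ x' ∈ V, ∀ y' ∈ W, y' ∉ c.leaf x' := by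
  obtain ⟨V, hV, W, hW, h1⟩ := exists_nhds_leaf_meets H hcomp hρ hρK x y
    ((isClosed_leaf H hcomp hρ hρK hA x).isOpen_compl.mem_nhds hxy)
  refine ⟨V, hV, W, hW, fun x' hx' y' hy' hmem => ?_⟩
  obtain ⟨z, hz, hz'⟩ := h1 x' hx' x (mem_of_mem_nhds hV) y' ⟨hmem, hy'⟩
  exact hz' hz

/-- Near a point, each leaf meets a unit flow box in at most one plaque. -/
theorem IsUnitBox.exists_nhds_fst_eq [T2Space M] (H : c.Induces g h)
    (hcomp : c.IsTransversallyCompleteMetric g) (hρ : ContMDiff (𝓡 (q + 1)) 𝓘(ℝ, ℝ) ∞ ρ)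
    (hρK : ∀ R, IsCompact {x | ρ x ≤ R}) (hA : ∀ x, ¬ IsCompact (closure (c.leaf x)))
    (hB : c.IsUnitBox g ρ i B) {z : M} (hz : z ∈ B.source) :
    ∃ V ∈ 𝓝 z, ∀ x ∈ V, ∀ x' ∈ V, x' ∈ c.leaf x → (B x).1 = (B x').1 := by
  obtain ⟨r, hr, hrB⟩ := Metric.isOpen_iff.1 B.open_target _ (B.map_source hz)
  have hinj : ∀ m, c.IsUnitCurve g ρ m univ → Function.Injective m :=
    fun m hm => hm.injective hρ hA
  obtain ⟨τ, hτ, hE⟩ := exists_nhds_unitCurve_meets H hcomp hρ hinj hB hz (half_pos hr)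
  obtain ⟨m, hm, rfl, hd⟩ := exists_isUnitCurve hρ hρK hB hz (Or.inl rfl)
  -- The part of the leaf of `z` at arc length at least `τ` from `z` is closed because the leaf is
  -- properly embedded, and it misses `z`.
  have hclosed : IsClosed (m '' {t | τ ≤ |t|}) :=
    (hm.isClosedEmbedding H hcomp hρ hρK hA).isClosedMap _
      (isClosed_le continuous_const continuous_abs)
  have h0 : m 0 ∉ m '' {t | τ ≤ |t|} := by
    rintro ⟨s, hs, he⟩
    obtain rfl := hinj m hm he
    rw [mem_ofPred_eq, abs_zero] at hs
    linarith
  obtain ⟨V₁, hV₁, V₂, hV₂, h1⟩ := hE _ _ (hclosed.isOpen_compl.mem_nhds h0)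
  refine ⟨V₁ ∩ V₂ ∩ (B.source ∩ B ⁻¹' Metric.ball (B (m 0)) (r / 2)),
    Filter.inter_mem (Filter.inter_mem hV₁ hV₂) (Filter.inter_mem (B.open_source.mem_nhds hz)
      ((B.continuousAt hz).preimage_mem_nhds (Metric.ball_mem_nhds _ (half_pos hr)))), ?_⟩
  intro x hx x' hx' hmem
  obtain ⟨ℓ, hℓ, rfl, hdℓ⟩ := exists_isUnitCurve hρ hρK hB hx.2.1 (Or.inl rfl)
  rw [hℓ.leaf_eq_range hρ] at hmem
  obtain ⟨t, rfl⟩ := hmem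
  -- A short arc stays in the box and in one plaque. A long arc from `x` to `x'` would force `m` to
  -- take, after time `τ`, a value outside the set `m '' {t | τ ≤ |t|}`; for negative `t` both
  -- curves are reversed.
  rcases lt_or_ge |t| (r / 2) with ht | ht
  · have h2 : B (ℓ 0) + (0, 1 * (t - 0)) ∈ B.target := by
      refine hrB ?_
      rw [mem_ball_iff_norm, add_sub_right_comm]
      have h3 : ‖B (ℓ 0) - B (m 0)‖ < r / 2 := mem_ball_iff_norm.1 hx.2.2
      have h4 : ‖((0, 1 * (t - 0)) : Euc q × ℝ)‖ < r / 2 := by simpa using ht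
      linarith [norm_add_le (B (ℓ 0) - B (m 0)) ((0, 1 * (t - 0)) : Euc q × ℝ)]
    rw [(hℓ.eq_of_mem_target hρ (mem_univ 0) hB hdℓ (mem_univ t) h2).1, B.right_inv h2]
    simp
  · exfalso
    rcases le_abs.1 ht with ht | ht
    · obtain ⟨T, hT, hn⟩ := h1 ℓ m 1 t hℓ hm hx.1.1 (mem_of_mem_nhds hV₁) hdℓ hd ht hx'.1.2
      exact hn ⟨T, hT.trans (le_abs_self T), rfl⟩
    · have ha : (-1 : ℝ) = 1 ∨ (-1 : ℝ) = -1 := Or.inr rfl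
      obtain ⟨T, hT, hn⟩ := h1 _ _ (-1) (-t) (hℓ.comp_affine (b := 0) ha)
        (hm.comp_affine (b := 0) ha) (by simpa using hx.1.1)
        (by simpa using mem_of_mem_nhds hV₁)
        (by simpa using HasDir.comp_affine (b := 0) (t := 0) ha (by simpa using hdℓ))
        (by simpa using HasDir.comp_affine (b := 0) (t := 0) ha (by simpa using hd)) ht
        (by simpa using hx'.1.2)
      refine hn ⟨-1 * T + 0, ?_, rfl⟩
      rw [mem_ofPred_eq, show -1 * T + 0 = -T by ring, abs_neg]
      exact hT.trans (le_abs_self T)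

end HaefligerCocycle

namespace HaefligerCocycle

variable {q : ℕ} {M : Type u} [TopologicalSpace M]
  [ChartedSpace (Euc (q + 1)) M] [IsManifold (𝓡 (q + 1)) ∞ M]

/-! ### The space of leaves -/

/-- The space of leaves. -/
abbrev LeafSpace (c : HaefligerCocycle.{w} (q + 1) q M) : Type u :=
  Quotient (Setoid.ker c.leaf)

/-- The projection onto the space of leaves. -/
def toLeafSpace (c : HaefligerCocycle.{w} (q + 1) q M) (x : M) : c.LeafSpace :=
  Quotient.mk _ x

theorem toLeafSpace_eq_iff (c : HaefligerCocycle.{w} (q + 1) q M) {x y : M} :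
    c.toLeafSpace x = c.toLeafSpace y ↔ c.leaf x = c.leaf y :=
  Quotient.eq (r := Setoid.ker c.leaf)

theorem surjective_toLeafSpace (c : HaefligerCocycle.{w} (q + 1) q M) :
    Function.Surjective c.toLeafSpace :=
  Quotient.mk_surjective

theorem continuous_toLeafSpace (c : HaefligerCocycle.{w} (q + 1) q M) :
    Continuous c.toLeafSpace :=
  continuous_quotient_mk'

variable {c : HaefligerCocycle.{w} (q + 1) q M} {g : SmoothMetric (q + 1) M} {ρ : M → ℝ}
  {h : c.ι → Euc q → Euc q →L[ℝ] Euc q →L[ℝ] ℝ}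
  {i j : c.ι} {B B' : OpenPartialHomeomorph M (Euc q × ℝ)} {ℓ m : ℝ → M}
  {t T ε ε' : ℝ}

theorem mem_leaf_iff [T2Space M] (hρ : ContMDiff (𝓡 (q + 1)) 𝓘(ℝ, ℝ) ∞ ρ)
    (hρK : ∀ R, IsCompact {x | ρ x ≤ R}) (g : SmoothMetric (q + 1) M) {x y : M} :
    y ∈ c.leaf x ↔ c.leaf y = c.leaf x :=
  ⟨leaf_eq_of_mem hρ hρK g, fun h => h ▸ mem_leaf_self hρ hρK c g y⟩

/-- Points of a leaf are joined by a smooth local map that preserves the leaves. -/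
theorem exists_contMDiffAt_leaf_eq [T2Space M] (hρ : ContMDiff (𝓡 (q + 1)) 𝓘(ℝ, ℝ) ∞ ρ)
    (hρK : ∀ R, IsCompact {x | ρ x ≤ R}) (g : SmoothMetric (q + 1) M) {x x' : M}
    (hx : c.leaf x' = c.leaf x) : ∃ f : M → M, ContMDiffAt (𝓡 (q + 1)) (𝓡 (q + 1)) ∞ f x ∧
      f x = x' ∧ ∀ᶠ y in 𝓝 x, c.leaf (f y) = c.leaf y := by
  obtain ⟨i, hi⟩ := c.exists_mem_U x
  obtain ⟨B, hB, hxB⟩ := exists_isUnitBox hρ g hi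
  obtain ⟨ℓ, hℓ, rfl, hd⟩ := exists_isUnitCurve hρ hρK hB hxB (Or.inl rfl)
  have h1 := (mem_leaf_iff hρ hρK g).2 hx
  rw [hℓ.leaf_eq_range hρ] at h1
  obtain ⟨t, rfl⟩ := h1
  obtain ⟨j, B', ε', hB', hd'⟩ := hℓ.exists_hasDir t trivial
  obtain ⟨f, hf, h2⟩ := hℓ.exists_transfer hρ hB hd t j B' ε' hB' hd'
  refine ⟨f, hf, (h2.self_of_nhds ℓ hℓ rfl hd).1.symm, ?_⟩
  have h3 : ∀ᶠ y in 𝓝 (ℓ 0), y ∈ B.source := B.open_source.mem_nhds hxB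
  filter_upwards [h2, h3] with y hy hyB
  obtain ⟨m, hm, rfl, hdm⟩ := exists_isUnitCurve hρ hρK hB hyB (Or.inl rfl)
  rw [← (hy m hm rfl hdm).1, hm.leaf_eq_range hρ, hm.leaf_eq_range hρ]

/-- The saturation of an open set is open: continuous local maps that preserve the leaves carry
neighbourhoods of its points into the given set. -/
theorem isOpenMap_toLeafSpace [T2Space M] (hρ : ContMDiff (𝓡 (q + 1)) 𝓘(ℝ, ℝ) ∞ ρ)
    (hρK : ∀ R, IsCompact {x | ρ x ≤ R}) (g : SmoothMetric (q + 1) M) :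
    IsOpenMap c.toLeafSpace := by
  intro U hU
  have hq : Topology.IsQuotientMap c.toLeafSpace := isQuotientMap_quotient_mk'
  rw [← hq.isOpen_preimage, isOpen_iff_mem_nhds]
  rintro x ⟨x', hx', he⟩
  obtain ⟨f, hf, rfl, h1⟩ := exists_contMDiffAt_leaf_eq hρ hρK g (c.toLeafSpace_eq_iff.1 he)
  filter_upwards [h1, hf.continuousAt.preimage_mem_nhds (hU.mem_nhds hx')] with y h2 h3
  exact ⟨f y, h3, c.toLeafSpace_eq_iff.2 h2⟩

theorem t2Space_leafSpace [T2Space M] (H : c.Induces g h)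
    (hcomp : c.IsTransversallyCompleteMetric g) (hρ : ContMDiff (𝓡 (q + 1)) 𝓘(ℝ, ℝ) ∞ ρ)
    (hρK : ∀ R, IsCompact {x | ρ x ≤ R}) (hA : ∀ x, ¬ IsCompact (closure (c.leaf x))) :
    T2Space c.LeafSpace := by
  refine ⟨fun a b hab => ?_⟩
  obtain ⟨x, rfl⟩ := c.surjective_toLeafSpace a
  obtain ⟨y, rfl⟩ := c.surjective_toLeafSpace b
  have hxy : y ∉ c.leaf x := fun hy =>
    hab (c.toLeafSpace_eq_iff.2 (leaf_eq_of_mem hρ hρK g hy).symm)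
  obtain ⟨V, hV, W, hW, h1⟩ := exists_nhds_disjoint_leaf H hcomp hρ hρK hA hxy
  have ho := isOpenMap_toLeafSpace (c := c) hρ hρK g
  refine ⟨_, _, ho _ isOpen_interior, ho _ isOpen_interior,
    mem_image_of_mem _ (mem_interior_iff_mem_nhds.2 hV),
    mem_image_of_mem _ (mem_interior_iff_mem_nhds.2 hW), ?_⟩
  rw [Set.disjoint_left]
  rintro _ ⟨x', hx', rfl⟩ ⟨y', hy', he⟩
  exact h1 x' (interior_subset hx') y' (interior_subset hy')
    ((mem_leaf_iff hρ hρK g).2 (c.toLeafSpace_eq_iff.1 he))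

/-- `e` is the chart of the space of leaves that is given by the first coordinates of the flow box
`B` on a ball. -/
structure IsLeafChart (c : HaefligerCocycle.{w} (q + 1) q M) (g : SmoothMetric (q + 1) M)
    (ρ : M → ℝ) (e : OpenPartialHomeomorph c.LeafSpace (Euc q)) (i : c.ι)
    (B : OpenPartialHomeomorph M (Euc q × ℝ)) (y₀ : Euc q × ℝ) (r : ℝ) : Prop where
  isUnitBox : c.IsUnitBox g ρ i B
  pos : 0 < r
  ball_subset : Metric.ball y₀ r ⊆ B.target
  target_eq : e.target = Metric.ball y₀.1 r
  mem_source : ∀ y ∈ Metric.ball y₀ r, c.toLeafSpace (B.symm y) ∈ e.source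
  apply_toLeafSpace : ∀ y ∈ Metric.ball y₀ r, e (c.toLeafSpace (B.symm y)) = y.1

/-- In a small flow box, lying on the same leaf means lying on the same plaque. So a transversal of
the box embeds as an open set in the space of leaves, and the chart is the inverse of this
embedding. -/
theorem exists_isLeafChart [T2Space M] (H : c.Induces g h)
    (hcomp : c.IsTransversallyCompleteMetric g) (hρ : ContMDiff (𝓡 (q + 1)) 𝓘(ℝ, ℝ) ∞ ρ)
    (hρK : ∀ R, IsCompact {x | ρ x ≤ R}) (hA : ∀ x, ¬ IsCompact (closure (c.leaf x)))
    (b : c.LeafSpace) : ∃ e i B y₀ r, c.IsLeafChart g ρ e i B y₀ r ∧ b ∈ e.source := by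
  obtain ⟨z, rfl⟩ := c.surjective_toLeafSpace b
  obtain ⟨i, hi⟩ := c.exists_mem_U z
  obtain ⟨B, hB, hz⟩ := exists_isUnitBox hρ g hi
  obtain ⟨V, hV, hVB⟩ := hB.exists_nhds_fst_eq H hcomp hρ hρK hA hz
  have h1 : B.target ∩ B.symm ⁻¹' V ∈ 𝓝 (B z) :=
    Filter.inter_mem (B.open_target.mem_nhds (B.map_source hz))
      ((B.continuousAt_symm (B.map_source hz)).preimage_mem_nhds (by rwa [B.left_inv hz]))
  obtain ⟨r, hr, hball⟩ := Metric.mem_nhds_iff.1 h1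
  have hmem : ∀ v ∈ Metric.ball (B z).1 r, ∀ s ∈ Metric.ball (B z).2 r,
      ((v, s) : Euc q × ℝ) ∈ Metric.ball (B z) r := fun v hv s hs => by
    rw [← ball_prod_same]
    exact ⟨hv, hs⟩
  have hs0 : (B z).2 ∈ Metric.ball (B z).2 r := Metric.mem_ball_self hr
  have hsame : ∀ y ∈ Metric.ball (B z) r, ∀ y' ∈ Metric.ball (B z) r,
      c.toLeafSpace (B.symm y) = c.toLeafSpace (B.symm y') ↔ y.1 = y'.1 := by
    intro y hy y' hy'
    rw [toLeafSpace_eq_iff]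
    constructor
    · intro he
      have h2 := hVB _ (hball hy').2 _ (hball hy).2 ((mem_leaf_iff hρ hρK g).2 he)
      rw [B.right_inv (hball hy).1, B.right_inv (hball hy').1] at h2
      exact h2.symm
    · intro he
      refine leaf_eq_of_fst_eq hρ hρK hB (B.map_target (hball hy).1) (B.map_target (hball hy').1) ?_
      rwa [B.right_inv (hball hy).1, B.right_inv (hball hy').1]
  let σ : Euc q → c.LeafSpace := fun v => c.toLeafSpace (B.symm (v, (B z).2))
  have hinj : InjOn σ (Metric.ball (B z).1 r) := fun v hv v' hv' he =>
    (hsame _ (hmem v hv _ hs0) _ (hmem v' hv' _ hs0)).1 he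
  have hcont : ContinuousOn σ (Metric.ball (B z).1 r) := by
    refine c.continuous_toLeafSpace.comp_continuousOn (B.continuousOn_symm.comp
      (by fun_prop) fun v hv => (hball (hmem v hv _ hs0)).1)
  have hopen : IsOpenMap ((Metric.ball (B z).1 r).domRestrict σ) := by
    intro U hU
    obtain ⟨U', hU', rfl⟩ := isOpen_induced_iff.1 hU
    -- Thickening the transversal set by the leaf coordinate does not change its image and makes it
    -- open in `M`.
    have h2 : (Metric.ball (B z).1 r).domRestrict σ '' (Subtype.val ⁻¹' U') =
        c.toLeafSpace '' (B.symm '' ((U' ∩ Metric.ball (B z).1 r) ×ˢ Metric.ball (B z).2 r)) := by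
      ext a
      constructor
      · rintro ⟨⟨v, hv⟩, hvU, rfl⟩
        exact ⟨_, ⟨(v, (B z).2), ⟨⟨hvU, hv⟩, hs0⟩, rfl⟩, rfl⟩
      · rintro ⟨_, ⟨⟨v, s⟩, ⟨⟨hvU, hv⟩, hs⟩, rfl⟩, rfl⟩
        exact ⟨⟨v, hv⟩, hvU, (hsame _ (hmem v hv _ hs0) _ (hmem v hv s hs)).2 rfl⟩
    rw [h2]
    refine isOpenMap_toLeafSpace hρ hρK g _ (B.symm.isOpen_image_of_subset_source
      ((hU'.inter Metric.isOpen_ball).prod Metric.isOpen_ball) ?_)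
    rintro ⟨v, s⟩ ⟨⟨-, hv⟩, hs⟩
    exact (hball (hmem v hv s hs)).1
  let E := (OpenPartialHomeomorph.ofContinuousOpenRestrict (InjOn.toPartialEquiv σ _ hinj)
    hcont hopen Metric.isOpen_ball).symm
  have hE : ∀ y ∈ Metric.ball (B z) r, c.toLeafSpace (B.symm y) ∈ E.source ∧
      E (c.toLeafSpace (B.symm y)) = y.1 := by
    intro y hy
    have hy1 : y.1 ∈ Metric.ball (B z).1 r := by
      rw [← ball_prod_same] at hy
      exact hy.1
    have h2 : c.toLeafSpace (B.symm y) = E.symm y.1 :=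
      (hsame _ hy _ (hmem y.1 hy1 _ hs0)).2 rfl
    have h3 : y.1 ∈ E.target := hy1
    exact ⟨h2 ▸ E.map_target h3, by rw [h2, E.right_inv h3]⟩
  refine ⟨E, i, B, B z, r, ⟨hB, hr, fun y hy => (hball hy).1, rfl, fun y hy => (hE y hy).1,
    fun y hy => (hE y hy).2⟩, ?_⟩
  simpa [B.left_inv hz] using (hE (B z) (Metric.mem_ball_self hr)).1

namespace IsLeafChart

variable {e e' : OpenPartialHomeomorph c.LeafSpace (Euc q)} {y₀ y₀' : Euc q × ℝ} {r r' : ℝ}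

theorem mk_mem_ball (he : c.IsLeafChart g ρ e i B y₀ r) {v : Euc q} (hv : v ∈ e.target) :
    ((v, y₀.2) : Euc q × ℝ) ∈ Metric.ball y₀ r := by
  rw [← ball_prod_same]
  exact ⟨he.target_eq ▸ hv, Metric.mem_ball_self he.pos⟩

theorem symm_apply (he : c.IsLeafChart g ρ e i B y₀ r) {v : Euc q} (hv : v ∈ e.target) :
    e.symm v = c.toLeafSpace (B.symm (v, y₀.2)) := by
  have h1 := he.mk_mem_ball hv
  rw [← e.left_inv (he.mem_source _ h1), he.apply_toLeafSpace _ h1]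

theorem contMDiffAt_symm (he : c.IsLeafChart g ρ e i B y₀ r) {v : Euc q} (hv : v ∈ e.target) :
    ContMDiffAt (𝓡 q) (𝓡 (q + 1)) ∞ (fun v => B.symm (v, y₀.2)) v := by
  have h1 : ContMDiffAt 𝓘(ℝ, Euc q × ℝ) (𝓡 (q + 1)) ∞ B.symm (v, y₀.2) :=
    he.isUnitBox.contMDiffOn_symm.contMDiffAt
      (B.open_target.mem_nhds (he.ball_subset (he.mk_mem_ball hv)))
  have h2 : ContMDiffAt (𝓡 q) 𝓘(ℝ, Euc q × ℝ) ∞ (fun v : Euc q => ((v, y₀.2) : Euc q × ℝ)) v :=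
    (contDiff_id.prodMk contDiff_const).contMDiff.contMDiffAt
  exact ContMDiffAt.comp (g := B.symm) (f := fun v : Euc q => ((v, y₀.2) : Euc q × ℝ)) v h1 h2

/-- A smooth map that preserves the leaves carries a neighbourhood of `x` into the box of the chart,
where the composite is the first coordinate. -/
theorem contMDiffAt_comp_toLeafSpace [T2Space M] (hρ : ContMDiff (𝓡 (q + 1)) 𝓘(ℝ, ℝ) ∞ ρ)
    (hρK : ∀ R, IsCompact {x | ρ x ≤ R}) (he : c.IsLeafChart g ρ e i B y₀ r) {x : M}
    (hx : c.toLeafSpace x ∈ e.source) :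
    ContMDiffAt (𝓡 (q + 1)) (𝓡 q) ∞ (fun y => e (c.toLeafSpace y)) x := by
  have h1 := he.mk_mem_ball (e.map_source hx)
  have h2 : c.leaf (B.symm (e (c.toLeafSpace x), y₀.2)) = c.leaf x := by
    rw [← toLeafSpace_eq_iff, ← he.symm_apply (e.map_source hx), e.left_inv hx]
  obtain ⟨f, hf, hfx, h3⟩ := exists_contMDiffAt_leaf_eq hρ hρK g h2
  have h4 : f x ∈ B.source := hfx ▸ B.map_target (he.ball_subset h1)
  have h5 : B (f x) ∈ Metric.ball y₀ r := by rwa [hfx, B.right_inv (he.ball_subset h1)]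
  have h6 : ∀ᶠ y in 𝓝 x, f y ∈ B.source ∩ B ⁻¹' Metric.ball y₀ r :=
    hf.continuousAt.preimage_mem_nhds (Filter.inter_mem (B.open_source.mem_nhds h4)
      ((B.continuousAt h4).preimage_mem_nhds (Metric.isOpen_ball.mem_nhds h5)))
  have h7 : ContMDiffAt (𝓡 (q + 1)) 𝓘(ℝ, Euc q × ℝ) ∞ (fun y => B (f y)) x :=
    ContMDiffAt.comp (g := B) (f := f) x
      (he.isUnitBox.contMDiffOn.contMDiffAt (B.open_source.mem_nhds h4)) hf
  have h8 : ContMDiffAt (𝓡 (q + 1)) (𝓡 q) ∞ (fun y => (B (f y)).1) x :=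
    ContMDiffAt.comp (g := fun y : Euc q × ℝ => y.1) (f := fun y => B (f y)) x
      contDiff_fst.contMDiff.contMDiffAt h7
  refine h8.congr_of_eventuallyEq ?_
  filter_upwards [h3, h6] with y hy hy'
  rw [← c.toLeafSpace_eq_iff.2 hy, ← he.apply_toLeafSpace _ hy'.2, B.left_inv hy'.1]

theorem contDiffOn_transition [T2Space M] (hρ : ContMDiff (𝓡 (q + 1)) 𝓘(ℝ, ℝ) ∞ ρ)
    (hρK : ∀ R, IsCompact {x | ρ x ≤ R}) (he : c.IsLeafChart g ρ e i B y₀ r)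
    (he' : c.IsLeafChart g ρ e' j B' y₀' r') :
    ContDiffOn ℝ ∞ (e.symm.trans e') (e.symm.trans e').source := by
  intro v hv
  rw [OpenPartialHomeomorph.trans_source] at hv
  have hv1 : v ∈ e.target := hv.1
  have hv2 : e.symm v ∈ e'.source := hv.2
  rw [he.symm_apply hv1] at hv2
  have h1 := ContMDiffAt.comp (g := fun y => e' (c.toLeafSpace y))
    (f := fun v => B.symm (v, y₀.2)) v (he'.contMDiffAt_comp_toLeafSpace hρ hρK hv2)
    (he.contMDiffAt_symm hv1)
  refine (h1.contDiffAt.congr_of_eventuallyEq ?_).contDiffWithinAt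
  filter_upwards [e.open_target.mem_nhds hv1] with v' hv'
  change e' (e.symm v') = _
  rw [he.symm_apply hv']
  rfl

end IsLeafChart

end HaefligerCocycle

namespace HaefligerCocycle

variable {q : ℕ} {M : Type u} [TopologicalSpace M]
  [ChartedSpace (Euc (q + 1)) M] [IsManifold (𝓡 (q + 1)) ∞ M]
  {c : HaefligerCocycle.{w} (q + 1) q M} {g : SmoothMetric (q + 1) M} {ρ : M → ℝ}
  {h : c.ι → Euc q → Euc q →L[ℝ] Euc q →L[ℝ] ℝ}
  {i j : c.ι} {B B' : OpenPartialHomeomorph M (Euc q × ℝ)}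
  {e : OpenPartialHomeomorph c.LeafSpace (Euc q)} {y₀ : Euc q × ℝ} {r : ℝ}

/-! ### The bundle of leaves -/

/-- The charts given by flow boxes make the space of leaves a charted space. -/
@[reducible] def leafChartedSpace
    (hex : ∀ b : c.LeafSpace, ∃ e i B y₀ r, c.IsLeafChart g ρ e i B y₀ r ∧ b ∈ e.source) :
    ChartedSpace (Euc q) c.LeafSpace where
  atlas := {e | ∃ i B y₀ r, c.IsLeafChart g ρ e i B y₀ r}
  chartAt b := (hex b).choose
  mem_chart_source b := by
    obtain ⟨-, -, -, -, -, hb⟩ := (hex b).choose_spec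
    exact hb
  chart_mem_atlas b := by
    obtain ⟨i, B, y₀, r, h1, -⟩ := (hex b).choose_spec
    exact ⟨i, B, y₀, r, h1⟩

/-- The chart has the smooth section `σ`. The inverse trivialization sends `(b, t)` to the point at
signed arc length `t` from `σ b`, with the leaves oriented by the box `B`. It is bijective because
unit curves are injective and fill the leaves. -/
theorem IsLeafChart.exists_partialDiffeomorph [T2Space M] [ChartedSpace (Euc q) c.LeafSpace]
    (H : c.Induces g h)
    (hcomp : c.IsTransversallyCompleteMetric g) (hρ : ContMDiff (𝓡 (q + 1)) 𝓘(ℝ, ℝ) ∞ ρ)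
    (hρK : ∀ R, IsCompact {x | ρ x ≤ R}) (hA : ∀ x, ¬ IsCompact (closure (c.leaf x)))
    (hp : ContMDiff (𝓡 (q + 1)) (𝓡 q) ∞ c.toLeafSpace) (he : c.IsLeafChart g ρ e i B y₀ r)
    (hes : ContMDiffOn (𝓡 q) (𝓡 q) ∞ e e.source) :
    ∃ Φ : PartialDiffeomorph (𝓡 (q + 1)) ((𝓡 q).prod 𝓘(ℝ, ℝ)) M (c.LeafSpace × ℝ) ∞,
      Φ.source = c.toLeafSpace ⁻¹' e.source ∧ Φ.target = e.source ×ˢ univ ∧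
        ∀ x ∈ c.toLeafSpace ⁻¹' e.source, (Φ x).1 = c.toLeafSpace x := by
  set p := c.toLeafSpace with hpdef
  let σ : c.LeafSpace → M := fun b => B.symm (e b, y₀.2)
  have hσB : ∀ b ∈ e.source, σ b ∈ B.source := fun b hb =>
    B.map_target (he.ball_subset (he.mk_mem_ball (e.map_source hb)))
  have hpσ : ∀ b ∈ e.source, p (σ b) = b := fun b hb => by
    rw [hpdef, ← he.symm_apply (e.map_source hb), e.left_inv hb]
  have hσ : ∀ b ∈ e.source, ContMDiffAt (𝓡 q) (𝓡 (q + 1)) ∞ σ b := fun b hb =>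
    ContMDiffAt.comp (g := fun v => B.symm (v, y₀.2)) (f := e) b
      (he.contMDiffAt_symm (e.map_source hb)) (hes.contMDiffAt (e.open_source.mem_nhds hb))
  have hL : ∀ b, ∃ ℓ, b ∈ e.source → c.IsUnitCurve g ρ ℓ univ ∧ ℓ 0 = σ b ∧ HasDir B ℓ 0 1 := by
    intro b
    by_cases hb : b ∈ e.source
    · obtain ⟨ℓ, hℓ⟩ := exists_isUnitCurve hρ hρK he.isUnitBox (hσB b hb) (Or.inl rfl)
      exact ⟨ℓ, fun _ => hℓ⟩
    · exact ⟨fun _ => σ b, fun h => absurd h hb⟩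
  choose L hL using hL
  have hpL : ∀ b ∈ e.source, ∀ t, p (L b t) = b := fun b hb t => by
    obtain ⟨h1, h2, -⟩ := hL b hb
    refine Eq.trans ?_ (hpσ b hb)
    rw [← h2]
    exact c.toLeafSpace_eq_iff.2 ((h1.leaf_eq_range hρ t).trans (h1.leaf_eq_range hρ 0).symm)
  have hθ : ∀ x, ∃ t, p x ∈ e.source → L (p x) t = x := by
    intro x
    by_cases hx : p x ∈ e.source
    · obtain ⟨h1, h2, -⟩ := hL _ hx
      have h3 : x ∈ c.leaf (L (p x) 0) := by
        rw [mem_leaf_iff hρ hρK g, ← c.toLeafSpace_eq_iff]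
        exact (hpL _ hx 0).symm
      rw [h1.leaf_eq_range hρ] at h3
      obtain ⟨t, ht⟩ := h3
      exact ⟨t, fun _ => ht⟩
    · exact ⟨0, fun h => absurd h hx⟩
  choose θ hθ using hθ
  have hinj : ∀ b ∈ e.source, Function.Injective (L b) := fun b hb =>
    (hL b hb).1.injective hρ hA
  -- Near `b₀` all the curves `L b` pass the same box in the same direction at time `t₀`, and their
  -- position there is a smooth function of `b`. Both maps of the trivialization are computed in
  -- this box.
  have hlocal : ∀ b₀ ∈ e.source, ∀ t₀, ∃ j B' ε, c.IsUnitBox g ρ j B' ∧ L b₀ t₀ ∈ B'.source ∧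
      ∃ F : c.LeafSpace → M, ContMDiffAt (𝓡 q) (𝓡 (q + 1)) ∞ F b₀ ∧ F b₀ = L b₀ t₀ ∧
        ∀ᶠ b in 𝓝 b₀, b ∈ e.source ∧ L b t₀ = F b ∧ HasDir B' (L b) t₀ ε := by
    intro b₀ hb₀ t₀
    obtain ⟨h1, h2, h3⟩ := hL b₀ hb₀
    obtain ⟨j, B', ε, hB', hd⟩ := h1.exists_hasDir t₀ trivial
    obtain ⟨f, hf, h4⟩ := h1.exists_transfer hρ he.isUnitBox h3 t₀ j B' ε hB' hd
    have h5 := h4.self_of_nhds _ h1 rfl h3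
    rw [h2] at hf h4 h5
    refine ⟨j, B', ε, hB', hd.mem, fun b => f (σ b),
      ContMDiffAt.comp (g := f) (f := σ) b₀ hf (hσ b₀ hb₀), h5.1.symm, ?_⟩
    filter_upwards [(hσ b₀ hb₀).continuousAt.eventually h4, e.open_source.mem_nhds hb₀]
      with b hb hbe
    obtain ⟨h6, h7, h8⟩ := hL b hbe
    exact ⟨hbe, hb _ h6 h7 h8⟩
  have hinv : ContMDiffOn ((𝓡 q).prod 𝓘(ℝ, ℝ)) (𝓡 (q + 1)) ∞
      (fun y : c.LeafSpace × ℝ => L y.1 y.2) (e.source ×ˢ univ) := by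
    rintro ⟨b₀, t₀⟩ ⟨hb₀, -⟩
    obtain ⟨j, B', ε, hB', hmem, F, hF, hF0, hev⟩ := hlocal b₀ hb₀ t₀
    have h1 : ContMDiffAt ((𝓡 q).prod 𝓘(ℝ, ℝ)) 𝓘(ℝ, Euc q × ℝ) ∞
        (fun y : c.LeafSpace × ℝ => B' (F y.1) + (0, ε * (y.2 - t₀))) (b₀, t₀) := by
      have h2 : ContMDiffAt (𝓡 q) 𝓘(ℝ, Euc q × ℝ) ∞ (fun b => B' (F b)) b₀ := by
        refine ContMDiffAt.comp (g := B') (f := F) b₀ ?_ hF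
        rw [hF0]
        exact hB'.contMDiffOn.contMDiffAt (B'.open_source.mem_nhds hmem)
      have h3 : ContMDiffAt ((𝓡 q).prod 𝓘(ℝ, ℝ)) 𝓘(ℝ, Euc q × ℝ) ∞
          (fun y : c.LeafSpace × ℝ => B' (F y.1)) (b₀, t₀) :=
        ContMDiffAt.comp (g := fun b => B' (F b)) (f := Prod.fst) (b₀, t₀) h2 contMDiffAt_fst
      have h4 : ContDiff ℝ ∞ (fun s : ℝ => ((0, ε * (s - t₀)) : Euc q × ℝ)) := by fun_prop
      have h5 : ContMDiffAt ((𝓡 q).prod 𝓘(ℝ, ℝ)) 𝓘(ℝ, Euc q × ℝ) ∞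
          (fun y : c.LeafSpace × ℝ => ((0, ε * (y.2 - t₀)) : Euc q × ℝ)) (b₀, t₀) :=
        ContMDiffAt.comp (g := fun s : ℝ => ((0, ε * (s - t₀)) : Euc q × ℝ)) (f := Prod.snd)
          (b₀, t₀) h4.contMDiff.contMDiffAt contMDiffAt_snd
      exact h3.add h5
    have h0 : B' (F b₀) + (0, ε * (t₀ - t₀)) = B' (L b₀ t₀) := by
      rw [hF0]
      simp [Prod.mk_zero_zero]
    have h2 : ContMDiffAt ((𝓡 q).prod 𝓘(ℝ, ℝ)) (𝓡 (q + 1)) ∞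
        (fun y : c.LeafSpace × ℝ => B'.symm (B' (F y.1) + (0, ε * (y.2 - t₀)))) (b₀, t₀) := by
      refine ContMDiffAt.comp (g := B'.symm)
        (f := fun y : c.LeafSpace × ℝ => B' (F y.1) + (0, ε * (y.2 - t₀))) (b₀, t₀) ?_ h1
      rw [h0]
      exact hB'.contMDiffOn_symm.contMDiffAt (B'.open_target.mem_nhds (B'.map_source hmem))
    have h3 : ∀ᶠ y : c.LeafSpace × ℝ in 𝓝 (b₀, t₀),
        B' (F y.1) + (0, ε * (y.2 - t₀)) ∈ B'.target := by
      refine h1.continuousAt.preimage_mem_nhds (B'.open_target.mem_nhds ?_)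
      rw [h0]
      exact B'.map_source hmem
    refine (h2.congr_of_eventuallyEq ?_).contMDiffWithinAt
    filter_upwards [h3, continuousAt_fst.eventually hev] with y hy hy'
    obtain ⟨h4, h5, h6⟩ := hy'
    rw [← h5] at hy ⊢
    exact ((hL _ h4).1.eq_of_mem_target hρ (mem_univ t₀) hB' h6 (mem_univ y.2) hy).1
  have hfun : ContMDiffOn (𝓡 (q + 1)) ((𝓡 q).prod 𝓘(ℝ, ℝ)) ∞
      (fun x => (p x, θ x)) (p ⁻¹' e.source) := by
    intro x hx
    refine (hp.contMDiffAt.prodMk ?_).contMDiffWithinAt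
    obtain ⟨j, B', ε, hB', hmem, F, hF, hF0, hev⟩ := hlocal (p x) hx (θ x)
    rw [hθ x hx] at hmem hF0
    -- For `x'` near `x`, the points `x'` and `F (p x')` of the same leaf lie in one plaque, so the
    -- arc length `θ x'` is read off from the difference of their heights.
    obtain ⟨V, hV, hVB⟩ := hB'.exists_nhds_fst_eq H hcomp hρ hρK hA hmem
    have hFp : ContMDiffAt (𝓡 (q + 1)) (𝓡 (q + 1)) ∞ (fun x' => F (p x')) x :=
      ContMDiffAt.comp (g := F) (f := p) x hF hp.contMDiffAt
    have hB'x : ContMDiffAt (𝓡 (q + 1)) 𝓘(ℝ, Euc q × ℝ) ∞ B' x :=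
      hB'.contMDiffOn.contMDiffAt (B'.open_source.mem_nhds hmem)
    have hBF : ContMDiffAt (𝓡 (q + 1)) 𝓘(ℝ, Euc q × ℝ) ∞ (fun x' => B' (F (p x'))) x := by
      refine ContMDiffAt.comp (g := B') (f := fun x' => F (p x')) x ?_ hFp
      rwa [hF0]
    have h1 : ContDiff ℝ ∞ (fun y : (Euc q × ℝ) × (Euc q × ℝ) => θ x + ε * (y.1.2 - y.2.2)) := by
      fun_prop
    have h2 : ContMDiffAt (𝓡 (q + 1)) 𝓘(ℝ, ℝ) ∞
        (fun x' => θ x + ε * ((B' x').2 - (B' (F (p x'))).2)) x :=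
      ContMDiffAt.comp (g := fun y : (Euc q × ℝ) × (Euc q × ℝ) => θ x + ε * (y.1.2 - y.2.2))
        (f := fun x' => (B' x', B' (F (p x')))) x h1.contMDiff.contMDiffAt
        (hB'x.prodMk_space hBF)
    refine h2.congr_of_eventuallyEq ?_
    have h3 : ∀ᶠ x' in 𝓝 x, F (p x') ∈ V :=
      hFp.continuousAt.preimage_mem_nhds (by rwa [hF0])
    filter_upwards [hp.continuous.continuousAt.eventually hev, h3, hV,
      B'.open_source.mem_nhds hmem] with x' h4 h5 h6 h7
    obtain ⟨h8, h9, h10⟩ := h4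
    refine hinj _ h8 ?_
    have h11 : F (p x') ∈ c.leaf x' := by
      rw [mem_leaf_iff hρ hρK g, ← c.toLeafSpace_eq_iff, ← h9]
      exact hpL _ h8 _
    have h12 := hVB x' h6 _ h5 h11
    rw [← h9] at h12 ⊢
    rw [hθ x' h8]
    exact (hL _ h8).1.eq_of_fst_eq hρ hB' h10 h7 h12
  refine ⟨{ toFun := fun x => (p x, θ x)
            invFun := fun y => L y.1 y.2
            source := p ⁻¹' e.source
            target := e.source ×ˢ univ
            map_source' := fun x hx => ⟨hx, trivial⟩
            map_target' := fun y hy => ?_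
            left_inv' := fun x hx => hθ x hx
            right_inv' := fun y hy => ?_
            open_source := e.open_source.preimage hp.continuous
            open_target := e.open_source.prod isOpen_univ
            contMDiffOn_toFun := hfun
            contMDiffOn_invFun := hinv }, rfl, rfl, fun _ _ => rfl⟩
  · change p (L y.1 y.2) ∈ e.source
    rw [hpL _ hy.1]
    exact hy.1
  · have h1 := hpL _ hy.1 y.2
    refine Prod.ext h1 (hinj _ hy.1 ?_)
    have h2 := hθ (L y.1 y.2) (by rw [h1]; exact hy.1)
    rwa [h1] at h2

/-- If no leaf is relatively compact, then the leaves are the fibres of a bundle with fibre `ℝ`. -/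
theorem exists_bundle [T2Space M] [SecondCountableTopology M] (H : c.Induces g h)
    (hcomp : c.IsTransversallyCompleteMetric g) (hA : ∀ x, ¬ IsCompact (closure (c.leaf x))) :
    Foliation.IsRBundle (Quot.mk _ c : Foliation.{w} (q + 1) q M) := by
  obtain ⟨ρ, hρ, hρK⟩ := exists_smooth_exhaustion (q + 1) M
  have hex := exists_isLeafChart H hcomp hρ hρK hA
  let _ := leafChartedSpace hex
  have hman : IsManifold (𝓡 q) ∞ c.LeafSpace := by
    refine isManifold_of_contDiffOn (𝓡 q) ∞ c.LeafSpace ?_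
    rintro e e' ⟨i, B, y₀, r, he⟩ ⟨j, B', y₀', r', he'⟩
    simpa using he.contDiffOn_transition hρ hρK he'
  have hp : ContMDiff (𝓡 (q + 1)) (𝓡 q) ∞ c.toLeafSpace := by
    intro x
    obtain ⟨i, B, y₀, r, he⟩ := chart_mem_atlas (Euc q) (c.toLeafSpace x)
    refine contMDiffAt_iff_target.2 ⟨c.continuous_toLeafSpace.continuousAt, ?_⟩
    exact he.contMDiffAt_comp_toLeafSpace hρ hρK (mem_chart_source _ _)
  have hop := isOpenMap_toLeafSpace (c := c) hρ hρK g
  refine ⟨c.LeafSpace, inferInstance, inferInstance, c.toLeafSpace,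
    t2Space_leafSpace H hcomp hρ hρK hA, TopologicalSpace.Quotient.secondCountableTopology hop, hman, hp,
    fun b => ?_, fun x => ?_⟩
  · obtain ⟨i, B, y₀, r, he⟩ := chart_mem_atlas (Euc q) b
    exact ⟨_, (chartAt (Euc q) b).open_source, mem_chart_source _ _,
      he.exists_partialDiffeomorph H hcomp hρ hρK hA hp contMDiffOn_chart⟩
  · ext y
    exact (mem_leaf_iff hρ hρK g).trans c.toLeafSpace_eq_iff.symm

end HaefligerCocycle

theorem mainTheorem2 (q : ℕ) (M : Type u) [TopologicalSpace M] [T2Space M]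
    [SecondCountableTopology M] [ConnectedSpace M]
    [ChartedSpace (EuclideanSpace ℝ (Fin (q + 1))) M] [IsManifold (𝓡 (q + 1)) ∞ M]
    (F : Foliation.{w} (q + 1) q M) (hF : F.IsRiemannian) (hc : F.IsTransversallyComplete) :
    F.IsRBundle ∨ ∀ x : M, IsCompact (closure (F.leaf x)) := by
  obtain ⟨c, rfl, g, ⟨h, hh, hg⟩, hcomp⟩ := hc
  have H : c.Induces g h := ⟨hh, hg⟩
  by_cases hA : ∃ x, IsCompact (closure (c.leaf x))
  · obtain ⟨x₀, hx₀⟩ := hA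
    obtain ⟨ρ, hρ, hρK⟩ := exists_smooth_exhaustion (q + 1) M
    exact Or.inr fun x =>
      HaefligerCocycle.isCompact_closure_leaf_of_exists H hcomp hρ hρK hx₀ x
  · exact Or.inl (HaefligerCocycle.exists_bundle H hcomp (not_exists.1 hA))

end
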